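/- Fix a partition $\mu$, viewed as a finite subset of $\mathbb{Z}_{\ge 0}^2$ closed under decreasing coordinates, integers $i_1,\dots,i_k\ge 0$ ($k\ge 0$), and an integer $a>0$. Let $\mu[x_1,x_2]\subset\mathbb{C}[x_1,x_2]$ be the ideal spanned by the monomials $x_1^ix_2^j$ with $(i,j)\notin\mu$, and let $$M_3=\mathbb{C}[x_3,x_3^{-1}]\otimes\mathbb{C}[x_1,x_2]/\mu[x_1,x_2],$$ a $\mathbb{C}[x_1,x_2,x_3]$-module with the action of $\mathbf{T}=(\mathbb{C}^*)^3$ given by $(t_1,t_2,t_3)\cdot x_i=t_ix_i$. The fixed loci $Q_U$ are the finitely generated $\mathbf{T}$-invariant $\mathbb{C}[x_1,x_2,x_3]$-submodules of $M_3/\langle 1\rangle$. Put $$\mathsf{F}_\mu=\sum_{(i,j)\in\mu}t_1^it_2^j,\qquad \mathsf{F}_U=\frac{\mathsf{F}_\mu}{1-t_3}+\operatorname{tr}(Q_U)\in\mathbb{Q}(t_1,t_2,t_3),$$ where $\operatorname{tr}(Q_U)$ is the $\mathbf{T}$-character of the finite-dimensional representation $Q_U$. Let the bar denote $t_i\mapsto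 t_i^{-1}$, and let $$\mathsf{G}_\mu=-\mathsf{F}_\mu-\frac{\overline{\mathsf{F}}_\mu}{t_1t_2}+\mathsf{F}_\mu\overline{\mathsf{F}}_\mu\frac{(1-t_1)(1-t_2)}{t_1t_2},$$ $$\mathsf{V}_U=\mathsf{F}_U-\frac{\overline{\mathsf{F}}_U}{t_1t_2t_3}+\mathsf{F}_U\overline{\mathsf{F}}_U\frac{(1-t_1)(1-t_2)(1-t_3)}{t_1t_2t_3}+\frac{\mathsf{G}_\mu}{1-t_3},$$ which is a Laurent polynomial in $t_1,t_2,t_3$. The descendent weight of $Q_U$ is $$\mathsf{w}_{i_1,\dots,i_k}(Q_U)=e(-\mathsf{V}_U)\prod_{j=1}^k\mathrm{ch}_{2+i_j}\big(\mathsf{F}_U(1-t_1)(1-t_2)(1-t_3)\big)\in\mathbb{Q}(s_1,s_2,s_3),$$ where, for a Laurent polynomial $\sum_w c_w t^w$ and $w\cdot s=w_1s_1+w_2s_2+w_3s_3$, $$e\Big(\sum_w c_wt^w\Big)=\prod_w(w\cdot s)^{c_w},\qquad \mathrm{ch}_n\Big(\sum_w c_wt^w\Big)=\sum_w c_w\frac{(w\cdot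 s)^n}{n!}.$$ For a Laurent polynomial $f\in\mathbb{Z}[t_1,t_2,(t_1t_2)^{-1/a}]$, let $\mathcal{S}_f$ be the set of those $Q_U$ for which the Laurent polynomial $(1-t_3)\mathsf{F}_U$ satisfies $(1-t_3)\mathsf{F}_U|_{t_3=(t_1t_2)^{1/a}}=f$. Proposition 4.2. For each $f\in\mathbb{Z}[t_1,t_2,(t_1t_2)^{-1/a}]$, the set $\mathcal{S}_f$ is finite and the evaluation $$\Big(\sum_{Q_U\in\mathcal{S}_f}\mathsf{w}_{i_1,\dots,i_k}(Q_U)\Big)\Big|_{s_3=\frac1a(s_1+s_2)}\in\mathbb{Q}(s_1,s_2)$$ is well-defined, that is, the sum is a quotient of polynomials in $s_1,s_2,s_3$ over $\mathbb{Q}$ whose denominator does not vanish identically on the plane $s_3=\frac1a(s_1+s_2)$. Moreover, for fixed $\mu$, $i_1,\dots,i_k$ and $a$, the evaluation vanishes for all but finitely many $f$. -/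

import Mathlib

open scoped TensorProduct LaurentPolynomial

noncomputable section

namespace OneLeg

/-! ### The module `M₃` and the torus-fixed stable pairs -/

/-- The coordinate ring `ℂ[x₁,x₂,x₃]` of the affine chart `U`. -/
abbrev R3 : Type := MvPolynomial (Fin 3) ℂ

/-- The torus `𝐓 = (ℂ*)³`. -/
abbrev Torus : Type := Fin 3 → ℂˣ

/-- The monomial ideal `μ[x₁,x₂] ⊆ ℂ[x₁,x₂]`, spanned by the monomials `x₁^i x₂^j` with
`(i,j) ∉ μ`. -/
def monomialIdeal (μ : YoungDiagram) : Ideal (MvPolynomial (Fin 2) ℂ) :=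
  Ideal.span {p | ∃ i j : ℕ, (i, j) ∉ μ ∧ p = MvPolynomial.X 0 ^ i * MvPolynomial.X 1 ^ j}

/-- `M₃ = ℂ[x₃,x₃⁻¹] ⊗ ℂ[x₁,x₂] / μ[x₁,x₂]`. -/
def M3 (μ : YoungDiagram) : Type :=
  ℂ[T;T⁻¹] ⊗[ℂ] (MvPolynomial (Fin 2) ℂ ⧸ monomialIdeal μ)

instance (μ : YoungDiagram) : CommRing (M3 μ) :=
  inferInstanceAs (CommRing (ℂ[T;T⁻¹] ⊗[ℂ] (MvPolynomial (Fin 2) ℂ ⧸ monomialIdeal μ)))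

instance (μ : YoungDiagram) : Algebra ℂ (M3 μ) :=
  inferInstanceAs (Algebra ℂ (ℂ[T;T⁻¹] ⊗[ℂ] (MvPolynomial (Fin 2) ℂ ⧸ monomialIdeal μ)))

/-- The element `x₃^n ⊗ p` of `M₃`. -/
def M3.mk (μ : YoungDiagram) (n : ℤ) (p : MvPolynomial (Fin 2) ℂ) : M3 μ :=
  (LaurentPolynomial.T n : ℂ[T;T⁻¹]) ⊗ₜ[ℂ] Ideal.Quotient.mk (monomialIdeal μ) p

theorem M3.mk_mul (μ : YoungDiagram) (m n : ℤ) (p q : MvPolynomial (Fin 2) ℂ) :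
    M3.mk μ m p * M3.mk μ n q = M3.mk μ (m + n) (p * q) := by
  unfold M3.mk
  rw [LaurentPolynomial.T_add, map_mul]
  exact Algebra.TensorProduct.tmul_mul_tmul ..

theorem M3.mk_smul (μ : YoungDiagram) (n : ℤ) (c : ℂ) (p : MvPolynomial (Fin 2) ℂ) :
    M3.mk μ n (c • p) = c • M3.mk μ n p :=
  TensorProduct.tmul_smul c (LaurentPolynomial.T n : ℂ[T;T⁻¹])
    (Ideal.Quotient.mk (monomialIdeal μ) p)

theorem M3.mk_zero_one (μ : YoungDiagram) : M3.mk μ 0 1 = 1 := rfl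

/-- The elements `x₃^n ⊗ p` span `M₃`. -/
theorem M3.span_mk (μ : YoungDiagram) :
    Submodule.span ℂ {m : M3 μ | ∃ n p, m = M3.mk μ n p} = ⊤ := by
  refine eq_top_iff.2 fun m _ => ?_
  refine TensorProduct.induction_on (motive := fun m : M3 μ =>
    m ∈ Submodule.span ℂ {m : M3 μ | ∃ n p, m = M3.mk μ n p}) m (zero_mem _) ?_
    (fun x y hx hy => add_mem hx hy)
  intro f p
  obtain ⟨p, rfl⟩ := Ideal.Quotient.mk_surjective p
  induction f using LaurentPolynomial.induction_on' with
  | add f g hf hg => rw [TensorProduct.add_tmul]; exact add_mem hf hg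
  | C_mul_T n a =>
    rw [← LaurentPolynomial.smul_eq_C_mul]
    have : M3.mk μ n p ∈ {m : M3 μ | ∃ n p, m = M3.mk μ n p} := ⟨n, p, rfl⟩
    exact Submodule.smul_mem _ a (Submodule.subset_span this)

/-- The coordinates `x₁, x₂, x₃` as elements of `M₃`. -/
def coordM3 (μ : YoungDiagram) : Fin 3 → M3 μ :=
  ![M3.mk μ 0 (MvPolynomial.X 0), M3.mk μ 0 (MvPolynomial.X 1), M3.mk μ 1 1]

/-- `M₃` as a `ℂ[x₁,x₂,x₃]`-algebra (in particular, a `ℂ[x₁,x₂,x₃]`-module). -/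
instance (μ : YoungDiagram) : Algebra R3 (M3 μ) :=
  (MvPolynomial.aeval (R := ℂ) (coordM3 μ)).toRingHom.toAlgebra

theorem algebraMap_R3_apply (μ : YoungDiagram) (r : R3) :
    algebraMap R3 (M3 μ) r = MvPolynomial.aeval (coordM3 μ) r := rfl

instance (μ : YoungDiagram) : IsScalarTower ℂ R3 (M3 μ) :=
  IsScalarTower.of_algebraMap_eq fun c => by
    rw [algebraMap_R3_apply, MvPolynomial.algebraMap_eq, MvPolynomial.aeval_C]

/-- The action of the third factor `ℂ*` on `ℂ[x₃,x₃⁻¹]`, with `c · x₃ = c x₃`. -/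
def laurentScale (c : ℂˣ) : ℂ[T;T⁻¹] →ₐ[ℂ] ℂ[T;T⁻¹] :=
  AddMonoidAlgebra.lift ℂ ℂ[T;T⁻¹] ℤ
    { toFun := fun n => ((c ^ n.toAdd : ℂˣ) : ℂ) • LaurentPolynomial.T n.toAdd
      map_one' := by simp
      map_mul' := fun m n => by
        rw [toAdd_mul, zpow_add, Units.val_mul, LaurentPolynomial.T_add, smul_mul_smul_comm] }

theorem laurentScale_T (c : ℂˣ) (n : ℤ) :
    laurentScale c (LaurentPolynomial.T n) = ((c ^ n : ℂˣ) : ℂ) • LaurentPolynomial.T n := by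
  rw [laurentScale, LaurentPolynomial.T, AddMonoidAlgebra.lift_single, one_smul]
  rfl

/-- The action of `(c₁,c₂)` on `ℂ[x₁,x₂]`, with `xᵢ ↦ cᵢ xᵢ`. -/
def planeScale (c₁ c₂ : ℂˣ) : MvPolynomial (Fin 2) ℂ →ₐ[ℂ] MvPolynomial (Fin 2) ℂ :=
  MvPolynomial.aeval ![(c₁ : ℂ) • MvPolynomial.X 0, (c₂ : ℂ) • MvPolynomial.X 1]

theorem monomialIdeal_le_comap (μ : YoungDiagram) (c₁ c₂ : ℂˣ) :
    monomialIdeal μ ≤ (monomialIdeal μ).comap (planeScale c₁ c₂) := by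
  refine Ideal.span_le.2 ?_
  rintro _ ⟨i, j, hij, rfl⟩
  have h : planeScale c₁ c₂ (MvPolynomial.X 0 ^ i * MvPolynomial.X 1 ^ j) =
      MvPolynomial.C ((c₁ : ℂ) ^ i * (c₂ : ℂ) ^ j) *
        (MvPolynomial.X 0 ^ i * MvPolynomial.X 1 ^ j) := by
    simp only [planeScale, map_mul, map_pow, MvPolynomial.aeval_X, Matrix.cons_val_zero,
      Matrix.cons_val_one, MvPolynomial.smul_eq_C_mul]
    ring
  change planeScale c₁ c₂ _ ∈ monomialIdeal μ
  rw [h]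
  exact Ideal.mul_mem_left _ _ (Ideal.subset_span ⟨i, j, hij, rfl⟩)

/-- The action of `𝐓` on `M₃` by algebra automorphisms, with `(t₁,t₂,t₃) · xᵢ = tᵢ xᵢ`. -/
def actM3 (μ : YoungDiagram) (t : Torus) : M3 μ →ₐ[ℂ] M3 μ :=
  Algebra.TensorProduct.map (laurentScale (t 2))
    (Ideal.quotientMapₐ (monomialIdeal μ) (planeScale (t 0) (t 1))
      (monomialIdeal_le_comap μ (t 0) (t 1)))

/-- The action of `𝐓` on `ℂ[x₁,x₂,x₃]`, with `(t₁,t₂,t₃) · xᵢ = tᵢ xᵢ`. -/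
def actR3 (t : Torus) : R3 →ₐ[ℂ] R3 :=
  MvPolynomial.aeval fun i => ((t i : ℂˣ) : ℂ) • MvPolynomial.X i

theorem actM3_mk (μ : YoungDiagram) (t : Torus) (n : ℤ) (p : MvPolynomial (Fin 2) ℂ) :
    actM3 μ t (M3.mk μ n p) = ((t 2 ^ n : ℂˣ) : ℂ) • M3.mk μ n (planeScale (t 0) (t 1) p) := by
  have h : actM3 μ t (M3.mk μ n p) = laurentScale (t 2) (LaurentPolynomial.T n) ⊗ₜ[ℂ]
      Ideal.Quotient.mk (monomialIdeal μ) (planeScale (t 0) (t 1) p) := rfl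
  rw [h, laurentScale_T]
  rfl

theorem actM3_coord (μ : YoungDiagram) (t : Torus) (i : Fin 3) :
    actM3 μ t (coordM3 μ i) = ((t i : ℂˣ) : ℂ) • coordM3 μ i := by
  fin_cases i
  · change actM3 μ t (M3.mk μ 0 (MvPolynomial.X 0)) = (t 0 : ℂ) • M3.mk μ 0 (MvPolynomial.X 0)
    rw [actM3_mk, zpow_zero, Units.val_one, one_smul, ← M3.mk_smul]
    simp [planeScale]
  · change actM3 μ t (M3.mk μ 0 (MvPolynomial.X 1)) = (t 1 : ℂ) • M3.mk μ 0 (MvPolynomial.X 1)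
    rw [actM3_mk, zpow_zero, Units.val_one, one_smul, ← M3.mk_smul]
    simp [planeScale]
  · change actM3 μ t (M3.mk μ 1 1) = (t 2 : ℂ) • M3.mk μ 1 1
    rw [actM3_mk, zpow_one, map_one]

theorem actM3_algebraMap (μ : YoungDiagram) (t : Torus) (r : R3) :
    actM3 μ t (algebraMap R3 (M3 μ) r) = algebraMap R3 (M3 μ) (actR3 t r) := by
  have h : (actM3 μ t).comp (MvPolynomial.aeval (coordM3 μ)) =
      (MvPolynomial.aeval (coordM3 μ)).comp (actR3 t) := by
    refine MvPolynomial.algHom_ext fun i => ?_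
    simp [actR3, actM3_coord]
  exact congrArg (fun φ : R3 →ₐ[ℂ] M3 μ => φ r) h

/-- The action of `t ∈ 𝐓` on `M₃` is semilinear over the action on `ℂ[x₁,x₂,x₃]`. -/
def actM3ₛ (μ : YoungDiagram) (t : Torus) : M3 μ →ₛₗ[(actR3 t : R3 →+* R3)] M3 μ where
  toFun := actM3 μ t
  map_add' := map_add _
  map_smul' r m := by
    rw [Algebra.smul_def, Algebra.smul_def, map_mul, actM3_algebraMap]
    rfl

/-- The submodule `⟨1⟩ = 𝒪_{C_μ} ⊆ M₃`. -/
def unitSubmodule (μ : YoungDiagram) : Submodule R3 (M3 μ) := Submodule.span R3 {1}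

/-- The action of `𝐓` on `M₃ / ⟨1⟩`. -/
def actQuot (μ : YoungDiagram) (t : Torus) :
    (M3 μ ⧸ unitSubmodule μ) →ₛₗ[(actR3 t : R3 →+* R3)] (M3 μ ⧸ unitSubmodule μ) :=
  Submodule.mapQ (unitSubmodule μ) (unitSubmodule μ) (actM3ₛ μ t) (by
    refine Submodule.span_le.2 ?_
    rintro _ rfl
    have : actM3ₛ μ t 1 = 1 := map_one (actM3 μ t)
    change actM3ₛ μ t 1 ∈ unitSubmodule μ
    rw [this]
    exact Submodule.mem_span_singleton_self (R := R3) (1 : M3 μ))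

theorem actQuot_smul (μ : YoungDiagram) (t : Torus) (c : ℂ) (q : M3 μ ⧸ unitSubmodule μ) :
    actQuot μ t (c • q) = c • actQuot μ t q := by
  rw [← algebraMap_smul R3 c q, map_smulₛₗ]
  have : (actR3 t : R3 →+* R3) (algebraMap ℂ R3 c) = algebraMap ℂ R3 c :=
    (actR3 t).commutes c
  rw [this, algebraMap_smul]

/-- The `𝐓`-fixed loci `Q_U`: finitely generated `𝐓`-invariant `ℂ[x₁,x₂,x₃]`-submodules of
`M₃ / ⟨1⟩`. -/
structure FixedLocus (μ : YoungDiagram) where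
  /-- the underlying submodule -/
  Q : Submodule R3 (M3 μ ⧸ unitSubmodule μ)
  fg : Q.FG
  invariant : ∀ (t : Torus), ∀ q ∈ Q, actQuot μ t q ∈ Q

/-- The eigenspace of weight `t₁^{w₁} t₂^{w₂} t₃^{w₃}` in `M₃ / ⟨1⟩`. -/
def weightSpace (μ : YoungDiagram) (w : Fin 3 → ℤ) : Submodule ℂ (M3 μ ⧸ unitSubmodule μ) where
  carrier := {q | ∀ t : Torus, actQuot μ t q = (∏ i, ((t i : ℂˣ) : ℂ) ^ w i) • q}
  zero_mem' t := by simp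
  add_mem' hp hq t := by rw [map_add, hp t, hq t, smul_add]
  smul_mem' c q hq t := by rw [actQuot_smul, hq t, smul_comm]

/-! ### Finiteness of the character of `Q_U` -/

theorem X_two_smul_mk (μ : YoungDiagram) (K : ℕ) (n : ℤ) (p : MvPolynomial (Fin 2) ℂ) :
    (MvPolynomial.X 2 ^ K : R3) • M3.mk μ n p = M3.mk μ (K + n) p := by
  rw [Algebra.smul_def, map_pow, algebraMap_R3_apply, MvPolynomial.aeval_X]
  have h : ∀ K : ℕ, coordM3 μ 2 ^ K = M3.mk μ K 1 := by
    intro K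
    induction K with
    | zero => simp [M3.mk_zero_one]
    | succ K ih =>
      rw [pow_succ, ih]
      change M3.mk μ K 1 * M3.mk μ 1 1 = _
      rw [M3.mk_mul]
      simp
  rw [h, M3.mk_mul, one_mul]

theorem mk_zero_mem (μ : YoungDiagram) (n : ℕ) (p : MvPolynomial (Fin 2) ℂ) :
    M3.mk μ n p ∈ unitSubmodule μ := by
  have h0 : M3.mk μ 0 p ∈ unitSubmodule μ := by
    refine Submodule.mem_span_singleton.2 ⟨MvPolynomial.rename (Fin.castSucc) p, ?_⟩
    rw [Algebra.smul_def, mul_one, algebraMap_R3_apply, MvPolynomial.aeval_rename]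
    have : (MvPolynomial.aeval (R := ℂ) (coordM3 μ ∘ Fin.castSucc)) =
        (Algebra.TensorProduct.includeRight.comp (Ideal.Quotient.mkₐ ℂ (monomialIdeal μ)) :
          MvPolynomial (Fin 2) ℂ →ₐ[ℂ] M3 μ) := by
      refine MvPolynomial.algHom_ext fun i => ?_
      rw [MvPolynomial.aeval_X]
      fin_cases i <;> rfl
    rw [this]
    rfl
  have := X_two_smul_mk μ n 0 p
  rw [add_zero] at this
  rw [← this]
  exact Submodule.smul_mem _ _ h0

theorem exists_X_two_pow_smul_mem (μ : YoungDiagram) (m : M3 μ) :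
    ∃ K : ℕ, ∀ k, K ≤ k → (MvPolynomial.X 2 ^ k : R3) • m ∈ unitSubmodule μ := by
  have hm : m ∈ Submodule.span ℂ {m : M3 μ | ∃ n p, m = M3.mk μ n p} := by
    rw [M3.span_mk]; trivial
  induction hm using Submodule.span_induction with
  | mem x hx =>
    obtain ⟨n, p, rfl⟩ := hx
    refine ⟨n.natAbs, fun k hk => ?_⟩
    rw [X_two_smul_mk]
    obtain ⟨l, hl⟩ : ∃ l : ℕ, (k : ℤ) + n = l := ⟨(k + n).toNat, by omega⟩
    rw [hl]
    exact mk_zero_mem μ l p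
  | zero => exact ⟨0, fun k _ => by simp⟩
  | add x y _ _ hx hy =>
    obtain ⟨K, hK⟩ := hx
    obtain ⟨L, hL⟩ := hy
    refine ⟨max K L, fun k hk => ?_⟩
    rw [smul_add]
    exact add_mem (hK k (le_trans (le_max_left _ _) hk)) (hL k (le_trans (le_max_right _ _) hk))
  | smul c x _ hx =>
    obtain ⟨K, hK⟩ := hx
    refine ⟨K, fun k hk => ?_⟩
    rw [smul_comm, ← algebraMap_smul R3 c]
    exact Submodule.smul_mem _ _ (hK k hk)

theorem exists_X_pow_smul_eq_zero (μ : YoungDiagram) (i : Fin 3)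
    (q : M3 μ ⧸ unitSubmodule μ) :
    ∃ K : ℕ, ∀ k, K ≤ k → (MvPolynomial.X i ^ k : R3) • q = 0 := by
  obtain ⟨m, rfl⟩ := Submodule.mkQ_surjective _ q
  suffices h : ∃ K : ℕ, ∀ k, K ≤ k → (MvPolynomial.X i ^ k : R3) • m ∈ unitSubmodule μ by
    obtain ⟨K, hK⟩ := h
    refine ⟨K, fun k hk => ?_⟩
    rw [← map_smul]
    exact (Submodule.Quotient.mk_eq_zero _).2 (hK k hk)
  have key : ∀ (j : Fin 2) (N : ℕ),
      Ideal.Quotient.mk (monomialIdeal μ) (MvPolynomial.X j ^ N) = 0 → ∀ k, N ≤ k →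
      (coordM3 μ j.castSucc) ^ k * m = 0 := by
    intro j N hN k hk
    have h1 : ∀ k : ℕ, coordM3 μ j.castSucc ^ k = M3.mk μ 0 (MvPolynomial.X j ^ k) := by
      intro k
      have h2 : coordM3 μ j.castSucc = M3.mk μ 0 (MvPolynomial.X j) := by fin_cases j <;> rfl
      induction k with
      | zero => simp [M3.mk_zero_one]
      | succ k ih => rw [pow_succ, pow_succ, ih, h2, M3.mk_mul, add_zero]
    rw [← Nat.add_sub_cancel' hk, pow_add, h1 N]
    unfold M3.mk
    rw [hN, TensorProduct.tmul_zero]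
    change (0 : M3 μ) * _ * _ = 0
    rw [zero_mul, zero_mul]
  have mem0 : ∀ m' : M3 μ, m' = 0 → m' ∈ unitSubmodule μ := by
    rintro _ rfl; exact zero_mem _
  obtain ⟨N, hN⟩ : ∃ N : ℕ, ∀ c ∈ μ.cells, c.1 < N ∧ c.2 < N :=
    ⟨μ.cells.sup (fun c => c.1 + c.2) + 1, fun c hc => by
      have : c.1 + c.2 ≤ μ.cells.sup (fun c => c.1 + c.2) :=
        Finset.le_sup (f := fun c : ℕ × ℕ => c.1 + c.2) hc
      omega⟩
  fin_cases i
  · refine ⟨N, fun k hk => mem0 _ ?_⟩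
    rw [Algebra.smul_def, map_pow, algebraMap_R3_apply, MvPolynomial.aeval_X]
    refine key 0 N ?_ k hk
    refine Ideal.Quotient.eq_zero_iff_mem.2 (Ideal.subset_span ⟨N, 0, fun h => ?_, by simp⟩)
    have := (hN _ ((YoungDiagram.mem_cells _).2 h)).1
    simp at this
  · refine ⟨N, fun k hk => mem0 _ ?_⟩
    rw [Algebra.smul_def, map_pow, algebraMap_R3_apply, MvPolynomial.aeval_X]
    refine key 1 N ?_ k hk
    refine Ideal.Quotient.eq_zero_iff_mem.2 (Ideal.subset_span ⟨0, N, fun h => ?_, by simp⟩)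
    have := (hN _ ((YoungDiagram.mem_cells _).2 h)).2
    simp at this
  · exact exists_X_two_pow_smul_mem μ m

theorem span_singleton_finite (μ : YoungDiagram) (q : M3 μ ⧸ unitSubmodule μ) :
    Module.Finite ℂ (Submodule.span R3 {q}) := by
  choose K hK using fun i => exists_X_pow_smul_eq_zero μ i q
  set D : Finset (Fin 3 →₀ ℕ) := Finset.Iic (Finsupp.equivFunOnFinite.symm K) with hD
  set S : Submodule ℂ (M3 μ ⧸ unitSubmodule μ) :=
    Submodule.span ℂ ((fun d => (MvPolynomial.monomial d (1 : ℂ) : R3) • q) '' (D : Set _)) with hS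
  have hfin : Module.Finite ℂ S := Module.Finite.span_of_finite ℂ ((Finset.finite_toSet D).image _)
  have hmon : ∀ d : Fin 3 →₀ ℕ, (MvPolynomial.monomial d (1 : ℂ) : R3) • q ∈ S := by
    intro d
    by_cases hd : d ∈ D
    · exact Submodule.subset_span ⟨d, hd, rfl⟩
    · obtain ⟨i, hi⟩ : ∃ i, K i < d i := by
        by_contra! h
        exact hd (by rw [hD, Finset.mem_Iic]; exact h)
      have hdi : d = (d - Finsupp.single i (d i)) + Finsupp.single i (d i) := by
        rw [tsub_add_cancel_of_le]
        intro j
        by_cases hj : i = j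
        · subst hj; simp
        · simp [hj]
      have : (MvPolynomial.monomial d (1 : ℂ) : R3) • q = 0 := by
        rw [hdi, ← one_mul (1 : ℂ), ← MvPolynomial.monomial_mul, mul_smul,
          ← MvPolynomial.X_pow_eq_monomial, hK i _ hi.le, smul_zero]
      rw [this]
      exact zero_mem _
  have hle : (Submodule.span R3 {q}).restrictScalars ℂ ≤ S := by
    intro x hx
    obtain ⟨r, rfl⟩ := Submodule.mem_span_singleton.1 (Submodule.restrictScalars_mem _ _ _ |>.1 hx)
    induction r using MvPolynomial.induction_on' with
    | monomial d c =>
      have : (MvPolynomial.monomial d c : R3) = c • MvPolynomial.monomial d (1 : ℂ) := by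
        rw [MvPolynomial.smul_monomial, smul_eq_mul, mul_one]
      rw [this, smul_assoc]
      exact Submodule.smul_mem _ _ (hmon d)
    | add p r hp hr =>
      rw [add_smul]
      exact add_mem
        (hp (Submodule.smul_mem _ _ (Submodule.mem_span_singleton_self q)))
        (hr (Submodule.smul_mem _ _ (Submodule.mem_span_singleton_self q)))
  exact Submodule.finiteDimensional_of_le hle

namespace FixedLocus

variable {μ : YoungDiagram} (L : FixedLocus μ)

theorem finite : Module.Finite ℂ (L.Q.restrictScalars ℂ) := by
  refine Submodule.fg_induction
    (motive := fun (N : Submodule R3 (M3 μ ⧸ unitSubmodule μ)) _ =>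
      Module.Finite ℂ (N.restrictScalars ℂ))
    (fun q => span_singleton_finite μ q) (fun N₁ N₂ _ _ h₁ h₂ => ?_) L.Q L.fg
  rw [Submodule.restrictScalars_sup]
  exact Submodule.finite_sup _ _

/-- The `w`-eigenspace of `Q_U`. -/
def weightPart (w : Fin 3 → ℤ) : Submodule ℂ (M3 μ ⧸ unitSubmodule μ) :=
  L.Q.restrictScalars ℂ ⊓ weightSpace μ w

theorem finite_weights : {w : Fin 3 → ℤ | Module.finrank ℂ (L.weightPart w) ≠ 0}.Finite := by
  have := L.finite
  have key : ∀ i : Fin 3, ∃ s : Set ℤ, s.Finite ∧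
      ∀ w, Module.finrank ℂ (L.weightPart w) ≠ 0 → w i ∈ s := by
    intro i
    set t : Torus := Function.update 1 i (Units.mk0 2 two_ne_zero) with ht
    let φ : Module.End ℂ (L.Q.restrictScalars ℂ) :=
      { toFun := fun q => ⟨actQuot μ t q, L.invariant t q q.2⟩
        map_add' := fun p q => Subtype.ext (map_add _ _ _)
        map_smul' := fun c q => Subtype.ext (actQuot_smul μ t c q) }
    refine ⟨{n : ℤ | φ.HasEigenvalue ((2 : ℂ) ^ n)}, ?_, fun w hw => ?_⟩
    · refine Set.Finite.preimage ?_ (Module.End.finite_hasEigenvalue φ)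
      intro m _ n _ hmn
      have h2 : ((2 : ℝ) ^ m : ℝ) = 2 ^ n := by
        have : (((2 : ℝ) ^ m : ℝ) : ℂ) = ((2 : ℝ) ^ n : ℝ) := by push_cast; exact hmn
        exact_mod_cast this
      exact zpow_right_injective₀ (by norm_num) (by norm_num) h2
    · have hne : L.weightPart w ≠ ⊥ := by
        intro h
        rw [h] at hw
        exact hw (finrank_bot ℂ _)
      obtain ⟨q, hq, hq0⟩ := Submodule.exists_mem_ne_zero_of_ne_bot hne
      refine Module.End.hasEigenvalue_of_hasEigenvector (x := ⟨q, hq.1⟩)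
        ⟨Module.End.mem_eigenspace_iff.2 (Subtype.ext ?_), fun h => hq0 (congrArg Subtype.val h)⟩
      change actQuot μ t q = (2 : ℂ) ^ w i • q
      rw [hq.2 t]
      congr 1
      rw [Finset.prod_eq_single i]
      · simp [ht]
      · intro j _ hj
        simp [ht, hj]
      · simp
  choose s hs hws using key
  refine (Set.Finite.pi' hs).subset fun w hw i => hws i w hw

end FixedLocus

/-! ### Characters -/

/-- Laurent polynomials `ℤ[t₁^±,t₂^±,t₃^±]`. -/
abbrev Laurent : Type := AddMonoidAlgebra ℤ (Fin 3 → ℤ)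

/-- The field `ℚ(t₁,t₂,t₃)`, the fraction field of the ring of Laurent polynomials. -/
abbrev CharField : Type := FractionRing Laurent

/-- The variable `tᵢ` as a Laurent polynomial. -/
def tvar (i : Fin 3) : Laurent := AddMonoidAlgebra.single (Pi.single i 1) 1

/-- The variable `tᵢ` in `ℚ(t₁,t₂,t₃)`. -/
def tK (i : Fin 3) : CharField := algebraMap Laurent CharField (tvar i)

/-- The bar operation `tᵢ ↦ tᵢ⁻¹` on Laurent polynomials. -/
def barLaurent : Laurent ≃+* Laurent :=
  (AddMonoidAlgebra.domCongr ℤ ℤ (AddEquiv.neg (Fin 3 → ℤ))).toRingEquiv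

/-- The bar operation `tᵢ ↦ tᵢ⁻¹` on `ℚ(t₁,t₂,t₃)`. -/
def bar : CharField ≃+* CharField := IsFractionRing.ringEquivOfRingEquiv barLaurent

theorem bar_algebraMap (P : Laurent) :
    bar (algebraMap Laurent CharField P) = algebraMap Laurent CharField (barLaurent P) := by
  simp [bar]

theorem barLaurent_tvar_mul (i : Fin 3) : barLaurent (tvar i) * tvar i = 1 := by
  have : barLaurent (tvar i) = AddMonoidAlgebra.single (-Pi.single i 1) 1 :=
    AddMonoidAlgebra.domCongr_single (R := ℤ) (A := ℤ) ..
  rw [this, tvar, AddMonoidAlgebra.single_mul_single, neg_add_cancel, one_mul]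
  rfl

theorem tK_ne_zero (i : Fin 3) : tK i ≠ 0 := by
  intro h
  have := congrArg (algebraMap Laurent CharField) (barLaurent_tvar_mul i)
  rw [map_mul, map_one] at this
  change _ * tK i = 1 at this
  rw [h, mul_zero] at this
  exact zero_ne_one this

theorem algebraMap_barLaurent_tvar (i : Fin 3) :
    algebraMap Laurent CharField (barLaurent (tvar i)) = (tK i)⁻¹ := by
  refine eq_inv_of_mul_eq_one_left ?_
  rw [tK, ← map_mul, barLaurent_tvar_mul, map_one]

theorem bar_tK (i : Fin 3) : bar (tK i) = (tK i)⁻¹ := by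
  rw [← algebraMap_barLaurent_tvar, tK, bar_algebraMap]

theorem one_sub_tK_ne_zero (i : Fin 3) : 1 - tK i ≠ 0 := by
  intro h
  have h1 : algebraMap Laurent CharField 1 = algebraMap Laurent CharField (tvar i) := by
    rw [map_one]; exact sub_eq_zero.1 h
  have h2 := IsFractionRing.injective Laurent CharField h1
  have h3 : (1 : Laurent) = AddMonoidAlgebra.single 0 1 := rfl
  rw [h3, tvar] at h2
  have h4 := congrArg (fun P : Laurent => P.coeff 0) h2
  have h5 : (Pi.single i 1 : Fin 3 → ℤ) ≠ 0 := by simp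
  rw [AddMonoidAlgebra.coeff_single, AddMonoidAlgebra.coeff_single, Finsupp.single_eq_same,
    Finsupp.single_eq_of_ne h5.symm] at h4
  exact one_ne_zero h4

/-- `𝖥_μ = ∑_{(k₁,k₂) ∈ μ} t₁^{k₁} t₂^{k₂}`. -/
def charPartition (μ : YoungDiagram) : Laurent :=
  ∑ c ∈ μ.cells, AddMonoidAlgebra.single ![(c.1 : ℤ), (c.2 : ℤ), 0] 1

/-- `𝖦_μ = - 𝖥_μ - \bar 𝖥_μ / (t₁t₂) + 𝖥_μ \bar 𝖥_μ (1-t₁)(1-t₂) / (t₁t₂)`. -/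
def edgeCharacter (μ : YoungDiagram) : CharField :=
  let F : CharField := algebraMap Laurent CharField (charPartition μ);
  -F - bar F / (tK 0 * tK 1) + F * bar F * ((1 - tK 0) * (1 - tK 1) / (tK 0 * tK 1))

namespace FixedLocus

variable {μ : YoungDiagram} (L : FixedLocus μ)

/-- The `𝐓`-character of the finite-dimensional representation `Q_U`: the coefficient of `t^w`
is the dimension of the `w`-eigenspace. -/
def charQ : Laurent :=
  AddMonoidAlgebra.ofCoeff (Finsupp.ofSupportFinite
    (fun w => (Module.finrank ℂ (L.weightPart w) : ℤ))
    (L.finite_weights.subset fun w hw h => hw (by simp [h])))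

/-- The `𝐓`-character `𝖥_U` of `F_U`, as a rational function, from
`0 → 𝒪_{C_μ} → F_U → Q_U → 0`, where `𝒪_{C_μ} = ℂ[x₁,x₂,x₃] / μ[x₁,x₂]` has character
`𝖥_μ / (1 - t₃)`. -/
def charF : CharField :=
  algebraMap Laurent CharField (charPartition μ) / (1 - tK 2) +
    algebraMap Laurent CharField L.charQ

/-- The `𝐓`-character of `R - χ(𝕀_U, 𝕀_U)`:
`𝖥_U - \bar 𝖥_U / (t₁t₂t₃) + 𝖥_U \bar 𝖥_U (1-t₁)(1-t₂)(1-t₃) / (t₁t₂t₃)`. -/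
def tangentCharacter : CharField :=
  L.charF - bar L.charF / (tK 0 * tK 1 * tK 2) +
    L.charF * bar L.charF * ((1 - tK 0) * (1 - tK 1) * (1 - tK 2) / (tK 0 * tK 1 * tK 2))

/-- The vertex character `𝖵_U`, as a rational function. -/
def vertexRational : CharField := L.tangentCharacter + edgeCharacter μ / (1 - tK 2)

theorem exists_vertex : ∃ V : Laurent, algebraMap Laurent CharField V = L.vertexRational := by
  refine ⟨L.charQ - barLaurent (tvar 2) * barLaurent L.charQ * barLaurent (tvar 0) *
      barLaurent (tvar 1) - (charPartition μ * barLaurent L.charQ * (-barLaurent (tvar 2)) +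
      L.charQ * barLaurent (charPartition μ) + (1 - barLaurent (tvar 2)) * L.charQ *
      barLaurent L.charQ) * (1 - barLaurent (tvar 0)) * (1 - barLaurent (tvar 1)), ?_⟩
  have h0 := tK_ne_zero 0
  have h1 := tK_ne_zero 1
  have h2 := tK_ne_zero 2
  have h3 := one_sub_tK_ne_zero 2
  have h4 : 1 - (tK 2)⁻¹ = -(1 - tK 2) / tK 2 := by field_simp; ring
  simp only [vertexRational, tangentCharacter, edgeCharacter, charF, map_add, map_sub, map_mul,
    map_neg, map_one, map_div₀, bar_algebraMap, bar_tK, algebraMap_barLaurent_tvar, h4]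
  generalize algebraMap Laurent CharField L.charQ = D
  generalize algebraMap Laurent CharField (barLaurent L.charQ) = D'
  generalize algebraMap Laurent CharField (charPartition μ) = F
  generalize algebraMap Laurent CharField (barLaurent (charPartition μ)) = F'
  generalize tK 0 = x at *
  generalize tK 1 = y at *
  generalize tK 2 = z at *
  field_simp
  ring

/-- The vertex character `𝖵_U`, a Laurent polynomial in `t₁, t₂, t₃`. -/
def vertex : Laurent := L.exists_vertex.choose

theorem exists_slice :
    ∃ P : Laurent, algebraMap Laurent CharField P = (1 - tK 2) * L.charF := by
  refine ⟨charPartition μ + (1 - tvar 2) * L.charQ, ?_⟩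
  have h := one_sub_tK_ne_zero 2
  rw [charF, mul_add, mul_div_cancel₀ _ h]
  simp [tK]

/-- The Laurent polynomial `(1 - t₃) 𝖥_U`. -/
def slice : Laurent := L.exists_slice.choose

theorem exists_descendent : ∃ P : Laurent, algebraMap Laurent CharField P =
    L.charF * ((1 - tK 0) * (1 - tK 1) * (1 - tK 2)) := by
  obtain ⟨P, hP⟩ := L.exists_slice
  refine ⟨P * (1 - tvar 0) * (1 - tvar 1), ?_⟩
  rw [map_mul, map_mul, hP]
  simp only [map_sub, map_one]
  change _ * (1 - tK 0) * (1 - tK 1) = _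
  ring

/-- The Laurent polynomial `𝖥_U · (1-t₁)(1-t₂)(1-t₃)`. -/
def descendentCharacter : Laurent := L.exists_descendent.choose

end FixedLocus

/-! ### Equivariant weights -/

/-- `ℚ(s₁,s₂,s₃)`. -/
abbrev SField : Type := FractionRing (MvPolynomial (Fin 3) ℚ)

/-- The weight `w₁s₁ + w₂s₂ + w₃s₃` of the character `t₁^{w₁} t₂^{w₂} t₃^{w₃}`. -/
def weight (w : Fin 3 → ℤ) : SField :=
  algebraMap (MvPolynomial (Fin 3) ℚ) SField (∑ i, (w i : ℚ) • MvPolynomial.X i)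

/-- The Euler class of a virtual representation, `e(∑ c_w t^w) = ∏ (w₁s₁ + w₂s₂ + w₃s₃)^{c_w}`
(for a virtual representation without trivial summand). -/
def euler (γ : Laurent) : SField := γ.coeff.prod fun w c => weight w ^ c

/-- The Chern character `ch_n(∑ c_w t^w) = ∑ c_w (w₁s₁ + w₂s₂ + w₃s₃)^n / n!`. -/
def chern (n : ℕ) (γ : Laurent) : SField :=
  γ.coeff.sum fun w c => (c : SField) * (weight w ^ n / (n.factorial : SField))

/-- The descendent weight
`𝗐_{i₁,…,i_k}(Q_U) = e(-𝖵_U) ∏_j ch_{2+i_j}(𝖥_U · (1-t₁)(1-t₂)(1-t₃))`. -/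
def FixedLocus.descendentWeight {μ : YoungDiagram} {k : ℕ} (i : Fin k → ℕ) (L : FixedLocus μ) :
    SField :=
  euler (-L.vertex) * ∏ j, chern (2 + i j) L.descendentCharacter

/-! ### The sets `𝒮_f` and the evaluation at `s₃ = (s₁+s₂)/a` -/

/-- Finite sums `∑ c t₁^x t₂^y` with `c ∈ ℤ` and rational exponents `x, y`. -/
abbrev FracLaurent : Type := AddMonoidAlgebra ℤ (ℚ × ℚ)

/-- The ring `ℤ[t₁, t₂, (t₁t₂)^{-1/a}]`. -/
def fracRing (a : ℕ) : Subalgebra ℤ FracLaurent :=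
  Algebra.adjoin ℤ {AddMonoidAlgebra.single (1, 0) 1, AddMonoidAlgebra.single (0, 1) 1,
    AddMonoidAlgebra.single (-(1 / (a : ℚ)), -(1 / (a : ℚ))) 1}

/-- The substitution `t₃ = (t₁t₂)^{1/a}`. -/
def substT3 (a : ℕ) : Laurent →+* FracLaurent :=
  AddMonoidAlgebra.mapDomainRingHom ℤ
    ({ toFun := fun w => ((w 0 : ℚ) + w 2 / a, (w 1 : ℚ) + w 2 / a)
       map_zero' := by simp
       map_add' := fun v w => by ext <;> simp <;> ring } : (Fin 3 → ℤ) →+ ℚ × ℚ)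

/-- `𝒮_f`, the set of `Q_U` with `(1-t₃) 𝖥_U |_{t₃ = (t₁t₂)^{1/a}} = f`. -/
def lociOver (μ : YoungDiagram) (a : ℕ) (f : FracLaurent) : Set (FixedLocus μ) :=
  {L | substT3 a L.slice = f}

/-- The sum of the descendent weights over `𝒮_f`. -/
def weightSum (μ : YoungDiagram) (a : ℕ) {k : ℕ} (i : Fin k → ℕ) (f : FracLaurent) : SField :=
  ∑ᶠ L ∈ lociOver μ a f, L.descendentWeight i

/-- The restriction of a polynomial to the hyperplane `s₃ = (s₁+s₂)/a`. -/
def restrictPoly (a : ℕ) : MvPolynomial (Fin 3) ℚ →ₐ[ℚ] MvPolynomial (Fin 2) ℚ :=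
  MvPolynomial.aeval ![MvPolynomial.X 0, MvPolynomial.X 1,
    (1 / (a : ℚ)) • (MvPolynomial.X 0 + MvPolynomial.X 1)]

/-- The rational function `x ∈ ℚ(s₁,s₂,s₃)` has a well-defined evaluation at `s₃ = (s₁+s₂)/a`,
and `y ∈ ℚ(s₁,s₂)` is the value: `x = p/q` where the polynomial `q` does not vanish identically
on the hyperplane, and `y = p|/q|`. -/
def HasEvaluation (a : ℕ) (x : SField) (y : FractionRing (MvPolynomial (Fin 2) ℚ)) : Prop :=
  ∃ p q : MvPolynomial (Fin 3) ℚ, restrictPoly a q ≠ 0 ∧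
    x = algebraMap _ SField p / algebraMap _ SField q ∧
    y = algebraMap _ (FractionRing (MvPolynomial (Fin 2) ℚ)) (restrictPoly a p) /
      algebraMap _ (FractionRing (MvPolynomial (Fin 2) ℚ)) (restrictPoly a q)

end OneLeg

end

/-!
A fixed locus `Q_U` is a weakly increasing function `h` on the boxes of `μ`: the monomials over the
box `(i, j)` that lie in `Q_U` are `x₁^i x₂^j x₃^(-k)` with `1 ≤ k ≤ h(i, j)`
(`FixedLocus.height_mono`, `FixedLocus.exists_height_eq`). Let `a i - h(i, j)` be the level of a box
and `i - j` its content. The restriction of `(1 - t₃) 𝖥_U` to `t₃ = (t₁t₂)^(1/a)` records the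
multiset of pairs (content, level), so the elements of `𝒮_f` are the distributions of this multiset
over the boxes of `μ` for which the resulting heights are nonnegative and increasing. Numbering the
pairs, the slots, by `Fin n`, these become permutations `σ` of `Fin n` that preserve the contents.

Let `ε = s₁ + s₂ - a s₃`. The character `-𝖵_U` is a sum of lines of weights `m ε - D s₂ + l s₃`,
where `m` is a difference of first coordinates of boxes (`FixedLocus.neg_vertex_eq`). Up to a part
that is the same for all `σ`, the numbers `D` and the range of `l` depend only on the slots. A
weight vanishes on the plane `ε = 0` only if `D = l = 0`. Hence the weight of `Q_U` is `ε^d R(σ)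
H(σ)` (`exists_descendentWeight_eq`), with a rational number `R(σ) = rootNumer / rootDenom`,
quotient of products of the integers `m`, a degree `d = rootDegree` that does not depend on `σ`, and
a function `H` that is a polynomial in the numbers `ε i` with coefficients that have no pole along
`ε = 0`. Moreover `R(σ) = 0` for those `σ` that do not come from a fixed locus. Expanding `H` in
monomials reduces the absence of poles, and the vanishing at `ε = 0`, to the vanishing of the sums
`∑ R(σ) ∏ i(σ s)^(α s)` in low degree (`sum_root_terms_eq_zero`). If there is a threshold `t ≤ 0`
such that some level is less than `t`, but none lies in the interval `[t - a, t)`, then the range of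
degrees includes the one that is responsible for the restriction to `ε = 0`. Since such a gap exists
if some level is less than `-a(n+1)` (`exists_gap`), and there are finitely many `h` without such a
level, the evaluation vanishes for almost all `f`.

For the vanishing of these sums, fix the order ideal that is occupied by the slots above the
threshold. The slots of given content, on a given side of the threshold, fill an interval of a
diagonal. Among the corresponding permutations, those in which no forbidden pair of slots is
adjacent are like the torus-fixed points of a regular nilpotent Hessenberg variety, with the
denominator of `R` as Euler class. The roots in the numerator of `R` split into two products, for
the pairs of diagonals `(c, c + 1)` with `c` even and with `c` odd, each of which vanishes at the
orders with a forbidden adjacent pair. Then `sum_eval_mul_eval_div_eq_zero` says that the sum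
vanishes below the dimension of the variety; it follows from a Poincaré duality, which is proved by
linear algebra from a nonsingular family of polynomials (`exists_separating_family`) and the
antisymmetrisation of polynomials of low degree (`sum_eval_div_vand_eq_zero`). The comparison of the
degrees is a count of pairs of boxes on the same and on adjacent diagonals (`card_cross`).
-/

noncomputable section

namespace OneLeg

/-! ### Sums over permutations of antisymmetric functions -/

section Antisymmetry

open Finset MvPolynomial

variable {n : ℕ} (d : Fin n → ℤ)

/-- Permutations of the slots that preserve the node of every slot. -/
def nodePerms : Finset (Equiv.Perm (Fin n)) := univ.filter fun ρ => ∀ s, d (ρ s) = d s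

theorem mem_nodePerms {ρ : Equiv.Perm (Fin n)} : ρ ∈ nodePerms d ↔ ∀ s, d (ρ s) = d s := by
  simp [nodePerms]

/-- The pairs `(s', s)` with `s' < s` of slots in the same node. -/
def nodePairs : Finset (Fin n × Fin n) := univ.filter fun q => q.1 < q.2 ∧ d q.1 = d q.2

/-- The product of the Vandermonde determinants of all nodes. -/
def vand (X : Fin n → ℚ) : ℚ := ∏ q ∈ nodePairs d, (X q.2 - X q.1)

theorem prod_nodePairs (f : Fin n → Fin n → ℚ) :
    ∏ q ∈ nodePairs d, f q.1 q.2 =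
      ∏ j, ∏ i ∈ Iio j, if d i = d j then f i j else 1 := by
  rw [nodePairs, prod_filter, ← univ_product_univ, prod_product_right]
  refine prod_congr rfl fun j _ => ?_
  have : (Iio j : Finset (Fin n)) = univ.filter fun i => i < j := by ext; simp
  rw [this, prod_filter]
  refine prod_congr rfl fun i _ => ?_
  by_cases h : i < j <;> simp [h]

theorem vand_comp (X : Fin n → ℚ) {ρ : Equiv.Perm (Fin n)} (hρ : ρ ∈ nodePerms d) :
    vand d (X ∘ ρ) = (Equiv.Perm.sign ρ : ℤ) * vand d X := by
  rw [mem_nodePerms] at hρ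
  -- Pairs in different nodes get an antisymmetric sign, so that the sign of `ρ` can be read off.
  let g : Fin n → Fin n → ℚ := fun i j => if d i = d j then 1 else if d i < d j then 1 else -1
  let f : Fin n → Fin n → ℚ := fun i j => (if d i = d j then X j - X i else 1) * g i j
  have hf : ∀ i j, f i j = -f j i := by
    intro i j
    simp only [f, g]
    rcases lt_trichotomy (d i) (d j) with h | h | h
    · simp [h, h.ne, h.ne', h.not_gt]
    · simp [h]
    · simp [h, h.ne, h.ne', h.not_gt]
  have key := ρ.prod_Iio_comp_eq_sign_mul_prod hf
  have hg : (∏ j, ∏ i ∈ Iio j, g i j) ≠ 0 := by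
    refine prod_ne_zero_iff.2 fun j _ => prod_ne_zero_iff.2 fun i _ => ?_
    simp only [g]
    split_ifs <;> norm_num
  have h1 : ∀ Y : Fin n → ℚ, vand d Y =
      ∏ j, ∏ i ∈ Iio j, if d i = d j then Y j - Y i else 1 :=
    fun Y => prod_nodePairs d fun i j => Y j - Y i
  have h2 : ∏ j, ∏ i ∈ Iio j, f (ρ i) (ρ j) =
      vand d (X ∘ ρ) * ∏ j, ∏ i ∈ Iio j, g i j := by
    rw [h1, ← prod_mul_distrib]
    refine prod_congr rfl fun j _ => ?_
    rw [← prod_mul_distrib]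
    refine prod_congr rfl fun i _ => ?_
    simp [f, g, hρ]
  have h3 : ∏ j, ∏ i ∈ Iio j, f i j = vand d X * ∏ j, ∏ i ∈ Iio j, g i j := by
    rw [h1, ← prod_mul_distrib]
    refine prod_congr rfl fun j _ => ?_
    rw [← prod_mul_distrib]
  rw [h2, h3, ← mul_assoc] at key
  exact mul_right_cancel₀ hg key

/-- A tuple of exponents that separates the slots of each node has large total degree. -/
theorem card_nodePairs_le_sum (α : Fin n → ℕ)
    (hα : ∀ s s', d s = d s' → α s = α s' → s = s') : #(nodePairs d) ≤ ∑ s, α s := by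
  have h1 : #(nodePairs d) ≤
      #((univ : Finset (Fin n × Fin n)).filter fun q => d q.1 = d q.2 ∧ α q.1 < α q.2) := by
    refine card_le_card_of_injOn
      (fun q => if α q.1 < α q.2 then (q.1, q.2) else (q.2, q.1)) ?_ ?_
    · intro q hq
      simp only [nodePairs, coe_filter, mem_univ, true_and, Set.mem_ofPred_eq] at hq ⊢
      have hne : α q.1 ≠ α q.2 := fun h => hq.1.ne (hα _ _ hq.2 h)
      split_ifs with h
      · exact ⟨hq.2, h⟩
      · exact ⟨hq.2.symm, lt_of_le_of_ne (not_lt.1 h) hne.symm⟩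
    · intro q hq q' hq' h
      simp only [nodePairs, coe_filter, mem_univ, true_and, Set.mem_ofPred_eq] at hq hq'
      simp only at h
      split_ifs at h <;> simp only [Prod.mk.injEq] at h
      · exact Prod.ext h.1 h.2
      · have := hq.1; have := hq'.1
        rw [h.1, h.2] at *
        omega
      · have := hq.1; have := hq'.1
        rw [h.1, h.2] at *
        omega
      · exact Prod.ext h.2 h.1
  refine h1.trans ?_
  rw [card_eq_sum_card_fiberwise (f := Prod.snd) (t := univ) (fun _ _ => mem_univ _)]
  refine sum_le_sum fun s _ => ?_
  refine (card_le_card_of_injOn (t := range (α s)) (fun q => α q.1) ?_ ?_).trans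
    (card_range _).le
  · intro q hq
    simp only [coe_filter, mem_filter, mem_univ, true_and, Set.mem_ofPred_eq] at hq
    simp only [coe_range, Set.mem_Iio]
    rw [← hq.2]; exact hq.1.2
  · intro q hq q' hq' h
    simp only [coe_filter, mem_filter, mem_univ, true_and, Set.mem_ofPred_eq] at hq hq'
    refine Prod.ext (hα _ _ ?_ h) (hq.2.trans hq'.2.symm)
    rw [hq.1.1, hq'.1.1, hq.2, hq'.2]

theorem sum_sign_mul_monomial_eq_zero (p : Fin n → ℚ) (α : Fin n → ℕ)
    (hα : ∑ s, α s < #(nodePairs d)) :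
    ∑ ρ ∈ nodePerms d, ((Equiv.Perm.sign ρ : ℤ) : ℚ) * ∏ s, p (ρ s) ^ α s = 0 := by
  obtain ⟨s, s', hd, ha, hne⟩ : ∃ s s', d s = d s' ∧ α s = α s' ∧ s ≠ s' := by
    by_contra! h
    exact absurd (card_nodePairs_le_sum d α h) (not_le.2 hα)
  refine sum_involution (fun ρ _ => ρ * Equiv.swap s s') ?_ ?_ ?_ ?_
  · intro ρ _
    have h1 : ∏ u, p ((ρ * Equiv.swap s s') u) ^ α u = ∏ u, p (ρ u) ^ α u := by
      rw [← Equiv.prod_comp (Equiv.swap s s')]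
      refine prod_congr rfl fun u _ => ?_
      have : α (Equiv.swap s s' u) = α u := by
        rcases eq_or_ne u s with rfl | h
        · simp [ha]
        · rcases eq_or_ne u s' with rfl | h'
          · simp [ha]
          · rw [Equiv.swap_apply_of_ne_of_ne h h']
      simp [this]
    rw [h1, Equiv.Perm.sign_mul, Equiv.Perm.sign_swap hne]
    push_cast
    ring
  · intro ρ _ _ h
    have := congrArg (fun τ : Equiv.Perm (Fin n) => τ s) h
    simp only [Equiv.Perm.mul_apply, Equiv.swap_apply_left] at this
    exact hne (ρ.injective this).symm
  · intro ρ hρ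
    rw [mem_nodePerms] at hρ ⊢
    intro u
    rw [Equiv.Perm.mul_apply, hρ]
    rcases eq_or_ne u s with rfl | h
    · simp [hd]
    · rcases eq_or_ne u s' with rfl | h'
      · simp [hd]
      · rw [Equiv.swap_apply_of_ne_of_ne h h']
  · intro ρ _
    simp [mul_assoc]

/-- The antisymmetrisation of a polynomial of degree less than that of the Vandermonde product
vanishes. -/
theorem sum_eval_div_vand_eq_zero (p : Fin n → ℚ) (P : MvPolynomial (Fin n) ℚ)
    (hP : P.totalDegree < #(nodePairs d)) :
    ∑ ρ ∈ nodePerms d, eval (p ∘ ρ) P / vand d (p ∘ ρ) = 0 := by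
  have h1 : ∀ ρ ∈ nodePerms d, eval (p ∘ ρ) P / vand d (p ∘ ρ) =
      (((Equiv.Perm.sign ρ : ℤ) : ℚ) * eval (p ∘ ρ) P) * (vand d p)⁻¹ := by
    intro ρ hρ
    rw [vand_comp d p hρ]
    rcases Int.units_eq_one_or (Equiv.Perm.sign ρ) with h | h
    · rw [h]; simp [div_eq_mul_inv]
    · rw [h]; simp [div_eq_mul_inv]
  rw [sum_congr rfl h1, ← sum_mul]
  convert zero_mul _
  simp_rw [eval_eq', mul_sum]
  rw [sum_comm]
  refine sum_eq_zero fun α hα => ?_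
  have h2 := sum_sign_mul_monomial_eq_zero d p α (lt_of_le_of_lt (by
    have := le_totalDegree hα
    rwa [Finsupp.sum_fintype _ _ (fun _ => rfl)] at this) hP)
  calc _ = coeff α P * ∑ ρ ∈ nodePerms d, ((Equiv.Perm.sign ρ : ℤ) : ℚ) *
        ∏ s, p (ρ s) ^ α s := by
        rw [mul_sum]
        refine sum_congr rfl fun ρ _ => ?_
        simp only [Function.comp_apply]
        ring
    _ = 0 := by rw [h2, mul_zero]

end Antisymmetry

/-! ### Arrangements of intervals on a line -/

section Arrangements

open Finset MvPolynomial

variable {n : ℕ}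

/-- Slots `i ∈ s`, each occupying an interval `[X i, X i + len i)` of the line of its node `c i`,
so that the intervals of every node are stacked without gaps from the origin `o` of the node,
and an interval of `i` is followed directly by one of `k` only if `R i k`. -/
structure Arrangement (c : Fin n → ℤ) (o : ℤ → ℤ) (R : Fin n → Fin n → Prop)
    (s : Finset (Fin n)) (len X : Fin n → ℤ) : Prop where
  zero : ∀ i ∉ s, X i = 0
  start_inj : ∀ i ∈ s, ∀ j ∈ s, c i = c j → X i = X j → i = j
  stop_inj : ∀ i ∈ s, ∀ j ∈ s, c i = c j → X i + len i = X j + len j → i = j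
  pred : ∀ i ∈ s, X i = o (c i) ∨ ∃ j ∈ s, c j = c i ∧ X j + len j = X i
  follow : ∀ i ∈ s, ∀ k ∈ s, c i = c k → X k = X i + len i → R i k

namespace Arrangement

variable {c : Fin n → ℤ} {o : ℤ → ℤ} {R : Fin n → Fin n → Prop} {s : Finset (Fin n)}
  {len X : Fin n → ℤ}

theorem origin_le (h : Arrangement c o R s len X) (hlen : ∀ i ∈ s, 0 < len i) :
    ∀ i ∈ s, o (c i) ≤ X i := by
  intro i
  have hw : WellFounded fun i j : Fin n => X i < X j :=
    @Finite.wellFounded_of_trans_of_irrefl _ _ _ ⟨fun _ _ _ => lt_trans⟩ ⟨fun _ => lt_irrefl _⟩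
  induction i using hw.induction with
  | _ i ih =>
    intro hi
    rcases h.pred i hi with h1 | ⟨j, hj, hc, hX⟩
    · exact h1.ge
    · have := hlen j hj
      have := ih j (by omega) hj
      rw [hc] at this
      omega

/-- Intervals of the same node do not overlap. -/
theorem stop_le (h : Arrangement c o R s len X) (hlen : ∀ i ∈ s, 0 < len i) :
    ∀ j ∈ s, ∀ i ∈ s, c i = c j → X i < X j → X i + len i ≤ X j := by
  intro j
  have hw : WellFounded fun i j : Fin n => X i < X j :=
    @Finite.wellFounded_of_trans_of_irrefl _ _ _ ⟨fun _ _ _ => lt_trans⟩ ⟨fun _ => lt_irrefl _⟩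
  induction j using hw.induction with
  | _ j ih =>
    intro hj i hi hc hlt
    rcases h.pred j hj with h1 | ⟨k, hk, hck, hX⟩
    · have := h.origin_le hlen i hi
      rw [hc] at this
      omega
    · have := hlen k hk
      rcases lt_trichotomy (X k) (X i) with h2 | h2 | h2
      · have := ih i hlt hi k hk (hck.trans hc.symm) h2
        omega
      · rw [h.start_inj i hi k hk (hc.trans hck.symm) h2.symm]
        omega
      · have := ih k (by omega) hk i hi (hc.trans hck.symm) h2
        omega

variable {m k : Fin n}

/-- Inserting the smallest slot `m` directly before `k`, whose interval is cut in two. -/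
theorem insert_before (hge : ∀ i j, i ≤ j → R j i) (hm : ∀ i ∈ s, m < i)
    (hk : k ∈ s) (hck : c k = c m) (hR : R m k) (hlen : ∀ i ∈ insert m s, 0 < len i)
    (h : Arrangement c o R s (Function.update len k (len m + len k)) X) :
    Arrangement c o R (insert m s) len
      (Function.update (Function.update X k (X k + len m)) m (X k)) := by
  have hmk := (hm k hk).ne
  have hms : m ∉ s := fun h => lt_irrefl _ (hm m h)
  have lm := hlen m (mem_insert_self _ _)
  have lk := hlen k (mem_insert_of_mem hk)
  set len' := Function.update len k (len m + len k) with hlen'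
  have l1 : len' k = len m + len k := by simp [hlen']
  have l2 : ∀ i, i ≠ k → len' i = len i := fun i hi => by simp [hlen', hi]
  have lpos : ∀ i ∈ s, 0 < len' i := by
    intro i hi
    rcases eq_or_ne i k with rfl | hik
    · omega
    · rw [l2 i hik]; exact hlen i (mem_insert_of_mem hi)
  set Y := Function.update (Function.update X k (X k + len m)) m (X k) with hY
  have y1 : Y m = X k := by simp [hY]
  have y2 : Y k = X k + len m := by simp [hY, hmk.symm]
  have y3 : ∀ i, i ≠ m → i ≠ k → Y i = X i := fun i hi hi' => by simp [hY, hi, hi']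
  -- every other slot lies entirely before or after the interval of `k`
  have sep : ∀ i ∈ s, i ≠ k → c i = c k → X i + len i ≤ X k ∨ X k + len m + len k ≤ X i := by
    intro i hi hik hc
    rcases lt_trichotomy (X i) (X k) with h1 | h1 | h1
    · have := h.stop_le lpos k hk i hi hc h1
      rw [l2 i hik] at this
      exact Or.inl this
    · exact absurd (h.start_inj i hi k hk hc h1) hik
    · have := h.stop_le lpos i hi k hk hc.symm h1
      omega
  have cases : ∀ i ∈ insert m s, i = m ∨ i = k ∨ (i ∈ s ∧ i ≠ m ∧ i ≠ k ∧ 0 < len i ∧ Y i = X i ∧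
      len' i = len i) := by
    intro i hi
    rcases eq_or_ne i m with rfl | him
    · exact Or.inl rfl
    rcases eq_or_ne i k with rfl | hik
    · exact Or.inr (Or.inl rfl)
    exact Or.inr (Or.inr ⟨mem_of_mem_insert_of_ne hi him, him, hik, hlen i hi, y3 i him hik, l2 i hik⟩)
  refine ⟨?_, ?_, ?_, ?_, ?_⟩
  · intro i hi
    rw [mem_insert, not_or] at hi
    rw [y3 i hi.1 (fun h => hi.2 (h ▸ hk))]
    exact h.zero i hi.2
  · intro i hi0 j hj0 hc hX
    rcases cases i hi0 with rfl | rfl | ⟨hi, him, hik, pi, yi, li⟩ <;>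
    rcases cases j hj0 with rfl | rfl | ⟨hj, hjm, hjk, pj, yj, lj⟩
    · rfl
    · omega
    · exact absurd (h.start_inj j hj k hk (hc.symm.trans hck.symm) (by omega)) hjk
    · omega
    · rfl
    · have := sep j hj hjk hc.symm; omega
    · exact absurd (h.start_inj i hi k hk (hc.trans hck.symm) (by omega)) hik
    · have := sep i hi hik hc; omega
    · exact h.start_inj i hi j hj hc (by omega)
  · intro i hi0 j hj0 hc hX
    rcases cases i hi0 with rfl | rfl | ⟨hi, him, hik, pi, yi, li⟩ <;>
    rcases cases j hj0 with rfl | rfl | ⟨hj, hjm, hjk, pj, yj, lj⟩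
    · rfl
    · omega
    · have := sep j hj hjk (hc.symm.trans hck.symm); omega
    · omega
    · rfl
    · exact absurd (h.stop_inj j hj i hk hc.symm (by omega)) hjk
    · have := sep i hi hik (hc.trans hck.symm); omega
    · exact absurd (h.stop_inj i hi j hk hc (by omega)) hik
    · exact h.stop_inj i hi j hj hc (by omega)
  · have key : ∀ i ∈ s, i ≠ k ∨ i = k → (X i = o (c i) ∨
        ∃ j ∈ insert m s, c j = c i ∧ Y j + len j = X i) := by
      intro i hi _
      rcases h.pred i hi with h1 | ⟨j, hj, hcj, hX⟩
      · exact Or.inl h1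
      · rcases eq_or_ne j k with rfl | hjk
        · exact Or.inr ⟨j, mem_insert_of_mem hj, hcj, by omega⟩
        · exact Or.inr ⟨j, mem_insert_of_mem hj, hcj, by
            rw [y3 j (fun h => hms (h ▸ hj)) hjk, ← l2 j hjk]; exact hX⟩
    intro i hi
    rcases cases i hi with rfl | rfl | ⟨hi, him, hik, pi, yi, li⟩
    · rw [y1, ← hck]; exact key k hk (Or.inr rfl)
    · exact Or.inr ⟨m, mem_insert_self _ _, hck.symm, by omega⟩
    · rw [yi]; exact key i hi (Or.inl hik)
  · intro i hi0 j hj0 hc hX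
    rcases cases i hi0 with rfl | rfl | ⟨hi, him, hik, pi, yi, li⟩ <;>
    rcases cases j hj0 with rfl | rfl | ⟨hj, hjm, hjk, pj, yj, lj⟩
    · omega
    · exact hR
    · have := sep j hj hjk (hc.symm.trans hck.symm); omega
    · omega
    · omega
    · exact h.follow i hk j hj hc (by omega)
    · exact hge _ _ (hm i hi).le
    · have := sep i hi hik hc; omega
    · exact h.follow i hi j hj hc (by omega)

/-- Removing the smallest slot `m`, whose interval is absorbed by the slot `k` following it. -/
theorem remove_before (hmono : ∀ i j k, i ≤ j → R i k → R j k) (hm : ∀ i ∈ s, m < i)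
    (hk : k ∈ s) (hck : c k = c m) (hlen : ∀ i ∈ insert m s, 0 < len i)
    (h : Arrangement c o R (insert m s) len X) (hX : X k = X m + len m) :
    Arrangement c o R s (Function.update len k (len m + len k))
      (Function.update (Function.update X k (X m)) m 0) := by
  have hmk := (hm k hk).ne
  have hms : m ∉ s := fun h => lt_irrefl _ (hm m h)
  have mm : m ∈ insert m s := mem_insert_self _ _
  have mk : k ∈ insert m s := mem_insert_of_mem hk
  have lm := hlen m mm
  have lk := hlen k mk
  set len' := Function.update len k (len m + len k) with hlen'
  have l1 : len' k = len m + len k := by simp [hlen']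
  have l2 : ∀ i, i ≠ k → len' i = len i := fun i hi => by simp [hlen', hi]
  set Y := Function.update (Function.update X k (X m)) m 0 with hY
  have y2 : Y k = X m := by simp [hY, hmk.symm]
  have y3 : ∀ i, i ≠ m → i ≠ k → Y i = X i := fun i hi hi' => by simp [hY, hi, hi']
  have cases : ∀ i ∈ s, i = k ∨ (i ∈ insert m s ∧ i ≠ m ∧ i ≠ k ∧ 0 < len i ∧ Y i = X i ∧
      len' i = len i) := by
    intro i hi
    have him := (hm i hi).ne'
    rcases eq_or_ne i k with rfl | hik
    · exact Or.inl rfl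
    exact Or.inr ⟨mem_insert_of_mem hi, him, hik, hlen i (mem_insert_of_mem hi), y3 i him hik,
      l2 i hik⟩
  refine ⟨?_, ?_, ?_, ?_, ?_⟩
  · intro i hi
    rcases eq_or_ne i m with rfl | him
    · simp [hY]
    · rw [y3 i him (fun h => hi (h ▸ hk))]
      exact h.zero i (by simp [him, hi])
  · intro i hi j hj hc hX'
    rcases cases i hi with rfl | ⟨hi, him, hik, pi, yi, li⟩ <;>
    rcases cases j hj with rfl | ⟨hj, hjm, hjk, pj, yj, lj⟩
    · rfl
    · exact absurd (h.start_inj m mm j hj (hck.symm.trans hc) (by omega)) hjm.symm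
    · exact absurd (h.start_inj m mm i hi (hck.symm.trans hc.symm) (by omega)) him.symm
    · exact h.start_inj i hi j hj hc (by omega)
  · intro i hi j hj hc hX'
    rcases cases i hi with rfl | ⟨hi, him, hik, pi, yi, li⟩ <;>
    rcases cases j hj with rfl | ⟨hj, hjm, hjk, pj, yj, lj⟩
    · rfl
    · exact h.stop_inj i mk j hj hc (by omega)
    · exact h.stop_inj i hi j mk hc (by omega)
    · exact h.stop_inj i hi j hj hc (by omega)
  · intro i hi
    rcases cases i hi with rfl | ⟨hi, him, hik, pi, yi, li⟩
    · rw [y2, hck]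
      rcases h.pred m mm with h1 | ⟨j, hj, hcj, hXj⟩
      · exact Or.inl h1
      · have hjm : j ≠ m := by rintro rfl; omega
        have hjk : j ≠ i := by rintro rfl; omega
        exact Or.inr ⟨j, mem_of_mem_insert_of_ne hj hjm, hcj, by rw [y3 j hjm hjk, l2 j hjk, hXj]⟩
    · rw [yi]
      rcases h.pred i hi with h1 | ⟨j, hj, hcj, hXj⟩
      · exact Or.inl h1
      · have hjm : j ≠ m := by
          rintro rfl
          exact hik (h.start_inj i hi k mk (hcj.symm.trans hck.symm) (by omega))
        refine Or.inr ⟨j, mem_of_mem_insert_of_ne hj hjm, hcj, ?_⟩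
        rcases cases j (mem_of_mem_insert_of_ne hj hjm) with rfl | ⟨_, _, _, _, yj, lj⟩ <;> omega
  · intro i hi j hj hc hX'
    rcases cases i hi with rfl | ⟨hi, him, hik, pi, yi, li⟩ <;>
    rcases cases j hj with rfl | ⟨hj, hjm, hjk, pj, yj, lj⟩
    · omega
    · exact h.follow i mk j hj hc (by omega)
    · exact hmono m i j (hm i (mem_of_mem_insert_of_ne hi him)).le
        (h.follow m mm j mk hck.symm hX)
    · exact h.follow i hi j hj hc (by omega)

/-- The end of the last interval in the node of `m`. -/
def nodeEnd (c : Fin n → ℤ) (o : ℤ → ℤ) (s : Finset (Fin n)) (len X : Fin n → ℤ) (m : Fin n) : ℤ :=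
  (insert (o (c m)) ((s.filter fun i => c i = c m).image fun i => X i + len i)).max'
    (insert_nonempty _ _)

theorem nodeEnd_mem (c : Fin n → ℤ) (o : ℤ → ℤ) (s : Finset (Fin n)) (len X : Fin n → ℤ)
    (m : Fin n) : nodeEnd c o s len X m = o (c m) ∨
      ∃ i ∈ s, c i = c m ∧ X i + len i = nodeEnd c o s len X m := by
  have := max'_mem (insert (o (c m)) ((s.filter fun i => c i = c m).image fun i => X i + len i))
    (insert_nonempty _ _)
  rw [mem_insert] at this
  refine this.imp id fun h => ?_
  obtain ⟨i, hi, h⟩ := mem_image.1 h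
  exact ⟨i, (mem_filter.1 hi).1, (mem_filter.1 hi).2, h⟩

theorem le_nodeEnd {i : Fin n} (hi : i ∈ s) (hc : c i = c m) :
    X i + len i ≤ nodeEnd c o s len X m :=
  le_max' _ _ (mem_insert_of_mem (mem_image_of_mem (fun i => X i + len i)
    (mem_filter.2 ⟨hi, hc⟩)))

/-- Inserting the smallest slot `m` at the end of its node. -/
theorem insert_last (hge : ∀ i j, i ≤ j → R j i) (hm : ∀ i ∈ s, m < i)
    (hlen : ∀ i ∈ insert m s, 0 < len i) (h : Arrangement c o R s len X) :
    Arrangement c o R (insert m s) len (Function.update X m (nodeEnd c o s len X m)) := by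
  have hms : m ∉ s := fun h => lt_irrefl _ (hm m h)
  have lm := hlen m (mem_insert_self _ _)
  have hle : ∀ i ∈ s, c i = c m → X i + len i ≤ nodeEnd c o s len X m :=
    fun i hi hc => le_nodeEnd hi hc
  have hmem := nodeEnd_mem c o s len X m
  set M := nodeEnd c o s len X m
  set Y := Function.update X m M with hY
  have y1 : Y m = M := by simp [hY]
  have y3 : ∀ i, i ≠ m → Y i = X i := fun i hi => by simp [hY, hi]
  have cases : ∀ i ∈ insert m s, i = m ∨ (i ∈ s ∧ 0 < len i ∧ Y i = X i) := by
    intro i hi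
    rcases eq_or_ne i m with rfl | him
    · exact Or.inl rfl
    exact Or.inr ⟨mem_of_mem_insert_of_ne hi him, hlen i hi, y3 i him⟩
  refine ⟨?_, ?_, ?_, ?_, ?_⟩
  · intro i hi
    rw [mem_insert, not_or] at hi
    rw [y3 i hi.1]
    exact h.zero i hi.2
  · intro i hi0 j hj0 hc hX
    rcases cases i hi0 with rfl | ⟨hi, pi, yi⟩ <;> rcases cases j hj0 with rfl | ⟨hj, pj, yj⟩
    · rfl
    · have := hle j hj hc.symm; omega
    · have := hle i hi hc; omega
    · exact h.start_inj i hi j hj hc (by omega)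
  · intro i hi0 j hj0 hc hX
    rcases cases i hi0 with rfl | ⟨hi, pi, yi⟩ <;> rcases cases j hj0 with rfl | ⟨hj, pj, yj⟩
    · rfl
    · have := hle j hj hc.symm; omega
    · have := hle i hi hc; omega
    · exact h.stop_inj i hi j hj hc (by omega)
  · intro i hi
    rcases cases i hi with rfl | ⟨hi, pi, yi⟩
    · rw [y1]
      refine hmem.imp id ?_
      rintro ⟨j, hj, hc, hX⟩
      exact ⟨j, mem_insert_of_mem hj, hc, by rw [y3 j (fun h => hms (h ▸ hj)), hX]⟩
    · rw [yi]
      refine (h.pred i hi).imp id ?_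
      rintro ⟨j, hj, hc, hX⟩
      exact ⟨j, mem_insert_of_mem hj, hc, by rw [y3 j (fun h => hms (h ▸ hj)), hX]⟩
  · intro i hi0 j hj0 hc hX
    rcases cases i hi0 with rfl | ⟨hi, pi, yi⟩ <;> rcases cases j hj0 with rfl | ⟨hj, pj, yj⟩
    · omega
    · have := hle j hj hc.symm; omega
    · exact hge _ _ (hm i hi).le
    · exact h.follow i hi j hj hc (by omega)

/-- Removing the smallest slot `m` when no slot follows it. -/
theorem remove_last (hm : ∀ i ∈ s, m < i) (hlen : ∀ i ∈ insert m s, 0 < len i)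
    (h : Arrangement c o R (insert m s) len X)
    (hX : ∀ k ∈ s, c k = c m → X k ≠ X m + len m) :
    Arrangement c o R s len (Function.update X m 0) ∧
      nodeEnd c o s len (Function.update X m 0) m = X m := by
  have hms : m ∉ s := fun h => lt_irrefl _ (hm m h)
  have mm : m ∈ insert m s := mem_insert_self _ _
  have lm := hlen m mm
  set Y := Function.update X m 0 with hY
  have y3 : ∀ i ∈ s, Y i = X i := fun i hi => by simp [hY, (hm i hi).ne']
  have hin : ∀ i ∈ s, i ∈ insert m s := fun i hi => mem_insert_of_mem hi
  have hpred : ∀ i ∈ s, X i = o (c i) ∨ ∃ j ∈ s, c j = c i ∧ X j + len j = X i := by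
    intro i hi
    refine (h.pred i (hin i hi)).imp id ?_
    rintro ⟨j, hj, hc, hXj⟩
    refine ⟨j, mem_of_mem_insert_of_ne hj ?_, hc, hXj⟩
    rintro rfl
    exact hX i hi hc.symm hXj.symm
  -- no slot of the node lies behind `m`: the first such slot would have to follow `m`
  have hlt : ∀ i ∈ s, c i = c m → X i < X m := by
    intro i
    have hw : WellFounded fun i j : Fin n => X i < X j :=
      @Finite.wellFounded_of_trans_of_irrefl _ _ _ ⟨fun _ _ _ => lt_trans⟩ ⟨fun _ => lt_irrefl _⟩
    induction i using hw.induction with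
    | _ i ih =>
      intro hi hc
      by_contra! hle
      have hlt : X m < X i := lt_of_le_of_ne hle fun h' =>
        (hm i hi).ne (h.start_inj m mm i (hin i hi) hc.symm h')
      rcases hpred i hi with h1 | ⟨j, hj, hcj, hXj⟩
      · have := h.origin_le hlen m mm
        rw [hc] at h1
        omega
      · have pj := hlen j (hin j hj)
        have h2 := ih j (by omega) hj (hcj.trans hc)
        have := h.stop_le hlen m mm j (hin j hj) (hcj.trans hc) h2
        omega
  refine ⟨⟨?_, ?_, ?_, ?_, ?_⟩, ?_⟩
  · intro i hi
    rcases eq_or_ne i m with rfl | him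
    · simp [hY]
    · rw [hY, Function.update_of_ne him]
      exact h.zero i (by simp [him, hi])
  · intro i hi j hj hc hX'
    rw [y3 i hi, y3 j hj] at hX'
    exact h.start_inj i (hin i hi) j (hin j hj) hc hX'
  · intro i hi j hj hc hX'
    rw [y3 i hi, y3 j hj] at hX'
    exact h.stop_inj i (hin i hi) j (hin j hj) hc hX'
  · intro i hi
    rw [y3 i hi]
    refine (hpred i hi).imp id ?_
    rintro ⟨j, hj, hc, hXj⟩
    exact ⟨j, hj, hc, by rw [y3 j hj, hXj]⟩
  · intro i hi j hj hc hX'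
    rw [y3 i hi, y3 j hj] at hX'
    exact h.follow i (hin i hi) j (hin j hj) hc hX'
  · refine le_antisymm ?_ ?_
    · rcases nodeEnd_mem c o s len Y m with h1 | ⟨i, hi, hc, h1⟩
      · rw [h1]; exact h.origin_le hlen m mm
      · rw [← h1, y3 i hi]
        exact h.stop_le hlen m mm i (hin i hi) hc (hlt i hi hc)
    · rcases h.pred m mm with h1 | ⟨j, hj, hc, hXj⟩
      · rw [h1]; exact le_max' _ _ (mem_insert_self _ _)
      · have hjm : j ≠ m := by rintro rfl; omega
        have hj' := mem_of_mem_insert_of_ne hj hjm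
        have := le_nodeEnd (o := o) (len := len) (X := Y) hj' hc
        rw [y3 j hj'] at this
        omega

end Arrangement

end Arrangements

/-! ### A basis of functions on arrangements -/

section ArrangementFamily

open Finset MvPolynomial

variable {n : ℕ}

theorem totalDegree_aeval_le {σ τ : Type*} [Fintype σ] {φ : σ → MvPolynomial τ ℚ}
    (hφ : ∀ i, (φ i).totalDegree ≤ 1) (P : MvPolynomial σ ℚ) :
    (aeval φ P).totalDegree ≤ P.totalDegree := by
  rw [aeval_def, eval₂_eq']
  refine totalDegree_finsetSum_le fun α hα => (totalDegree_mul _ _).trans ?_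
  rw [algebraMap_eq, totalDegree_C, zero_add]
  refine (totalDegree_finsetProd _ _).trans ?_
  refine le_trans ?_ (le_totalDegree hα)
  rw [Finsupp.sum_fintype _ _ (fun _ => rfl)]
  refine sum_le_sum fun i _ => (totalDegree_pow _ _).trans ?_
  calc α i * (φ i).totalDegree ≤ α i * 1 := Nat.mul_le_mul_left _ (hφ i)
    _ = α i := mul_one _

/-- The number of pairs of slots in a node that the relation `R` allows to be adjacent. -/
def allowedPairs (c : Fin n → ℤ) (R : Fin n → Fin n → Prop) [DecidableRel R]
    (s : Finset (Fin n)) : ℕ :=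
  #((s ×ˢ s).filter fun q => q.1 < q.2 ∧ c q.1 = c q.2 ∧ R q.1 q.2)

theorem allowedPairs_insert (c : Fin n → ℤ) (R : Fin n → Fin n → Prop) [DecidableRel R]
    {s : Finset (Fin n)} {m : Fin n} (hm : ∀ i ∈ s, m < i) :
    allowedPairs c R (insert m s) =
      #(s.filter fun k => c k = c m ∧ R m k) + allowedPairs c R s := by
  have hms : m ∉ s := fun h => lt_irrefl _ (hm m h)
  have : ((insert m s ×ˢ insert m s).filter fun q : Fin n × Fin n =>
        q.1 < q.2 ∧ c q.1 = c q.2 ∧ R q.1 q.2) =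
      ((s.filter fun k => c k = c m ∧ R m k).image fun k => (m, k)) ∪
      (s ×ˢ s).filter fun q => q.1 < q.2 ∧ c q.1 = c q.2 ∧ R q.1 q.2 := by
    ext ⟨i, j⟩
    simp only [mem_filter, mem_product, mem_insert, mem_union, mem_image, Prod.mk.injEq]
    constructor
    · rintro ⟨⟨rfl | hi, rfl | hj⟩, hlt, hc, hR⟩
      · exact absurd hlt (lt_irrefl _)
      · exact Or.inl ⟨j, ⟨hj, hc.symm, hR⟩, rfl, rfl⟩
      · exact absurd (hm i hi) hlt.not_gt
      · exact Or.inr ⟨⟨hi, hj⟩, hlt, hc, hR⟩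
    · rintro (⟨k, ⟨hk, hc, hR⟩, rfl, rfl⟩ | ⟨⟨hi, hj⟩, h⟩)
      · exact ⟨⟨Or.inl rfl, Or.inr hk⟩, hm k hk, hc.symm, hR⟩
      · exact ⟨⟨Or.inr hi, Or.inr hj⟩, h⟩
  rw [allowedPairs, this, card_union_of_disjoint, card_image_of_injective, allowedPairs]
  · intro k k' h; exact congrArg Prod.snd h
  · rw [disjoint_left]
    rintro ⟨i, j⟩ h1 h2
    obtain ⟨k, _, h⟩ := mem_image.1 h1
    have : i = m := (congrArg Prod.fst h).symm
    exact hms (this ▸ (mem_product.1 (mem_filter.1 h2).1).1)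

variable {c : Fin n → ℤ} {o : ℤ → ℤ} {R : Fin n → Fin n → Prop}

/-- The arrangements in which the smallest slot `m` is followed by the slot `e r` (or, for the last
value of `r`, is at the end of its node) correspond to arrangements of the remaining slots. -/
theorem exists_insertion (hge : ∀ i j, i ≤ j → R j i) (hmono : ∀ i j k, i ≤ j → R i k → R j k)
    {s : Finset (Fin n)} {m : Fin n} (hm : ∀ i ∈ s, m < i) {len : Fin n → ℤ}
    (hlen : ∀ i ∈ insert m s, 0 < len i) {N : ℕ} (e : Fin N → Fin n)
    (he : ∀ k, (∃ q, e q = k) ↔ k ∈ s ∧ c k = c m ∧ R m k) (he' : Function.Injective e)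
    (r : Fin (N + 1)) :
    ∃ (len' : Fin n → ℤ) (ins : (Fin n → ℤ) → Fin n → ℤ) (φ : Fin n → MvPolynomial (Fin n) ℚ),
      (∀ i ∈ s, 0 < len' i) ∧ (∀ i, (φ i).totalDegree ≤ 1) ∧
      (∀ X, Arrangement c o R s len' X → Arrangement c o R (insert m s) len (ins X) ∧
        (∀ i, eval (fun j => (ins X j : ℚ)) (φ i) = X i) ∧
        (∀ q : Fin N, q.castSucc = r → ins X (e q) = ins X m + len m) ∧
        (∀ q : Fin N, q.castSucc < r → ins X (e q) ≠ ins X m + len m)) ∧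
      (∀ X, Arrangement c o R (insert m s) len X →
        (∀ q : Fin N, q.castSucc = r → X (e q) = X m + len m) →
        (∀ q : Fin N, q.castSucc < r → X (e q) ≠ X m + len m) →
        ∃ X', Arrangement c o R s len' X' ∧ ins X' = X) := by
  have hms : m ∉ s := fun h => lt_irrefl _ (hm m h)
  have hek : ∀ q, e q ∈ s ∧ c (e q) = c m ∧ R m (e q) := fun q => (he _).1 ⟨q, rfl⟩
  induction r using Fin.lastCases with
  | last =>
    refine ⟨len, fun X => Function.update X m (Arrangement.nodeEnd c o s len X m),
      Function.update X m 0, fun i hi => hlen i (mem_insert_of_mem hi), ?_, ?_, ?_⟩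
    · intro i
      rcases eq_or_ne i m with rfl | him
      · simp
      · simp [him]
    · intro Y hY
      refine ⟨hY.insert_last hge hm hlen, ?_, ?_, ?_⟩
      · intro i
        rcases eq_or_ne i m with rfl | him
        · simp [hY.zero i hms]
        · simp [him]
      · intro q hq
        exact absurd hq (Fin.castSucc_lt_last q).ne
      · intro q _
        have h1 := Arrangement.le_nodeEnd (o := o) (len := len) (X := Y) (hek q).1 (hek q).2.1
        have h2 := hlen m (mem_insert_self _ _)
        have h3 := hlen _ (mem_insert_of_mem (hek q).1)
        simp only [Function.update_self, Function.update_of_ne (hm _ (hek q).1).ne']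
        omega
    · intro Y hY _ hq
      have hno : ∀ k ∈ s, c k = c m → Y k ≠ Y m + len m := by
        intro k hk hc hYk
        obtain ⟨q, rfl⟩ := (he k).2 ⟨hk, hc, hY.follow m (mem_insert_self _ _) k
          (mem_insert_of_mem hk) hc.symm hYk⟩
        exact hq q (Fin.castSucc_lt_last q) hYk
      obtain ⟨h1, h2⟩ := hY.remove_last hm hlen hno
      exact ⟨_, h1, by simp [h2]⟩
  | cast r =>
    obtain ⟨hk, hck, hR⟩ := hek r
    have hkm := (hm _ hk).ne'
    refine ⟨Function.update len (e r) (len m + len (e r)),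
      fun X => Function.update (Function.update X (e r) (X (e r) + len m)) m (X (e r)),
      Function.update (Function.update X (e r) (X m)) m 0, ?_, ?_, ?_, ?_⟩
    · intro i hi
      have h1 := hlen i (mem_insert_of_mem hi)
      have h2 := hlen m (mem_insert_self _ _)
      rcases eq_or_ne i (e r) with rfl | h
      · rw [Function.update_self]; omega
      · rwa [Function.update_of_ne h]
    · intro i
      rcases eq_or_ne i m with rfl | him
      · simp
      · rcases eq_or_ne i (e r) with rfl | h
        · simp [him]
        · simp [him, h]
    · intro Y hY
      have hA := hY.insert_before hge hm hk hck hR hlen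
      have hr : Function.update (Function.update Y (e r) (Y (e r) + len m)) m (Y (e r)) (e r) =
          Function.update (Function.update Y (e r) (Y (e r) + len m)) m (Y (e r)) m + len m := by
        simp [hkm]
      refine ⟨hA, ?_, ?_, ?_⟩
      · intro i
        rcases eq_or_ne i m with rfl | him
        · simp [hY.zero i hms]
        · rcases eq_or_ne i (e r) with rfl | h
          · simp [him]
          · simp [him, h]
      · intro q hq
        rw [Fin.castSucc_injective _ hq]
        exact hr
      · intro q hq h
        rw [← hr] at h
        have := hA.start_inj _ (mem_insert_of_mem (hek q).1) _ (mem_insert_of_mem hk)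
          ((hek q).2.1.trans hck.symm) h
        rw [he' this] at hq
        exact lt_irrefl _ hq
    · intro Y hY hq _
      have h1 := hq r rfl
      refine ⟨_, hY.remove_before hmono hm hk hck hlen h1, ?_⟩
      funext i
      rcases eq_or_ne i m with rfl | him
      · simp [hkm]
      · rcases eq_or_ne i (e r) with rfl | h
        · simp [hkm, h1]
        · simp [him, h]

/-- The arrangements of a set of slots are indexed by a finite type `A` with a duality, together
with a family of polynomials, of degrees bounded by a function `size` on `A`, whose matrix of values
at the arrangements is nonsingular. By induction, the smallest slot `m` is inserted before one of
the slots that may follow it, or at the end: the matrix is block triangular, as the family of a later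
option is multiplied by linear forms that vanish on the arrangements of the earlier ones. -/
theorem exists_separating_family [DecidableRel R] (o : ℤ → ℤ) (hge : ∀ i j, i ≤ j → R j i)
    (hmono : ∀ i j k, i ≤ j → R i k → R j k) (s : Finset (Fin n)) :
    ∃ (A : Type) (_ : Fintype A) (size : A → ℕ) (dual : A → A), Function.Involutive dual ∧
      (∀ a, size a + size (dual a) = allowedPairs c R s) ∧
      ∀ len : Fin n → ℤ, (∀ i ∈ s, 0 < len i) →
        ∃ (x : A → Fin n → ℤ) (ψ : A → MvPolynomial (Fin n) ℚ),
          (∀ a, Arrangement c o R s len (x a)) ∧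
          (∀ X, Arrangement c o R s len X → ∃ a, x a = X) ∧
          (∀ a, (ψ a).totalDegree ≤ size a) ∧
          ∀ w : A → ℚ, (∀ b, ∑ a, w a * eval (fun i => (x b i : ℚ)) (ψ a) = 0) → ∀ a, w a = 0 := by
  induction s using Finset.induction_on_min with
  | empty =>
    refine ⟨Unit, inferInstance, fun _ => 0, id, fun _ => rfl, fun _ => by simp [allowedPairs],
      fun len _ => ⟨fun _ => 0, fun _ => 1, fun _ => ?_, fun X hX => ⟨(), ?_⟩, fun _ => by simp,
      fun w hw a => ?_⟩⟩
    · constructor <;> simp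
    · funext i; exact (hX.zero i (by simp)).symm
    · simpa using hw ()
  | insert m s hm ih =>
    obtain ⟨A, _, size, dual, hdual, hsize, hA⟩ := ih
    obtain ⟨N, hN⟩ : ∃ N, N = #(s.filter fun k => c k = c m ∧ R m k) := ⟨_, rfl⟩
    obtain ⟨e, he, he'⟩ : ∃ e : Fin N → Fin n,
        (∀ k, (∃ q, e q = k) ↔ k ∈ s ∧ c k = c m ∧ R m k) ∧ Function.Injective e := by
      refine ⟨(s.filter fun k => c k = c m ∧ R m k).orderEmbOfFin hN.symm, fun k => ?_,
        (RelEmbedding.injective _)⟩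
      have := range_orderEmbOfFin (s.filter fun k => c k = c m ∧ R m k) hN.symm
      rw [← Set.mem_range, this]
      simp
    refine ⟨Fin (N + 1) × A, inferInstance, fun a => a.1 + size a.2, fun a => (a.1.rev, dual a.2),
      fun a => by simp [hdual a.2], fun a => ?_, fun len hlen => ?_⟩
    · rw [allowedPairs_insert c R hm, ← hsize a.2, ← hN]
      simp only [Fin.val_rev]
      omega
    choose len' ins φ h1 h2 h3 h4 using
      exists_insertion (o := o) hge hmono hm hlen e he he'
    choose x ψ hx hsurj hdeg hind using fun r => hA (len' r) (h1 r)
    let F : Fin (N + 1) → MvPolynomial (Fin n) ℚ := fun r =>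
      ∏ q : Fin N with q.castSucc < r, (X (e q) - X m - C (len m : ℚ))
    have hF : ∀ (r : Fin (N + 1)) (Y : Fin n → ℤ), eval (fun i => (Y i : ℚ)) (F r) =
        ∏ q : Fin N with q.castSucc < r, ((Y (e q) - Y m - len m : ℤ) : ℚ) := by
      intro r Y
      simp only [F, map_prod, map_sub, eval_X, eval_C]
      push_cast
      rfl
    refine ⟨fun a => ins a.1 (x a.1 a.2), fun a => F a.1 * aeval (φ a.1) (ψ a.1 a.2), ?_, ?_, ?_, ?_⟩
    · rintro ⟨r, a⟩
      exact (h3 r _ (hx r a)).1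
    · intro Y hY
      have : ∃ r, (∀ q : Fin N, q.castSucc = r → Y (e q) = Y m + len m) ∧
          (∀ q : Fin N, q.castSucc < r → Y (e q) ≠ Y m + len m) := by
        by_cases h : ∃ q, Y (e q) = Y m + len m
        · obtain ⟨q, hq⟩ := h
          refine ⟨q.castSucc, fun q' hq' => ?_, fun q' hq' h => ?_⟩
          · rw [Fin.castSucc_injective _ hq', hq]
          · have k1 := (he _).1 ⟨q, rfl⟩
            have k2 := (he _).1 ⟨q', rfl⟩
            have := hY.start_inj _ (mem_insert_of_mem k2.1) _ (mem_insert_of_mem k1.1)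
              (k2.2.1.trans k1.2.1.symm) (h.trans hq.symm)
            rw [he' this] at hq'
            exact lt_irrefl _ hq'
        · push Not at h
          exact ⟨Fin.last N, fun q hq => absurd hq (Fin.castSucc_lt_last q).ne, fun q _ => h q⟩
      obtain ⟨r, hr1, hr2⟩ := this
      obtain ⟨X', hX', rfl⟩ := h4 r Y hY hr1 hr2
      obtain ⟨a, rfl⟩ := hsurj r X' hX'
      exact ⟨(r, a), rfl⟩
    · rintro ⟨r, a⟩
      refine (totalDegree_mul _ _).trans (add_le_add ?_
        ((totalDegree_aeval_le (h2 r) _).trans (hdeg r a)))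
      refine (totalDegree_finsetProd _ _).trans ?_
      calc _ ≤ ∑ q : Fin N with q.castSucc < r, (1 : ℕ) := by
            refine sum_le_sum fun q _ => ?_
            refine (totalDegree_sub_C_le _ _).trans ((totalDegree_sub _ _).trans ?_)
            simp
        _ ≤ (r : ℕ) := by
          rw [sum_const, smul_eq_mul, mul_one]
          refine (card_le_card_of_injOn (t := range r) (fun q : Fin N => (q : ℕ)) ?_ ?_).trans
            (card_range _).le
          · intro q hq
            simpa [Fin.lt_def] using hq
          · intro q _ q' _ h
            exact Fin.ext h
    · intro w hw
      have key : ∀ r : Fin (N + 1), ∀ a, w (r, a) = 0 := by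
        intro r
        induction r using WellFoundedLT.induction with
        | _ r ih =>
        refine hind r (fun a => w (r, a)) fun b => ?_
        obtain ⟨_, e2, e3, e4⟩ := h3 r (x r b) (hx r b)
        have hFr : eval (fun i => (ins r (x r b) i : ℚ)) (F r) ≠ 0 := by
          rw [hF]
          refine prod_ne_zero_iff.2 fun q hq => ?_
          have := e4 q (mem_filter.1 hq).2
          exact_mod_cast (by omega : ins r (x r b) (e q) - ins r (x r b) m - len m ≠ 0)
        have h0 : ∀ r', r < r' → eval (fun i => (ins r (x r b) i : ℚ)) (F r') = 0 := by
          intro r' hr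
          rw [hF]
          have hlt : (r : ℕ) < N := lt_of_lt_of_le (Fin.lt_def.1 hr) (Nat.le_of_lt_succ r'.2)
          have hq : (⟨r, hlt⟩ : Fin N).castSucc = r := rfl
          refine prod_eq_zero (i := ⟨r, hlt⟩) (mem_filter.2 ⟨mem_univ _, by rw [hq]; exact hr⟩) ?_
          have := e3 _ hq
          exact_mod_cast (by omega :
            ins r (x r b) (e ⟨r, hlt⟩) - ins r (x r b) m - len m = 0)
        have hval : ∀ a, eval (fun i => (ins r (x r b) i : ℚ)) (aeval (φ r) (ψ r a)) =
            eval (fun i => (x r b i : ℚ)) (ψ r a) := by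
          intro a
          rw [← coe_aeval_eq_eval, RingHom.coe_coe, ← AlgHom.comp_apply, comp_aeval,
            aeval_eq_eval]
          congr 2
          funext i
          rw [← e2 i, aeval_eq_eval]
        have := hw (r, b)
        rw [Fintype.sum_prod_type, sum_eq_single r] at this
        · simp only [map_mul, hval] at this
          refine (mul_eq_zero.1 ?_).resolve_left hFr
          rw [mul_sum, ← this]
          exact sum_congr rfl fun a _ => by ring
        · intro r' _ hr
          refine sum_eq_zero fun a _ => ?_
          rcases lt_or_gt_of_ne hr with h | h
          · rw [ih r' h a, zero_mul]
          · simp only [map_mul, h0 r' h, zero_mul, mul_zero]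
        · simp
      exact fun a => key a.1 a.2

end ArrangementFamily

/-! ### Vanishing sums over arrangements -/

section Hessenberg

open Finset MvPolynomial

/-- Linear algebra of a filtered space with a pairing: if a basis `v` is graded by `size`, with a
symmetry of the grading, and `v a`, `v b` are orthogonal when `size a + size b < D`, then the
filtration is its own annihilator. -/
theorem exists_coeffs_of_orthogonal {A : Type*} [Fintype A] (v : A → A → ℚ)
    (hv : ∀ w : A → ℚ, (∀ b, ∑ a, w a * v a b = 0) → ∀ a, w a = 0) (ω : A → ℚ)
    (hω : ∀ a, ω a ≠ 0) {size : A → ℕ} {dual : A → A} {D : ℕ} (hdual : Function.Involutive dual)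
    (hsize : ∀ a, size a + size (dual a) = D)
    (horth : ∀ a b, size a + size b < D → ∑ x, v a x * v b x * ω x = 0)
    (φ : A → ℚ) (m : ℤ) (hφ : ∀ b, (size b : ℤ) + m < D → ∑ x, φ x * v b x * ω x = 0) :
    ∃ w : A → ℚ, (∀ a, w a ≠ 0 → (size a : ℤ) ≤ m) ∧ ∀ x, φ x = ∑ a, w a * v a x := by
  classical
  have hdet : (Matrix.of v).det ≠ 0 := by
    intro h
    obtain ⟨w, hw, hw'⟩ := Matrix.exists_vecMul_eq_zero_iff.2 h
    refine hw (funext fun a => hv w (fun b => ?_) a)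
    exact congrFun hw' b
  obtain ⟨w, hw⟩ : ∃ w : A → ℚ, Matrix.vecMul w (Matrix.of v) = φ := by
    refine ⟨Matrix.vecMul φ (Matrix.of v)⁻¹, ?_⟩
    rw [Matrix.vecMul_vecMul, Matrix.nonsing_inv_mul _ (Ne.isUnit hdet), Matrix.vecMul_one]
  have hw' : ∀ x, φ x = ∑ a, w a * v a x := fun x => (congrFun hw x).symm
  refine ⟨w, fun a ha => ?_, hw'⟩
  by_contra! hlt
  -- the Gram matrix, with rows of small size and columns of large size
  let S := {b : A // (size b : ℤ) + m < D}
  let G : A → A → ℚ := fun a b => ∑ x, v a x * v b x * ω x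
  let M : Matrix S S ℚ := fun b b' => G b (dual b')
  have hbig : ∀ a, m < size a → (size (dual a) : ℤ) + m < D := by
    intro a h
    have := hsize a
    omega
  have hdetM : M.det ≠ 0 := by
    intro h
    obtain ⟨u, hu, hu'⟩ := Matrix.exists_vecMul_eq_zero_iff.2 h
    let u' : A → ℚ := fun b => if h : (size b : ℤ) + m < D then u ⟨b, h⟩ else 0
    have hsum : ∀ F : A → ℚ, ∑ b, u' b * F b = ∑ b : S, u b * F b := by
      intro F
      rw [← sum_filter_of_ne (s := univ) (p := fun b => (size b : ℤ) + m < D),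
        sum_subtype (p := fun b => (size b : ℤ) + m < D) _ (by simp)]
      · refine sum_congr rfl fun b _ => ?_
        simp [u', b.2]
      · intro b _ hb
        by_contra h
        simp [u', h] at hb
    have hG : ∀ a, ∑ b, u' b * G b a = 0 := by
      intro a
      by_cases h : m < size a
      · rw [hsum]
        have := congrFun hu' ⟨dual a, hbig a h⟩
        simpa [Matrix.vecMul, dotProduct, M, hdual a] using this
      · rw [hsum]
        refine sum_eq_zero fun b _ => ?_
        have := b.2
        rw [show G b a = 0 from horth b a (by omega), mul_zero]
    have h1 : ∀ b, (∑ a, u' a * v a b) * ω b = 0 := by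
      have : Matrix.mulVec (Matrix.of v) (fun b => (∑ a, u' a * v a b) * ω b) = 0 := by
        funext a
        refine Eq.trans ?_ (hG a)
        simp only [Matrix.mulVec, dotProduct, Matrix.of_apply, G, mul_sum, sum_mul]
        rw [sum_comm]
        exact sum_congr rfl fun b _ => sum_congr rfl fun x _ => by ring
      have h2 := Matrix.eq_zero_of_mulVec_eq_zero hdet this
      exact fun b => congrFun h2 b
    have h2 := hv u' fun b => (mul_eq_zero.1 (h1 b)).resolve_right (hω b)
    refine hu (funext fun b => ?_)
    have := h2 b
    simpa [u', b.2] using this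
  have hM : Matrix.mulVec M (fun b' => w (dual b')) = 0 := by
    funext b
    have h1 : ∑ a, G b a * w a = 0 := by
      rw [← hφ b b.2]
      simp only [G, hw', sum_mul]
      rw [sum_comm]
      exact sum_congr rfl fun x _ => sum_congr rfl fun a _ => by ring
    rw [Pi.zero_apply, ← h1, ← Equiv.sum_comp hdual.toPerm]
    simp only [Matrix.mulVec, dotProduct, Function.Involutive.coe_toPerm]
    rw [← sum_filter_of_ne (s := univ) (p := fun a => (size a : ℤ) + m < D)]
    · rw [sum_subtype (p := fun b => (size b : ℤ) + m < D) _ (by simp)]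
    · intro a' _ h
      by_contra h'
      refine h ?_
      have := hsize a'
      have := b.2
      rw [show G b (dual a') = 0 from horth b (dual a') (by omega), zero_mul]
  have := congrFun (Matrix.eq_zero_of_mulVec_eq_zero hdetM hM) ⟨dual a, hbig a hlt⟩
  simp only [hdual a, Pi.zero_apply] at this
  exact ha this

/-- Two finite sets of integers that are stacked without gaps from the same origin are equal if
they have the same cardinality. -/
theorem eq_of_consecutive {o : ℤ} {S T : Finset ℤ} (hS : ∀ x ∈ S, x = o ∨ x - 1 ∈ S)
    (hT : ∀ x ∈ T, x = o ∨ x - 1 ∈ T) (h : #S = #T) : S = T := by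
  have low : ∀ {S : Finset ℤ}, (∀ x ∈ S, x = o ∨ x - 1 ∈ S) → ∀ x ∈ S, o ≤ x := by
    intro S hS x hx
    have hne : S.Nonempty := ⟨x, hx⟩
    have := S.min'_le x hx
    rcases hS _ (S.min'_mem hne) with h | h
    · omega
    · have := S.min'_le _ h
      omega
  have down : ∀ {S : Finset ℤ}, (∀ x ∈ S, x = o ∨ x - 1 ∈ S) → ∀ x ∈ S, ∀ k : ℕ, o ≤ x - k →
      x - k ∈ S := by
    intro S hS x hx k
    induction k with
    | zero => intro _; simpa using hx
    | succ k ih =>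
      intro hk
      push_cast at hk ⊢
      rcases hS _ (ih (by omega)) with h | h
      · omega
      · rwa [sub_sub] at h
  by_contra hne
  obtain ⟨s, hs, hsT⟩ : ∃ s ∈ S, s ∉ T := by
    by_contra! hsub
    exact hne (eq_of_subset_of_card_le hsub h.ge)
  obtain ⟨t, ht, htS⟩ : ∃ t ∈ T, t ∉ S := by
    by_contra! hsub
    exact hne (eq_of_subset_of_card_le hsub h.le).symm
  have h1 := low hS s hs
  have h2 := low hT t ht
  rcases le_total s t with hst | hst
  · have := down hT t ht (t - s).toNat
    rw [show t - ((t - s).toNat : ℤ) = s by omega] at this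
    exact hsT (this h1)
  · have := down hS s hs (s - t).toNat
    rw [show s - ((s - t).toNat : ℤ) = t by omega] at this
    exact htS (this h2)

variable {n : ℕ} {c p : Fin n → ℤ} {o : ℤ → ℤ} {R : Fin n → Fin n → Prop}

theorem exists_nodePerm_of_arrangement
    (hinj : ∀ b b', c b = c b' → p b = p b' → b = b')
    (hcons : ∀ b, p b = o (c b) ∨ ∃ b', c b' = c b ∧ p b' + 1 = p b)
    {X : Fin n → ℤ} (hX : Arrangement c o R univ (fun _ => 1) X) :
    ∃ ρ ∈ nodePerms c, X = p ∘ ρ := by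
  have hset : ∀ z, (univ.filter fun s => c s = z).image X = (univ.filter fun s => c s = z).image p := by
    intro z
    refine eq_of_consecutive (o := o z) ?_ ?_ ?_
    · intro x hx
      obtain ⟨s, hs, rfl⟩ := mem_image.1 hx
      have hs := (mem_filter.1 hs).2
      refine (hX.pred s (mem_univ _)).imp (fun h => by rw [h, hs]) ?_
      rintro ⟨j, _, hj, h⟩
      exact mem_image.2 ⟨j, by simp [hj, hs], by omega⟩
    · intro x hx
      obtain ⟨s, hs, rfl⟩ := mem_image.1 hx
      have hs := (mem_filter.1 hs).2
      refine (hcons s).imp (fun h => by rw [h, hs]) ?_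
      rintro ⟨j, hj, h⟩
      exact mem_image.2 ⟨j, by simp [hj, hs], by omega⟩
    · rw [card_image_of_injOn, card_image_of_injOn]
      · intro s hs t ht h
        exact hinj s t (((mem_filter.1 hs).2).trans ((mem_filter.1 ht).2).symm) h
      · intro s hs t ht h
        exact hX.start_inj s (mem_univ _) t (mem_univ _)
          (((mem_filter.1 hs).2).trans ((mem_filter.1 ht).2).symm) h
  have hex : ∀ s, ∃ b, c b = c s ∧ p b = X s := by
    intro s
    have : X s ∈ (univ.filter fun t => c t = c s).image p := by
      rw [← hset]
      exact mem_image_of_mem _ (by simp)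
    obtain ⟨b, hb, h⟩ := mem_image.1 this
    exact ⟨b, (mem_filter.1 hb).2, h⟩
  choose r hr1 hr2 using hex
  have hri : Function.Injective r := by
    intro s t h
    refine hX.start_inj s (mem_univ _) t (mem_univ _) ?_ ?_
    · rw [← hr1 s, ← hr1 t, h]
    · rw [← hr2 s, ← hr2 t, h]
  refine ⟨Equiv.ofBijective r (Finite.injective_iff_bijective.1 hri), ?_, ?_⟩
  · rw [mem_nodePerms]; exact hr1
  · funext s; exact (hr2 s).symm

/-- The pairs of slots in a node that the relation `R` forbids to be adjacent. -/
def forbiddenPairs (c : Fin n → ℤ) (R : Fin n → Fin n → Prop) [DecidableRel R] :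
    Finset (Fin n × Fin n) :=
  (nodePairs c).filter fun q => ¬ R q.1 q.2

theorem card_forbiddenPairs_add [DecidableRel R] :
    #(forbiddenPairs c R) + allowedPairs c R univ = #(nodePairs c) := by
  rw [forbiddenPairs, add_comm, ← card_filter_add_card_filter_not (s := nodePairs c)
    (fun q => R q.1 q.2)]
  congr 1
  rw [allowedPairs, nodePairs, filter_filter]
  congr 1
  ext q
  simp [and_assoc]

/-- The vanishing, in low degree, of integrals over products of regular nilpotent Hessenberg
varieties, computed by localization: the fixed points are the orders of the slots of each node in
which no forbidden pair is adjacent. The bound on the degree of `f g` is the dimension plus twice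
the number of forbidden pairs, as `f` and `g` both vanish at the other orders and are thus, on the
fixed points, divisible by the product of the forbidden roots. -/
theorem sum_eval_mul_eval_div_eq_zero [DecidableRel R] (hge : ∀ i j, i ≤ j → R j i)
    (hmono : ∀ i j k, i ≤ j → R i k → R j k)
    (hinj : ∀ b b', c b = c b' → p b = p b' → b = b')
    (hcons : ∀ b, p b = o (c b) ∨ ∃ b', c b' = c b ∧ p b' + 1 = p b)
    (f g : MvPolynomial (Fin n) ℚ)
    (hf : ∀ ρ ∈ nodePerms c, (∃ l k, c l = c k ∧ ¬ R l k ∧ p (ρ k) = p (ρ l) + 1) →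
      eval (fun s => (p (ρ s) : ℚ)) f = 0)
    (hg : ∀ ρ ∈ nodePerms c, (∃ l k, c l = c k ∧ ¬ R l k ∧ p (ρ k) = p (ρ l) + 1) →
      eval (fun s => (p (ρ s) : ℚ)) g = 0)
    (hdeg : f.totalDegree + g.totalDegree < #(forbiddenPairs c R) + #(nodePairs c)) :
    ∑ ρ ∈ nodePerms c, eval (fun s => (p (ρ s) : ℚ)) f * eval (fun s => (p (ρ s) : ℚ)) g /
      ((∏ q ∈ forbiddenPairs c R, ((p (ρ q.2) : ℚ) - p (ρ q.1) - 1)) *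
        vand c (fun s => (p (ρ s) : ℚ))) = 0 := by
  classical
  obtain ⟨A, _, size, dual, hdual, hsize, hA⟩ := exists_separating_family (c := c) o hge hmono univ
  obtain ⟨x, ψ, hx, hsurj, hψ, hind⟩ := hA (fun _ => 1) (fun _ _ => one_pos)
  choose σ hσ hσx using fun a => exists_nodePerm_of_arrangement hinj hcons (hx a)
  let bad : Equiv.Perm (Fin n) → Prop :=
    fun ρ => ∃ l k, c l = c k ∧ ¬ R l k ∧ p (ρ k) = p (ρ l) + 1
  let pt : Equiv.Perm (Fin n) → Fin n → ℚ := fun ρ s => (p (ρ s) : ℚ)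
  have hxpt : ∀ a, (fun i => (x a i : ℚ)) = pt (σ a) := by
    intro a; funext i; rw [hσx a]; rfl
  have hgood : ∀ a, ¬ bad (σ a) := by
    rintro a ⟨l, k, hc, hR, h⟩
    refine hR ((hx a).follow l (mem_univ _) k (mem_univ _) hc ?_)
    rw [hσx a]; exact h
  have hσinj : Function.Injective σ := by
    intro a b h
    by_contra hab
    have hdet : (Matrix.of fun a b => eval (fun i => (x b i : ℚ)) (ψ a)).det ≠ 0 := by
      intro h
      obtain ⟨w, hw, hw'⟩ := Matrix.exists_vecMul_eq_zero_iff.2 h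
      exact hw (funext fun a => hind w (fun b => congrFun hw' b) a)
    refine hdet (Matrix.det_zero_of_column_eq hab fun i => ?_)
    simp only [Matrix.of_apply, hxpt, h]
  -- sums over all orders of quantities that vanish at the bad orders
  have hsum : ∀ F : Equiv.Perm (Fin n) → ℚ, (∀ ρ ∈ nodePerms c, bad ρ → F ρ = 0) →
      ∑ ρ ∈ nodePerms c, F ρ = ∑ a, F (σ a) := by
    intro F hF
    rw [← sum_image (s := univ) (f := F) (g := σ) (fun a _ b _ h => hσinj h)]
    symm
    refine sum_subset ?_ ?_
    · intro ρ hρ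
      obtain ⟨a, _, rfl⟩ := mem_image.1 hρ
      exact hσ a
    · intro ρ hρ hρ'
      by_cases hb : bad ρ
      · exact hF ρ hρ hb
      · exfalso
        have hρ1 := (mem_nodePerms c).1 hρ
        obtain ⟨a, ha⟩ : ∃ a, x a = fun s => p (ρ s) := by
          refine hsurj _ ⟨fun i hi => absurd (mem_univ i) hi,
            fun i _ j _ h h' => ρ.injective (hinj _ _ (by rw [hρ1, hρ1, h]) h'),
            fun i _ j _ h h' => ρ.injective (hinj _ _ (by rw [hρ1, hρ1, h]) (by omega)), ?_, ?_⟩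
          · intro i _
            rw [← hρ1 i]
            refine (hcons (ρ i)).imp id ?_
            rintro ⟨b, hb, h⟩
            refine ⟨ρ.symm b, mem_univ _, ?_, by simpa using h⟩
            rw [← hb, ← hρ1 (ρ.symm b), Equiv.apply_symm_apply]
          · intro i _ k _ hc h
            by_contra hR
            exact hb ⟨i, k, hc, hR, h⟩
        · refine hρ' (mem_image.2 ⟨a, mem_univ _, ?_⟩)
          have ha' : p ∘ σ a = fun s => p (ρ s) := (hσx a).symm.trans ha
          ext s
          rw [hinj (σ a s) (ρ s) (by rw [hρ1, (mem_nodePerms c).1 (hσ a)]) (congrFun ha' s)]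
  -- the product of the roots of the forbidden pairs vanishes exactly at the bad orders
  let EP : MvPolynomial (Fin n) ℚ := ∏ q ∈ forbiddenPairs c R, (X q.2 - X q.1 - C 1)
  have hEP : ∀ ρ, eval (pt ρ) EP =
      ∏ q ∈ forbiddenPairs c R, ((p (ρ q.2) : ℚ) - p (ρ q.1) - 1) := by
    intro ρ; simp [EP, pt]
  have hEdeg : EP.totalDegree ≤ #(forbiddenPairs c R) := by
    refine (totalDegree_finsetProd _ _).trans ?_
    rw [card_eq_sum_ones]
    refine sum_le_sum fun q _ => ?_
    refine (totalDegree_sub_C_le _ _).trans ((totalDegree_sub _ _).trans ?_)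
    simp
  have hEbad : ∀ ρ, bad ρ → eval (pt ρ) EP = 0 := by
    rintro ρ ⟨l, k, hc, hR, h⟩
    rw [hEP]
    have hlk : l < k := by
      by_contra! hle
      exact hR (hge k l hle)
    refine prod_eq_zero (i := (l, k)) (mem_filter.2 ⟨mem_filter.2 ⟨mem_univ _, hlk, hc⟩, hR⟩) ?_
    rw [h]; push_cast; ring
  have hEgood : ∀ ρ, ¬ bad ρ → eval (pt ρ) EP ≠ 0 := by
    intro ρ hρ
    rw [hEP]
    refine prod_ne_zero_iff.2 fun q hq h => hρ ?_
    obtain ⟨h1, h2⟩ := mem_filter.1 hq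
    refine ⟨q.1, q.2, (mem_filter.1 h1).2.2, h2, ?_⟩
    exact_mod_cast (by linarith : (p (ρ q.2) : ℚ) = p (ρ q.1) + 1)
  have hV : ∀ ρ ∈ nodePerms c, vand c (pt ρ) ≠ 0 := by
    intro ρ hρ
    refine prod_ne_zero_iff.2 fun q hq h => ?_
    have h1 := (mem_filter.1 hq).2
    have h2 : (p (ρ q.1) : ℚ) = p (ρ q.2) := (sub_eq_zero.1 h).symm
    have h2 : p (ρ q.1) = p (ρ q.2) := by exact_mod_cast h2
    have hρ1 := (mem_nodePerms c).1 hρ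
    exact h1.1.ne (ρ.injective (hinj _ _ (by rw [hρ1, hρ1, h1.2]) h2))
  have hanti : ∀ P : MvPolynomial (Fin n) ℚ, P.totalDegree < #(nodePairs c) →
      (∀ ρ ∈ nodePerms c, bad ρ → eval (pt ρ) P = 0) →
      ∑ a, eval (pt (σ a)) P / vand c (pt (σ a)) = 0 := by
    intro P hP hbad
    rw [← hsum (fun ρ => eval (pt ρ) P / vand c (pt ρ)) fun ρ hρ hb => by
      rw [hbad ρ hρ hb, zero_div]]
    exact sum_eval_div_vand_eq_zero c (fun b => (p b : ℚ)) P hP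
  have hcard := card_forbiddenPairs_add (c := c) (R := R)
  -- by duality, `f / EP` is a combination of separating polynomials of degree `deg f - deg EP`
  obtain ⟨w, hw1, hw2⟩ := exists_coeffs_of_orthogonal
    (fun a b => eval (pt (σ b)) (ψ a)) (fun w hw => hind w fun b => by simpa only [hxpt] using hw b)
    (fun b => eval (pt (σ b)) EP / vand c (pt (σ b)))
    (fun b => div_ne_zero (hEgood _ (hgood b)) (hV _ (hσ b))) hdual hsize (by
      intro a b hab
      rw [← hanti (ψ a * ψ b * EP) ?_ fun ρ _ hb => by rw [map_mul, hEbad ρ hb, mul_zero]]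
      · refine sum_congr rfl fun y _ => ?_
        rw [map_mul, map_mul, mul_div_assoc]
      · have h1 := totalDegree_mul (ψ a * ψ b) EP
        have h2 := totalDegree_mul (ψ a) (ψ b)
        have := hψ a
        have := hψ b
        omega)
    (fun b => eval (pt (σ b)) f / eval (pt (σ b)) EP)
    (f.totalDegree - #(forbiddenPairs c R)) (by
      intro b hb
      rw [← hanti (f * ψ b) ?_ fun ρ hρ hb => by rw [map_mul]; exact mul_eq_zero_of_left (hf ρ hρ hb) _]
      · refine sum_congr rfl fun y _ => ?_
        have := hEgood _ (hgood y)
        have := hV _ (hσ y)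
        rw [map_mul]
        field_simp
      · have h1 := totalDegree_mul f (ψ b)
        have := hψ b
        omega)
  rw [hsum (fun ρ => eval (pt ρ) f * eval (pt ρ) g /
    ((∏ q ∈ forbiddenPairs c R, ((p (ρ q.2) : ℚ) - p (ρ q.1) - 1)) * vand c (pt ρ)))
    fun ρ hρ hb => by rw [show eval (pt ρ) f = 0 from hf ρ hρ hb]; simp]
  calc _ = ∑ y, ∑ a, w a * (eval (pt (σ y)) (ψ a * g) / vand c (pt (σ y))) := by
        refine sum_congr rfl fun y _ => ?_
        rw [← hEP, ← div_div, mul_div_right_comm, hw2 y, sum_mul, sum_div]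
        refine sum_congr rfl fun a _ => ?_
        rw [map_mul]
        ring
    _ = 0 := by
        rw [sum_comm]
        refine sum_eq_zero fun a _ => ?_
        rw [← mul_sum]
        by_cases ha : w a = 0
        · rw [ha, zero_mul]
        · rw [hanti (ψ a * g) ?_ fun ρ hρ hb => by
            rw [map_mul]; exact mul_eq_zero_of_right _ (hg ρ hρ hb), mul_zero]
          have h1 := totalDegree_mul (ψ a) g
          have := hψ a
          have := hw1 a ha
          omega

end Hessenberg

/-! ### Diagonals of partitions -/

section Diagonals

open Finset MvPolynomial

/-- The coordinates `I` and contents `c = I - J` of the boxes `(I, J)` of a partition. -/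
structure IsPartition {B : Type*} (I c : B → ℤ) : Prop where
  nonneg : ∀ b, 0 ≤ I b
  content_le : ∀ b, c b ≤ I b
  inj : ∀ b b', c b = c b' → I b = I b' → b = b'
  down : ∀ b i j, 0 ≤ i → i ≤ I b → 0 ≤ j → j ≤ I b - c b → ∃ b', I b' = i ∧ c b' = i - j

/-- Telescoping of the squares of the differences of a finitely supported sequence. -/
theorem sum_sq_sub_eq (u : ℕ → ℤ) (N : ℕ) (h0 : u 0 = 0) (hN : u N = 0) :
    ∑ k ∈ range N, (u (k + 1) - u k) ^ 2 =
      2 * (∑ k ∈ range N, u k * u k - ∑ k ∈ range N, u (k + 1) * u k) := by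
  have h1 : ∑ k ∈ range N, u (k + 1) * u (k + 1) = ∑ k ∈ range N, u k * u k := by
    have h := sum_range_succ (fun k => u k * u k) N
    rw [sum_range_succ', h0, hN] at h
    simpa using h
  have h2 : ∀ k, (u (k + 1) - u k) ^ 2 = u (k + 1) * u (k + 1) + u k * u k - 2 * (u (k + 1) * u k) :=
    fun k => by ring
  simp_rw [h2]
  rw [sum_sub_distrib, sum_add_distrib, h1, ← mul_sum]
  ring

variable {B : Type*} [Fintype B] (c : B → ℤ) (U : Finset B)

/-- The number of pairs of elements of `U` on the same diagonal, minus the number of pairs on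
adjacent diagonals, in terms of the lengths of the diagonals. -/
theorem two_mul_sub_eq_sum_sq : ∃ (M : ℕ), (∀ b, -(M : ℤ) < c b ∧ c b < M) ∧
    2 * ((#((U ×ˢ U).filter fun q => c q.2 = c q.1) : ℤ) -
      #((U ×ˢ U).filter fun q => c q.2 = c q.1 + 1)) =
    ∑ k ∈ range (2 * M), ((#(U.filter fun b => c b = -M + k + 1) : ℤ) -
      #(U.filter fun b => c b = -M + k)) ^ 2 := by
  obtain ⟨M, hM⟩ : ∃ M : ℕ, ∀ b, -(M : ℤ) < c b ∧ c b < M := by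
    refine ⟨univ.sup (fun b => (c b).natAbs) + 1, fun b => ?_⟩
    have := le_sup (f := fun b => (c b).natAbs) (mem_univ b)
    omega
  refine ⟨M, hM, ?_⟩
  let u : ℕ → ℤ := fun k => #(U.filter fun b => c b = -M + k)
  have hu : ∀ k : ℕ, u (k + 1) = #(U.filter fun b => c b = -M + k + 1) := by
    intro k; simp only [u]; push_cast; simp only [add_assoc]
  have key := sum_sq_sub_eq u (2 * M) (by
    simp only [u, Nat.cast_eq_zero, card_eq_zero]
    exact filter_eq_empty_iff.2 fun b _ h => by have := hM b; simp at h; omega) (by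
    simp only [u, Nat.cast_eq_zero, card_eq_zero]
    exact filter_eq_empty_iff.2 fun b _ h => by have := hM b; push_cast at h; omega)
  have hcount : ∀ e : ℕ, (#((U ×ˢ U).filter fun q => c q.2 = c q.1 + e) : ℤ) =
      ∑ k ∈ range (2 * M), u (k + e) * u k := by
    intro e
    rw [card_eq_sum_card_fiberwise (f := fun q => (c q.1 + M).toNat) (t := range (2 * M))]
    · push_cast
      refine sum_congr rfl fun k _ => ?_
      simp only [u]
      rw [← Nat.cast_mul, mul_comm, ← card_product]
      congr 2
      ext ⟨b, b'⟩
      have := hM b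
      simp only [mem_filter, mem_product]
      push_cast
      constructor
      · rintro ⟨⟨⟨h1, h2⟩, h3⟩, h4⟩
        exact ⟨⟨h1, by omega⟩, h2, by omega⟩
      · rintro ⟨⟨h1, h2⟩, h3, h4⟩
        exact ⟨⟨⟨h1, h3⟩, by omega⟩, by omega⟩
    · intro q _
      have := hM q.1
      simp only [coe_range, Set.mem_Iio]
      omega
  have e0 := hcount 0
  have e1 := hcount 1
  simp only [Nat.cast_zero, add_zero, Nat.cast_one] at e0 e1
  rw [e0, e1, ← key]
  exact sum_congr rfl fun k _ => by rw [hu]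

theorem card_adjacent_le_card_same :
    (#((U ×ˢ U).filter fun q => c q.2 = c q.1 + 1) : ℤ) ≤
      #((U ×ˢ U).filter fun q => c q.2 = c q.1) := by
  obtain ⟨M, -, h⟩ := two_mul_sub_eq_sum_sq c U
  have : 0 ≤ ∑ k ∈ range (2 * M), ((#(U.filter fun b => c b = -M + k + 1) : ℤ) -
      #(U.filter fun b => c b = -M + k)) ^ 2 := sum_nonneg fun _ _ => sq_nonneg _
  omega

theorem card_adjacent_lt_card_same (hU : U.Nonempty) :
    (#((U ×ˢ U).filter fun q => c q.2 = c q.1 + 1) : ℤ) <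
      #((U ×ˢ U).filter fun q => c q.2 = c q.1) := by
  obtain ⟨M, hM, h⟩ := two_mul_sub_eq_sum_sq c U
  by_contra hle
  have h0 : ∑ k ∈ range (2 * M), ((#(U.filter fun b => c b = -M + k + 1) : ℤ) -
      #(U.filter fun b => c b = -M + k)) ^ 2 = 0 := by
    have : 0 ≤ ∑ k ∈ range (2 * M), ((#(U.filter fun b => c b = -M + k + 1) : ℤ) -
      #(U.filter fun b => c b = -M + k)) ^ 2 := sum_nonneg fun _ _ => sq_nonneg _
    omega
  rw [sum_eq_zero_iff_of_nonneg fun _ _ => sq_nonneg _] at h0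
  have hz : ∀ k : ℕ, k ≤ 2 * M → #(U.filter fun b => c b = -M + k) = 0 := by
    intro k
    induction k with
    | zero =>
      intro _
      rw [card_eq_zero]
      exact filter_eq_empty_iff.2 fun b _ h => by have := hM b; simp at h; omega
    | succ k ih =>
      intro hk
      have h1 := h0 k (mem_range.2 (by omega))
      have h2 := ih (by omega)
      rw [h2, sq_eq_zero_iff] at h1
      push_cast
      rw [← add_assoc]
      omega
  obtain ⟨b, hb⟩ := hU
  have := hM b
  have h1 := hz (c b + M).toNat (by omega)
  rw [card_eq_zero, filter_eq_empty_iff] at h1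
  exact h1 hb (by omega)

variable {c U} {I : B → ℤ}

/-- The lengths of the diagonals of a partition change by at most one from each diagonal to the
next, which makes the quadratic form of the diagram `A_∞` linear on them. -/
theorem IsPartition.card_same_sub_card_adjacent (h : IsPartition I c)
    (hU : ∀ b ∈ U, ∀ b', I b' ≤ I b → I b' - c b' ≤ I b - c b → b' ∈ U) :
    (#((U ×ˢ U).filter fun q => c q.2 = c q.1) : ℤ) -
      #((U ×ˢ U).filter fun q => c q.2 = c q.1 + 1) = #(U.filter fun b => c b = 0) := by
  obtain ⟨M, hM, hsq⟩ := two_mul_sub_eq_sum_sq c U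
  let u : ℤ → ℤ := fun z => #(U.filter fun b => c b = z)
  -- moving a box down, or to the left, moves it to an adjacent diagonal
  have move : ∀ (z z' : ℤ) (P : B → Prop) [DecidablePred P] (di dj : ℤ), 0 ≤ di → 0 ≤ dj →
      z' = z - di + dj → (∀ b ∈ U, c b = z → P b → di ≤ I b ∧ dj ≤ I b - c b) →
      #((U.filter fun b => c b = z).filter P) ≤ #(U.filter fun b => c b = z') := by
    intro z z' P _ di dj hdi hdj hz hP
    have hex : ∀ b : B, ∃ b' : B, b ∈ U → c b = z → P b → I b' = I b - di ∧ c b' = z' ∧ b' ∈ U := by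
      intro b
      by_cases hb : b ∈ U ∧ c b = z ∧ P b
      · obtain ⟨h1, h2⟩ := hP b hb.1 hb.2.1 hb.2.2
        obtain ⟨b', h3, h4⟩ := h.down b (I b - di) (I b - c b - dj) (by omega) (by omega) (by omega)
          (by omega)
        refine ⟨b', fun _ _ _ => ⟨h3, by omega, hU b hb.1 b' (by omega) (by omega)⟩⟩
      · exact ⟨b, fun h1 h2 h3 => absurd ⟨h1, h2, h3⟩ hb⟩
    choose F hF using hex
    refine card_le_card_of_injOn F ?_ ?_
    · intro b hb
      simp only [coe_filter, mem_filter, Set.mem_ofPred_eq] at hb ⊢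
      have := hF b hb.1.1 hb.1.2 hb.2
      exact ⟨this.2.2, this.2.1⟩
    · intro b hb b' hb' he
      simp only [coe_filter, mem_filter, Set.mem_ofPred_eq] at hb hb'
      have h1 := hF b hb.1.1 hb.1.2 hb.2
      have h2 := hF b' hb'.1.1 hb'.1.2 hb'.2
      rw [he] at h1
      exact h.inj b b' (by omega) (by omega)
  have hone : ∀ (z : ℤ) (P : B → Prop) [DecidablePred P],
      (∀ b b', c b = z → c b' = z → ¬ P b → ¬ P b' → I b = I b') →
      #(U.filter fun b => c b = z) ≤ #((U.filter fun b => c b = z).filter P) + 1 := by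
    intro z P _ hP
    rw [← card_filter_add_card_filter_not (s := U.filter fun b => c b = z) P]
    gcongr
    refine card_le_one.2 fun b hb b' hb' => ?_
    simp only [mem_filter] at hb hb'
    exact h.inj b b' (by omega) (hP b b' hb.1.2 hb'.1.2 hb.2 hb'.2)
  have hpos : ∀ z, 0 ≤ z → u z - u (z + 1) = 0 ∨ u z - u (z + 1) = 1 := by
    intro z hz
    have h1 := move (z + 1) z (fun _ => True) 1 0 (by omega) le_rfl (by omega) (by
      intro b _ hb _
      have := h.content_le b
      omega)
    have h2 := move z (z + 1) (fun b => 1 ≤ I b - c b) 0 1 le_rfl (by omega) (by omega) (by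
      intro b _ hb h1
      have := h.nonneg b
      omega)
    have h3 := hone z (fun b => 1 ≤ I b - c b) (by
      intro b b' hb hb' h1 h2
      have := h.content_le b
      have := h.content_le b'
      omega)
    rw [filter_true] at h1
    simp only [u]
    omega
  have hneg : ∀ z, z < 0 → u (z + 1) - u z = 0 ∨ u (z + 1) - u z = 1 := by
    intro z hz
    have h1 := move z (z + 1) (fun _ => True) 0 1 le_rfl (by omega) (by omega) (by
      intro b _ hb _
      have := h.nonneg b
      omega)
    have h2 := move (z + 1) z (fun b => 1 ≤ I b) 1 0 (by omega) le_rfl (by omega) (by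
      intro b _ hb h1
      have := h.content_le b
      omega)
    have h3 := hone (z + 1) (fun b => 1 ≤ I b) (by
      intro b b' hb hb' h1 h2
      have := h.nonneg b
      have := h.nonneg b'
      omega)
    rw [filter_true] at h1
    simp only [u]
    omega
  have u1 : u (-M) = 0 := by
    simp only [u, Nat.cast_eq_zero, card_eq_zero]
    exact filter_eq_empty_iff.2 fun b _ h => by have := hM b; omega
  have u2 : u M = 0 := by
    simp only [u, Nat.cast_eq_zero, card_eq_zero]
    exact filter_eq_empty_iff.2 fun b _ h => by have := hM b; omega
  have hs1 : ∑ k ∈ range M, (u (-M + k + 1) - u (-M + k)) ^ 2 = u 0 := by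
    calc _ = ∑ k ∈ range M, (u (-M + (k + 1 : ℕ)) - u (-M + k)) := by
          refine sum_congr rfl fun k hk => ?_
          have := mem_range.1 hk
          push_cast
          rw [← add_assoc]
          rcases hneg (-M + k) (by omega) with h | h <;> rw [h] <;> norm_num
      _ = u 0 := by
          rw [sum_range_sub (fun k : ℕ => u (-M + k))]
          simp [u1]
  have hs2 : ∑ k ∈ range M, (u (-M + (M + k : ℕ) + 1) - u (-M + (M + k : ℕ))) ^ 2 = u 0 := by
    calc _ = ∑ k ∈ range M, (u (k : ℕ) - u (k + 1 : ℕ)) := by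
          refine sum_congr rfl fun k hk => ?_
          push_cast
          rw [neg_add_cancel_left]
          rw [← neg_sub (u k), neg_sq]
          rcases hpos k (by omega) with h | h <;> rw [h] <;> norm_num
      _ = u 0 := by
          rw [sum_range_sub' (fun k : ℕ => u k)]
          simp [u2]
  have hfin : ∑ k ∈ range (2 * M), (u (-M + k + 1) - u (-M + k)) ^ 2 = u 0 + u 0 := by
    rw [two_mul, sum_range_add, hs1, hs2]
  have : (2 : ℤ) * ((#((U ×ˢ U).filter fun q => c q.2 = c q.1) : ℤ) -
      #((U ×ˢ U).filter fun q => c q.2 = c q.1 + 1)) = u 0 + u 0 := by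
    rw [hsq, ← hfin]
  simp only [u] at this
  omega

end Diagonals

/-! ### The singular part of the weights -/

section RootSums

open Finset MvPolynomial

variable {n : ℕ} (c y : Fin n → ℤ) (a : ℤ)

/-- The pairs of slots `(s, s')` contributing the root `X s' - X s - p` to the weight, where `c` and
`y` are the contents and levels of the slots, and `r` is the shift in the second coordinate. -/
def rootSet (p r : ℤ) : Finset (Fin n × Fin n) :=
  univ.filter fun q => c q.2 - c q.1 = p - r ∧ y q.1 + p * a < y q.2

/-- The product of the roots `X s' - X s - p` over a set of pairs `(s, s')`. -/
def rootProd (T : Finset (Fin n × Fin n)) (p : ℤ) (X : Fin n → ℚ) : ℚ :=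
  ∏ q ∈ T, (X q.2 - X q.1 - p)

/-- The slots on the main diagonal with positive `y`. -/
def frameLow : Finset (Fin n) := univ.filter fun s => c s = 0 ∧ 0 < y s

/-- The slots on the main diagonal with `y < -a`. -/
def frameHigh : Finset (Fin n) := univ.filter fun s => c s = 0 ∧ y s + a < 0

/-- The numerator of the singular part of the weight, where `X s` is the first coordinate of the box
occupied by the slot `s`. -/
def rootNumer (X : Fin n → ℚ) : ℚ :=
  rootProd (rootSet c y a 1 0) 1 X * rootProd (rootSet c y a 0 1) 0 X *
    (∏ s ∈ frameLow c y, X s) * ∏ s ∈ frameHigh c y a, (-X s - 1)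

/-- The denominator of the singular part of the weight. -/
def rootDenom (X : Fin n → ℚ) : ℚ :=
  rootProd (rootSet c y a 0 0) 0 X * rootProd (rootSet c y a 1 1) 1 X

/-- The degree of the singular part of the weight. -/
def rootDegree : ℤ :=
  #(rootSet c y a 1 0) + #(rootSet c y a 0 1) + #(frameLow c y) + #(frameHigh c y a) -
    #(rootSet c y a 0 0) - #(rootSet c y a 1 1)

/-- The roots as a polynomial. -/
def rootPoly (T : Finset (Fin n × Fin n)) (p : ℤ) : MvPolynomial (Fin n) ℚ :=
  ∏ q ∈ T, (X q.2 - X q.1 - C (p : ℚ))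

theorem eval_rootPoly (T : Finset (Fin n × Fin n)) (p : ℤ) (x : Fin n → ℚ) :
    eval x (rootPoly T p) = rootProd T p x := by
  simp [rootPoly, rootProd]

theorem totalDegree_rootPoly_le (T : Finset (Fin n × Fin n)) (p : ℤ) :
    (rootPoly T p).totalDegree ≤ #T := by
  refine (totalDegree_finsetProd _ _).trans ?_
  rw [card_eq_sum_ones]
  refine sum_le_sum fun q _ => ?_
  refine (totalDegree_sub_C_le _ _).trans ((totalDegree_sub _ _).trans ?_)
  simp

variable {c y a}

theorem rootProd_eq_zero {T : Finset (Fin n × Fin n)} {p : ℤ} {x : Fin n → ℤ} {q : Fin n × Fin n}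
    (hq : q ∈ T) (h : x q.2 = x q.1 + p) : rootProd T p (fun s => (x s : ℚ)) = 0 := by
  refine prod_eq_zero hq ?_
  simp only [h]
  push_cast
  ring

/-- A product of roots over a set of pairs defined in terms of the nodes does not change under
permutations that preserve the nodes. -/
theorem rootProd_comp_nodePerm {d : Fin n → ℤ} {ρ : Equiv.Perm (Fin n)} (hρ : ρ ∈ nodePerms d)
    {T : Finset (Fin n × Fin n)}
    (hT : ∀ q q' : Fin n × Fin n, d q.1 = d q'.1 → d q.2 = d q'.2 → q ∈ T → q' ∈ T)
    (p : ℤ) (x : Fin n → ℚ) : rootProd T p (fun s => x (ρ s)) = rootProd T p x := by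
  rw [mem_nodePerms] at hρ
  have h' : ∀ s, d (ρ.symm s) = d s := fun s => by rw [← hρ (ρ.symm s), Equiv.apply_symm_apply]
  refine prod_nbij' (fun q => (ρ q.1, ρ q.2)) (fun q => (ρ.symm q.1, ρ.symm q.2)) ?_ ?_ ?_ ?_ ?_
  · exact fun q hq => hT q _ (hρ _).symm (hρ _).symm hq
  · exact fun q hq => hT q _ (h' _).symm (h' _).symm hq
  · intro q _; simp
  · intro q _; simp
  · intro q _; simp

/-- The side of a threshold `t` on which the level of a slot lies. -/
def side (y : Fin n → ℤ) (t : ℤ) (s : Fin n) : ℤ := if t ≤ y s then 1 else 0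

theorem side_eq_one {t : ℤ} {s : Fin n} : side y t s = 1 ↔ t ≤ y s := by
  unfold side; split_ifs <;> simp_all

theorem side_eq_zero {t : ℤ} {s : Fin n} : side y t s = 0 ↔ y s < t := by
  unfold side; split_ifs <;> simp_all

theorem side_cases (y : Fin n → ℤ) (t : ℤ) (s : Fin n) : side y t s = 0 ∨ side y t s = 1 := by
  unfold side; split_ifs <;> simp

/-- The nodes, refined by the side of the threshold. -/
def sideNode (c y : Fin n → ℤ) (t : ℤ) (s : Fin n) : ℤ := 2 * c s + side y t s

theorem sideNode_eq_iff {t : ℤ} {s s' : Fin n} :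
    sideNode c y t s = sideNode c y t s' ↔ c s = c s' ∧ side y t s = side y t s' := by
  have := side_cases y t s
  have := side_cases y t s'
  unfold sideNode
  omega

/-- The pairs of slots on different sides, with given difference of contents. -/
def crossSet (c y : Fin n → ℤ) (t e : ℤ) : Finset (Fin n × Fin n) :=
  univ.filter fun q => c q.2 - c q.1 = e ∧ y q.1 < t ∧ t ≤ y q.2

/-- The pairs of a root set that are on the same side. -/
def sameSet (c y : Fin n → ℤ) (a t p r : ℤ) : Finset (Fin n × Fin n) :=
  (rootSet c y a p r).filter fun q => side y t q.1 = side y t q.2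

theorem filter_not_same {t p : ℤ} (ha : 0 ≤ a) (hgap : ∀ s, t ≤ y s ∨ y s + a < t)
    (hp0 : 0 ≤ p) (hp1 : p ≤ 1) (r : ℤ) :
    ((rootSet c y a p r).filter fun q => ¬ side y t q.1 = side y t q.2) =
      crossSet c y t (p - r) := by
  have hpa : 0 ≤ p * a := mul_nonneg hp0 ha
  have hpa' : p * a ≤ a := by nlinarith
  ext q
  have h1 := hgap q.1
  have h2 := hgap q.2
  simp only [rootSet, crossSet, mem_filter, mem_univ, true_and]
  unfold side
  split_ifs <;> constructor <;> intro h <;> omega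

theorem rootProd_split {t p : ℤ} (ha : 0 ≤ a) (hgap : ∀ s, t ≤ y s ∨ y s + a < t)
    (hp0 : 0 ≤ p) (hp1 : p ≤ 1) (r : ℤ) (x : Fin n → ℚ) :
    rootProd (rootSet c y a p r) p x =
      rootProd (sameSet c y a t p r) p x * rootProd (crossSet c y t (p - r)) p x := by
  rw [← filter_not_same ha hgap hp0 hp1]
  exact (prod_filter_mul_prod_filter_not _ _ _).symm

theorem card_rootSet_split {t p : ℤ} (ha : 0 ≤ a) (hgap : ∀ s, t ≤ y s ∨ y s + a < t)
    (hp0 : 0 ≤ p) (hp1 : p ≤ 1) (r : ℤ) :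
    #(rootSet c y a p r) = #(sameSet c y a t p r) + #(crossSet c y t (p - r)) := by
  rw [← filter_not_same ha hgap hp0 hp1]
  exact (card_filter_add_card_filter_not _).symm

/-- The number of pairs across an order ideal of a partition: the quadratic form counting pairs on
equal and adjacent diagonals is known on the partition and on the ideal, and positive definite on
the complement. -/
theorem card_cross {p : Fin n → ℤ} {t : ℤ} (hP : IsPartition p c)
    (hK : ∀ b, t ≤ y b → ∀ b', p b' ≤ p b → p b' - c b' ≤ p b - c b → t ≤ y b') :
    (2 * #(crossSet c y t 0) : ℤ) ≤ #(crossSet c y t 1) + #(crossSet c y t (-1)) +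
        #(univ.filter fun s => c s = 0 ∧ y s < t) ∧
      ((∃ s, y s < t) → (2 * #(crossSet c y t 0) : ℤ) < #(crossSet c y t 1) +
        #(crossSet c y t (-1)) + #(univ.filter fun s => c s = 0 ∧ y s < t)) := by
  let K : Finset (Fin n) := univ.filter fun s => t ≤ y s
  let L : Finset (Fin n) := univ.filter fun s => y s < t
  have split : ∀ e : ℤ,
      #((univ ×ˢ univ : Finset (Fin n × Fin n)).filter fun q => c q.2 = c q.1 + e) =
      #((K ×ˢ K).filter fun q => c q.2 = c q.1 + e) + #((L ×ˢ L).filter fun q => c q.2 = c q.1 + e) +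
        #(crossSet c y t e) + #(crossSet c y t (-e)) := by
    intro e
    rw [← card_filter_add_card_filter_not (fun q : Fin n × Fin n => t ≤ y q.1),
      ← card_filter_add_card_filter_not (s := filter (fun q => t ≤ y q.1) _)
        (fun q : Fin n × Fin n => t ≤ y q.2),
      ← card_filter_add_card_filter_not (s := filter (fun q => ¬ t ≤ y q.1) _)
        (fun q : Fin n × Fin n => t ≤ y q.2)]
    have h1 : #(crossSet c y t (-e)) = #((((univ ×ˢ univ : Finset (Fin n × Fin n)).filter
        fun q => c q.2 = c q.1 + e).filter fun q => t ≤ y q.1).filter fun q => ¬ t ≤ y q.2) := by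
      refine card_nbij' Prod.swap Prod.swap ?_ ?_ (fun _ _ => rfl) (fun _ _ => rfl)
      · intro q hq
        simp [crossSet] at hq ⊢
        omega
      · intro q hq
        simp [crossSet] at hq ⊢
        omega
    have h2 : crossSet c y t e = (((univ ×ˢ univ : Finset (Fin n × Fin n)).filter
        fun q => c q.2 = c q.1 + e).filter fun q => ¬ t ≤ y q.1).filter fun q => t ≤ y q.2 := by
      ext q; simp [crossSet]; omega
    have h3 : (K ×ˢ K).filter (fun q => c q.2 = c q.1 + e) =
        (((univ ×ˢ univ : Finset (Fin n × Fin n)).filter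
        fun q => c q.2 = c q.1 + e).filter fun q => t ≤ y q.1).filter fun q => t ≤ y q.2 := by
      ext q; simp [K]; omega
    have h4 : (L ×ˢ L).filter (fun q => c q.2 = c q.1 + e) =
        (((univ ×ˢ univ : Finset (Fin n × Fin n)).filter
        fun q => c q.2 = c q.1 + e).filter fun q => ¬ t ≤ y q.1).filter fun q => ¬ t ≤ y q.2 := by
      ext q; simp [L]; omega
    rw [h1, h2, h3, h4]
    omega
  have s0 := split 0
  have s1 := split 1
  simp only [add_zero, neg_zero] at s0
  have q1 := hP.card_same_sub_card_adjacent (U := univ) (fun _ _ _ _ _ => mem_univ _)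
  have q2 := hP.card_same_sub_card_adjacent (U := K) (by
    intro b hb b' h1 h2
    exact mem_filter.2 ⟨mem_univ _, hK b (mem_filter.1 hb).2 b' h1 h2⟩)
  have z : #(univ.filter fun b => c b = 0) =
      #(K.filter fun b => c b = 0) + #(univ.filter fun s => c s = 0 ∧ y s < t) := by
    rw [← card_filter_add_card_filter_not (s := univ.filter fun b => c b = 0) (fun b => t ≤ y b)]
    congr 2
    · ext b; simp [K, and_comm]
    · ext b; simp
  have l1 := card_adjacent_le_card_same c L
  refine ⟨by omega, fun ⟨s, hs⟩ => ?_⟩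
  have l2 := card_adjacent_lt_card_same c (U := L) ⟨s, by simp [L, hs]⟩
  omega

theorem rootNumer_ne_zero {p : Fin n → ℤ} (h : rootNumer c y a (fun s => (p s : ℚ)) ≠ 0) :
    (∀ s s', c s' = c s + 1 → p s' = p s + 1 → y s' ≤ y s + a) ∧
      (∀ s s', c s = c s' + 1 → p s' = p s → y s' ≤ y s) ∧
      (∀ s, c s = 0 → p s = 0 → y s ≤ 0) := by
  rw [rootNumer, mul_ne_zero_iff, mul_ne_zero_iff, mul_ne_zero_iff] at h
  obtain ⟨⟨⟨h1, h2⟩, h3⟩, -⟩ := h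
  refine ⟨fun s s' hc hp => ?_, fun s s' hc hp => ?_, fun s hc hp => ?_⟩
  · by_contra! hlt
    refine h1 (rootProd_eq_zero (q := (s, s')) (mem_filter.2 ⟨mem_univ _, ?_, ?_⟩) hp)
    · simp only; omega
    · simp only; omega
  · by_contra! hlt
    refine h2 (rootProd_eq_zero (q := (s, s')) (mem_filter.2 ⟨mem_univ _, ?_, ?_⟩) ?_)
    · simp only; omega
    · simp only; omega
    · simp only; omega
  · by_contra! hlt
    exact h3 (prod_eq_zero (mem_filter.2 ⟨mem_univ _, hc, hlt⟩) (by simp [hp]))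

/-- In a valid filling, the slots above a threshold below which there is a gap of length `a` occupy
an order ideal. -/
theorem order_ideal {p : Fin n → ℤ} {t : ℤ} (hP : IsPartition p c)
    (hgap : ∀ s, t ≤ y s ∨ y s + a < t)
    (h1 : ∀ s s', c s' = c s + 1 → p s' = p s + 1 → y s' ≤ y s + a)
    (h2 : ∀ s s', c s = c s' + 1 → p s' = p s → y s' ≤ y s) :
    ∀ b, t ≤ y b → ∀ b', p b' ≤ p b → p b' - c b' ≤ p b - c b → t ≤ y b' := by
  suffices h : ∀ k : ℕ, ∀ b, t ≤ y b → ∀ b', p b' ≤ p b → p b' - c b' ≤ p b - c b →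
      p b - p b' + ((p b - c b) - (p b' - c b')) = k → t ≤ y b' by
    intro b hb b' hi hj
    exact h (p b - p b' + ((p b - c b) - (p b' - c b'))).toNat b hb b' hi hj (by omega)
  intro k
  induction k with
  | zero =>
    intro b hb b' hi hj hk
    rwa [hP.inj b' b (by omega) (by omega)]
  | succ k ih =>
    intro b hb b' hi hj hk
    have := hP.nonneg b'
    have := hP.content_le b'
    rcases hi.lt_or_eq with hlt | heq
    · obtain ⟨b'', e1, e2⟩ := hP.down b (p b - 1) (p b - c b) (by omega) (by omega) (by omega) le_rfl
      have := h1 b'' b (by omega) (by omega)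
      have := hgap b''
      exact ih b'' (by omega) b' (by omega) (by omega) (by omega)
    · obtain ⟨b'', e1, e2⟩ := hP.down b (p b) (p b - c b - 1) (by omega) le_rfl (by omega) (by omega)
      have := h2 b'' b (by omega) (by omega)
      exact ih b'' (by omega) b' (by omega) (by omega) (by omega)

end RootSums

/-! ### Vanishing sums of singular parts -/

section CosetSums

open Finset MvPolynomial

variable {n : ℕ} {c y p : Fin n → ℤ} {a t : ℤ}

/-- Every refined node of a valid filling is an interval of a diagonal. -/
theorem exists_pred_of_lt (hP : IsPartition p c)
    (hK : ∀ b, t ≤ y b → ∀ b', p b' ≤ p b → p b' - c b' ≤ p b - c b → t ≤ y b')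
    {b b' : Fin n} (hd : sideNode c y t b = sideNode c y t b') (hlt : p b < p b') :
    ∃ b'', sideNode c y t b'' = sideNode c y t b' ∧ p b'' + 1 = p b' := by
  rw [sideNode_eq_iff] at hd
  have := hP.nonneg b
  have := hP.content_le b
  obtain ⟨b'', e1, e2⟩ := hP.down b' (p b' - 1) (p b' - c b' - 1) (by omega) (by omega)
    (by omega) (by omega)
  refine ⟨b'', sideNode_eq_iff.2 ⟨by omega, ?_⟩, by omega⟩
  have k1 := hK b'
  have k2 := hK b''
  rcases side_cases y t b' with h | h
  · rw [h]
    have h' := hd.2.trans h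
    rw [side_eq_zero] at h' ⊢
    by_contra! hle
    have := k2 hle b (by omega) (by omega)
    omega
  · rw [h]
    rw [side_eq_one] at h ⊢
    exact k1 h b'' (by omega) (by omega)

theorem exists_origin (hP : IsPartition p c)
    (hK : ∀ b, t ≤ y b → ∀ b', p b' ≤ p b → p b' - c b' ≤ p b - c b → t ≤ y b') :
    ∃ o : ℤ → ℤ, ∀ b, p b = o (sideNode c y t b) ∨
      ∃ b', sideNode c y t b' = sideNode c y t b ∧ p b' + 1 = p b := by
  classical
  let N : ℤ → Finset (Fin n) := fun z => univ.filter fun b => sideNode c y t b = z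
  refine ⟨fun z => if h : (N z).Nonempty then ((N z).image p).min' (h.image p) else 0, fun b => ?_⟩
  have hb : b ∈ N (sideNode c y t b) := by simp [N]
  have hne : (N (sideNode c y t b)).Nonempty := ⟨b, hb⟩
  simp only [dif_pos hne]
  obtain ⟨b0, hb0, h0⟩ := mem_image.1 (min'_mem _ (hne.image p))
  have hle := min'_le _ _ (mem_image_of_mem p hb)
  rw [← h0] at hle ⊢
  rcases hle.lt_or_eq with h | h
  · exact Or.inr (exists_pred_of_lt hP hK (mem_filter.1 hb0).2 h)
  · exact Or.inl h.symm

/-- When two slots of a refined node occupy consecutive boxes of a diagonal although they are not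
allowed to, the boxes between them on each of the two adjacent diagonals give a vanishing root. -/
theorem exists_vanishing_roots (hP : IsPartition p c)
    (hK : ∀ b, t ≤ y b → ∀ b', p b' ≤ p b → p b' - c b' ≤ p b - c b → t ≤ y b')
    {ρ : Equiv.Perm (Fin n)} (hρ : ρ ∈ nodePerms (sideNode c y t)) {l k : Fin n}
    (hd : sideNode c y t l = sideNode c y t k) (hR : ¬ y k ≤ y l + a) (h : p (ρ k) = p (ρ l) + 1) :
    (∃ q, min (c q.1) (c q.2) = c l ∧ ((q ∈ sameSet c y a t 1 0 ∧ p (ρ q.2) = p (ρ q.1) + 1) ∨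
      (q ∈ sameSet c y a t 0 1 ∧ p (ρ q.2) = p (ρ q.1) + 0))) ∧
    (∃ q, min (c q.1) (c q.2) = c l - 1 ∧ ((q ∈ sameSet c y a t 1 0 ∧ p (ρ q.2) = p (ρ q.1) + 1) ∨
      (q ∈ sameSet c y a t 0 1 ∧ p (ρ q.2) = p (ρ q.1) + 0))) := by
  have hρd := (mem_nodePerms _).1 hρ
  have hρ' : ∀ s, c (ρ s) = c s ∧ side y t (ρ s) = side y t s := fun s => sideNode_eq_iff.1 (hρd s)
  have hρi : ∀ s, c (ρ.symm s) = c s ∧ side y t (ρ.symm s) = side y t s := by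
    intro s
    have := hρ' (ρ.symm s)
    rw [Equiv.apply_symm_apply] at this
    exact ⟨this.1.symm, this.2.symm⟩
  obtain ⟨hc, hs⟩ := sideNode_eq_iff.1 hd
  have l1 := hP.nonneg (ρ l)
  have l2 := hP.content_le (ρ l)
  obtain ⟨k1, k2⟩ := hρ' k
  obtain ⟨l3, l4⟩ := hρ' l
  -- a box between those of `l` and `k` is on the same side
  have between : ∀ b, p (ρ l) ≤ p b → p (ρ l) - c l ≤ p b - c b → p b ≤ p (ρ k) →
      p b - c b ≤ p (ρ k) - c k → side y t b = side y t l := by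
    intro b h1 h2 h3 h4
    rcases side_cases y t l with h | h
    · rw [h]
      have h' := l4.trans h
      rw [side_eq_zero] at h' ⊢
      by_contra! hle
      have := hK b hle (ρ l) (by omega) (by omega)
      omega
    · rw [h]
      have h' := k2.trans (hs.symm.trans h)
      rw [side_eq_one] at h' ⊢
      exact hK (ρ k) h' b (by omega) (by omega)
  have mem : ∀ {q : Fin n × Fin n} {p r : ℤ}, c q.2 - c q.1 = p - r → y q.1 + p * a < y q.2 →
      side y t q.1 = side y t q.2 → q ∈ sameSet c y a t p r := by
    intro q p r h1 h2 h3
    exact mem_filter.2 ⟨mem_filter.2 ⟨mem_univ _, h1, h2⟩, h3⟩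
  constructor
  · obtain ⟨b, e1, e2⟩ := hP.down (ρ k) (p (ρ k)) (p (ρ k) - c (ρ k) - 1) (by omega) le_rfl
      (by omega) (by omega)
    have hb := between b (by omega) (by omega) (by omega) (by omega)
    obtain ⟨s, rfl⟩ := ρ.surjective b
    obtain ⟨s1, s2⟩ := hρ' s
    by_cases hy : y l + a < y s
    · refine ⟨(l, s), by simp only; omega, Or.inl ⟨mem ?_ ?_ ?_, ?_⟩⟩ <;> simp only <;> omega
    · refine ⟨(s, k), by simp only; omega, Or.inr ⟨mem ?_ ?_ ?_, ?_⟩⟩ <;> simp only <;> omega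
  · obtain ⟨b, e1, e2⟩ := hP.down (ρ k) (p (ρ k) - 1) (p (ρ k) - c (ρ k)) (by omega) (by omega)
      (by omega) le_rfl
    have hb := between b (by omega) (by omega) (by omega) (by omega)
    obtain ⟨s, rfl⟩ := ρ.surjective b
    obtain ⟨s1, s2⟩ := hρ' s
    by_cases hy : y l < y s
    · refine ⟨(l, s), by simp only; omega, Or.inr ⟨mem ?_ ?_ ?_, ?_⟩⟩ <;> simp only <;> omega
    · refine ⟨(s, k), by simp only; omega, Or.inl ⟨mem ?_ ?_ ?_, ?_⟩⟩ <;> simp only <;> omega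

/-- The product of the roots between slots of the same side that satisfy the predicate `P`. -/
def parityPoly (c y : Fin n → ℤ) (a t : ℤ) (P : Fin n × Fin n → Prop) [DecidablePred P] :
    MvPolynomial (Fin n) ℚ :=
  rootPoly ((sameSet c y a t 1 0).filter P) 1 * rootPoly ((sameSet c y a t 0 1).filter P) 0

variable (P : Fin n × Fin n → Prop) [DecidablePred P]

theorem eval_parityPoly_eq_zero {x : Fin n → ℤ} {q : Fin n × Fin n} (hP : P q)
    (h : (q ∈ sameSet c y a t 1 0 ∧ x q.2 = x q.1 + 1) ∨
      (q ∈ sameSet c y a t 0 1 ∧ x q.2 = x q.1 + 0)) :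
    eval (fun s => (x s : ℚ)) (parityPoly c y a t P) = 0 := by
  rw [parityPoly, map_mul, eval_rootPoly, eval_rootPoly]
  rcases h with ⟨h1, h2⟩ | ⟨h1, h2⟩
  · rw [rootProd_eq_zero (mem_filter.2 ⟨h1, hP⟩) h2, zero_mul]
  · rw [rootProd_eq_zero (mem_filter.2 ⟨h1, hP⟩) h2, mul_zero]

theorem eval_parityPoly_mul (x : Fin n → ℚ) :
    eval x (parityPoly c y a t P) * eval x (parityPoly c y a t fun q => ¬ P q) =
      rootProd (sameSet c y a t 1 0) 1 x * rootProd (sameSet c y a t 0 1) 0 x := by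
  simp only [parityPoly, map_mul, eval_rootPoly]
  unfold rootProd
  rw [← prod_filter_mul_prod_filter_not (sameSet c y a t 1 0) P,
    ← prod_filter_mul_prod_filter_not (sameSet c y a t 0 1) P]
  ring

theorem totalDegree_parityPoly_add_le :
    (parityPoly c y a t P).totalDegree + (parityPoly c y a t fun q => ¬ P q).totalDegree ≤
      #(sameSet c y a t 1 0) + #(sameSet c y a t 0 1) := by
  rw [← card_filter_add_card_filter_not (s := sameSet c y a t 1 0) P,
    ← card_filter_add_card_filter_not (s := sameSet c y a t 0 1) P]
  have h := fun (Q : Fin n × Fin n → Prop) [DecidablePred Q] =>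
    (totalDegree_mul (rootPoly ((sameSet c y a t 1 0).filter Q) 1)
    (rootPoly ((sameSet c y a t 0 1).filter Q) 0)).trans
    (add_le_add (totalDegree_rootPoly_le _ _) (totalDegree_rootPoly_le _ _))
  refine (add_le_add (h P) (h fun q => ¬ P q)).trans (le_of_eq ?_)
  ring

variable (c y t) in
/-- The pairs of slots of a refined node with equal `y`. -/
def tieSet : Finset (Fin n × Fin n) :=
  (nodePairs (sideNode c y t)).filter fun q => ¬ y q.1 < y q.2

theorem sameSet_zero_zero (hy : Monotone y) :
    sameSet c y a t 0 0 = (nodePairs (sideNode c y t)).filter fun q => y q.1 < y q.2 := by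
  ext q
  simp only [sameSet, rootSet, nodePairs, mem_filter, mem_univ, true_and, sideNode_eq_iff]
  constructor
  · rintro ⟨⟨h1, h2⟩, h3⟩
    have : y q.1 < y q.2 := by simpa using h2
    exact ⟨⟨by_contra fun h => absurd (hy (not_lt.1 h)) (not_le.2 this), by omega, h3⟩, this⟩
  · rintro ⟨⟨_, h1, h2⟩, h3⟩
    exact ⟨⟨by omega, by simpa using h3⟩, h2⟩

theorem sameSet_one_one (hy : Monotone y) (ha : 0 ≤ a) :
    sameSet c y a t 1 1 = forbiddenPairs (sideNode c y t) fun l k => y k ≤ y l + a := by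
  ext q
  simp only [sameSet, rootSet, forbiddenPairs, nodePairs, mem_filter, mem_univ, true_and,
    sideNode_eq_iff]
  constructor
  · rintro ⟨⟨h1, h2⟩, h3⟩
    have : y q.1 < y q.2 := by omega
    exact ⟨⟨by_contra fun h => absurd (hy (not_lt.1 h)) (not_le.2 this), by omega, h3⟩, by omega⟩
  · rintro ⟨⟨_, h1, h2⟩, h3⟩
    exact ⟨⟨by omega, by omega⟩, h2⟩

theorem vand_sideNode (hy : Monotone y) (x : Fin n → ℚ) :
    vand (sideNode c y t) x = rootProd (sameSet c y a t 0 0) 0 x * rootProd (tieSet c y t) 0 x := by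
  rw [sameSet_zero_zero hy, tieSet]
  unfold rootProd vand
  rw [prod_filter_mul_prod_filter_not]
  simp

theorem card_nodePairs_sideNode (hy : Monotone y) :
    #(nodePairs (sideNode c y t)) = #(sameSet c y a t 0 0) + #(tieSet c y t) := by
  rw [sameSet_zero_zero hy, tieSet, card_filter_add_card_filter_not]

theorem totalDegree_prod_le {s : Finset (Fin n)} {φ : Fin n → MvPolynomial (Fin n) ℚ}
    (h : ∀ i, (φ i).totalDegree ≤ 1) : (∏ i ∈ s, φ i).totalDegree ≤ #s := by
  refine (totalDegree_finsetProd _ _).trans ?_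
  rw [card_eq_sum_ones]
  exact sum_le_sum fun i _ => h i

/-- The terms of the fixed points for which the slots above the threshold occupy a given order
ideal cancel in low degree. -/
theorem sum_sideNode_perms_eq_zero (hP : IsPartition p c) (hy : Monotone y) (ha : 0 ≤ a)
    (ht : t ≤ 0) (hgap : ∀ s, t ≤ y s ∨ y s + a < t)
    (hvalid : rootNumer c y a (fun s => (p s : ℚ)) ≠ 0) (α : Fin n → ℕ)
    (hα : rootDegree c y a + ∑ s, (α s : ℤ) ≤ 0)
    (hα' : rootDegree c y a + ∑ s, (α s : ℤ) = 0 → ∃ s, y s < t) :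
    ∑ ρ ∈ nodePerms (sideNode c y t), rootNumer c y a (fun s => (p (ρ s) : ℚ)) /
      rootDenom c y a (fun s => (p (ρ s) : ℚ)) * ∏ s, (p (ρ s) : ℚ) ^ α s = 0 := by
  obtain ⟨v1, v2, -⟩ := rootNumer_ne_zero hvalid
  have hK := order_ideal hP hgap v1 v2
  obtain ⟨o, ho⟩ := exists_origin hP hK
  -- the pairs of adjacent diagonals are divided among the two factors by parity
  let Ev : Fin n × Fin n → Prop := fun q => Even (min (c q.1) (c q.2))
  let f := parityPoly c y a t Ev
  let g' := parityPoly c y a t fun q => ¬ Ev q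
  let HK : Finset (Fin n) := (frameHigh c y a).filter fun s => t ≤ y s
  let L0 : Finset (Fin n) := univ.filter fun s => c s = 0 ∧ y s < t
  have hL0 : (frameHigh c y a).filter (fun s => ¬ t ≤ y s) = L0 := by
    ext s
    have := hgap s
    simp only [frameHigh, L0, mem_filter, mem_univ, true_and]
    constructor <;> intro h <;> omega
  let g := g' * (∏ s ∈ frameLow c y, X s) * (∏ s ∈ HK, (-X s - C 1)) *
    rootPoly (tieSet c y t) 0 * monomial (Finsupp.equivFunOnFinite.symm α) 1
  have hinj : ∀ b b', sideNode c y t b = sideNode c y t b' → p b = p b' → b = b' :=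
    fun b b' h h' => hP.inj b b' (sideNode_eq_iff.1 h).1 h'
  have hvan : ∀ ρ ∈ nodePerms (sideNode c y t), (∃ l k, sideNode c y t l = sideNode c y t k ∧
      ¬ (y k ≤ y l + a) ∧ p (ρ k) = p (ρ l) + 1) → eval (fun s => (p (ρ s) : ℚ)) f = 0 ∧
        eval (fun s => (p (ρ s) : ℚ)) g' = 0 := by
    rintro ρ hρ ⟨l, k, hd, hR, h⟩
    obtain ⟨⟨q, hq, hq'⟩, r, hr, hr'⟩ := exists_vanishing_roots hP hK hρ hd hR h
    by_cases he : Even (c l)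
    · refine ⟨eval_parityPoly_eq_zero (x := fun s => p (ρ s)) Ev (by simpa only [Ev, hq]) hq',
        eval_parityPoly_eq_zero (x := fun s => p (ρ s)) _ ?_ hr'⟩
      simp only [Ev, hr]
      intro h'
      have := he.sub h'
      simp at this
    · refine ⟨eval_parityPoly_eq_zero (x := fun s => p (ρ s)) Ev ?_ hr',
        eval_parityPoly_eq_zero (x := fun s => p (ρ s)) _ (by simpa only [Ev, hq]) hq'⟩
      simp only [Ev, hr]
      rw [Int.not_even_iff_odd] at he
      exact he.sub_odd odd_one
  have hg0 : ∀ x : Fin n → ℚ, eval x g = eval x g' * (∏ s ∈ frameLow c y, x s) *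
      (∏ s ∈ HK, (-x s - 1)) * rootProd (tieSet c y t) 0 x * ∏ s, x s ^ α s := by
    intro x
    simp [g, eval_rootPoly, eval_monomial, Finsupp.prod_fintype]
  have key := sum_eval_mul_eval_div_eq_zero (c := sideNode c y t) (p := p) (o := o)
    (R := fun l k => y k ≤ y l + a) (fun i j h => by have := hy h; omega)
    (fun i j k h h' => by have := hy h; omega) hinj ho f g (fun ρ hρ h => (hvan ρ hρ h).1)
    (fun ρ hρ h => by rw [hg0, (hvan ρ hρ h).2]; simp) ?_
  · -- the factors that involve both sides are the same for all permutations
    let κ : ℚ := rootProd (crossSet c y t 1) 1 (fun s => (p s : ℚ)) *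
      rootProd (crossSet c y t (-1)) 0 (fun s => (p s : ℚ)) * (∏ s ∈ L0, (-(p s : ℚ) - 1)) /
      (rootProd (crossSet c y t 0) 0 (fun s => (p s : ℚ)) *
        rootProd (crossSet c y t 0) 1 (fun s => (p s : ℚ)))
    rw [← mul_zero κ, ← key, mul_sum]
    refine sum_congr rfl fun ρ hρ => ?_
    have hcross : ∀ e r : ℤ, rootProd (crossSet c y t e) r (fun s => (p (ρ s) : ℚ)) =
        rootProd (crossSet c y t e) r (fun s => (p s : ℚ)) := by
      intro e r
      refine rootProd_comp_nodePerm hρ ?_ r (fun s => (p s : ℚ))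
      intro q q' h1 h2 hq
      rw [sideNode_eq_iff] at h1 h2
      simp only [crossSet, mem_filter, mem_univ, true_and, ← side_eq_zero, ← side_eq_one] at hq ⊢
      omega
    have hLow : ∏ s ∈ L0, (-(p (ρ s) : ℚ) - 1) = ∏ s ∈ L0, (-(p s : ℚ) - 1) := by
      have hmem : ∀ s, ρ s ∈ L0 ↔ s ∈ L0 := by
        intro s
        obtain ⟨h1, h2⟩ := sideNode_eq_iff.1 ((mem_nodePerms _).1 hρ s)
        simp only [L0, mem_filter, mem_univ, true_and, ← side_eq_zero]
        omega
      exact prod_bijective ρ ρ.bijective (fun s => (hmem s).symm) fun _ _ => rfl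
    -- pairs with equal levels occur in the Vandermonde product, but not in the denominator
    have htie : rootProd (tieSet c y t) 0 (fun s => (p (ρ s) : ℚ)) ≠ 0 := by
      refine prod_ne_zero_iff.2 fun q hq h => ?_
      obtain ⟨_, h1, h2⟩ := mem_filter.1 (mem_filter.1 hq).1
      have hρ1 := (mem_nodePerms _).1 hρ
      have h3 : (p (ρ q.2) : ℚ) = p (ρ q.1) := by
        push_cast at h
        linarith
      exact h1.ne (ρ.injective (hinj _ _ (by rw [hρ1, hρ1, h2]) (by exact_mod_cast h3.symm)))
    have hforb : ∏ q ∈ forbiddenPairs (sideNode c y t) (fun l k => y k ≤ y l + a),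
        ((p (ρ q.2) : ℚ) - p (ρ q.1) - 1) =
        rootProd (sameSet c y a t 1 1) 1 (fun s => (p (ρ s) : ℚ)) := by
      rw [sameSet_one_one hy ha]
      unfold rootProd
      simp
    have hfg := eval_parityPoly_mul (c := c) (y := y) (a := a) (t := t) Ev
      (fun s => (p (ρ s) : ℚ))
    rw [hforb, vand_sideNode (a := a) hy, hg0, rootNumer, rootDenom,
      rootProd_split ha hgap zero_le_one le_rfl, rootProd_split ha hgap le_rfl zero_le_one,
      rootProd_split ha hgap le_rfl zero_le_one, rootProd_split ha hgap zero_le_one le_rfl,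
      ← prod_filter_mul_prod_filter_not (frameHigh c y a) (fun s => t ≤ y s), hL0, hLow]
    simp only [hcross, sub_self, sub_zero, zero_sub]
    have halg : ∀ F G S T V A B C D E E' L H W m : ℚ, V ≠ 0 → F * G = S * T →
        S * C * (T * D) * L * (H * W) / (A * E * (B * E')) * m =
        C * D * W / (E * E') * (F * (G * L * H * V * m) / (B * (A * V))) := by
      intro F G S T V A B C D E E' L H W m hV hFG
      calc _ = C * D * W * L * H * m * (S * T) * (E * E' * B * A)⁻¹ := by
            rw [div_eq_mul_inv, show A * E * (B * E') = E * E' * B * A by ring]; ring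
        _ = C * D * W * L * H * m * (F * G) * (E * E' * B * A)⁻¹ * (V * V⁻¹) := by
            rw [hFG, mul_inv_cancel₀ hV, mul_one]
        _ = _ := by
            simp only [div_eq_mul_inv, mul_inv]
            ring
    exact halg _ _ _ _ _ _ _ _ _ _ _ _ _ _ _ htie hfg
  · have d1 : f.totalDegree + g'.totalDegree ≤ _ := totalDegree_parityPoly_add_le Ev
    have d2 : (∏ s ∈ frameLow c y, (X s : MvPolynomial (Fin n) ℚ)).totalDegree ≤
        #(frameLow c y) := totalDegree_prod_le fun i => (totalDegree_X i).le
    have d3 : (∏ s ∈ HK, (-X s - C 1 : MvPolynomial (Fin n) ℚ)).totalDegree ≤ #HK :=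
      totalDegree_prod_le fun i => (totalDegree_sub_C_le _ _).trans (by simp)
    have d4 := totalDegree_rootPoly_le (tieSet c y t) 0
    have d5 : (monomial (Finsupp.equivFunOnFinite.symm α) (1 : ℚ)).totalDegree = ∑ s, α s := by
      rw [totalDegree_monomial _ one_ne_zero, Finsupp.sum_fintype _ _ (fun _ => rfl)]
      rfl
    have d6 : g.totalDegree ≤ g'.totalDegree + #(frameLow c y) + #HK + #(tieSet c y t) +
        ∑ s, α s := by
      refine (totalDegree_mul _ _).trans (add_le_add ?_ d5.le)
      refine (totalDegree_mul _ _).trans (add_le_add ?_ d4)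
      refine (totalDegree_mul _ _).trans (add_le_add ?_ d3)
      exact (totalDegree_mul _ _).trans (add_le_add le_rfl d2)
    have e1 := card_rootSet_split (c := c) ha hgap zero_le_one le_rfl 0
    have e2 := card_rootSet_split (c := c) ha hgap le_rfl zero_le_one 1
    have e3 := card_rootSet_split (c := c) ha hgap le_rfl zero_le_one 0
    have e4 := card_rootSet_split (c := c) ha hgap zero_le_one le_rfl 1
    have e5 : #(frameHigh c y a) = #HK + #L0 := by
      rw [← hL0]
      exact (card_filter_add_card_filter_not _).symm
    have e6 := card_nodePairs_sideNode (c := c) (a := a) (t := t) hy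
    have e7 := congrArg card (sameSet_one_one (c := c) (a := a) (t := t) hy ha)
    obtain ⟨x1, x2⟩ := card_cross hP hK
    simp only [sub_self, sub_zero, zero_sub] at e1 e2 e3 e4
    unfold rootDegree at hα hα'
    have hsum : ((∑ s, α s : ℕ) : ℤ) = ∑ s, (α s : ℤ) := by push_cast; rfl
    rw [← hsum] at hα hα'
    change (2 * #(crossSet c y t 0) : ℤ) ≤ _ + _ + #L0 at x1
    change _ → (2 * #(crossSet c y t 0) : ℤ) < _ + _ + #L0 at x2
    rw [← e7]
    by_cases hL : ∃ s, y s < t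
    · have := x2 hL
      omega
    · have : rootDegree c y a + ∑ s, (α s : ℤ) ≠ 0 := fun h => hL (hα' (by
        rw [← hsum] at h; exact h))
      rw [rootDegree, ← hsum] at this
      omega

/-- The cancellation of the polar parts of the weights: the terms of all fixed points with a given
restricted character sum up to zero in low degree. -/
theorem sum_root_terms_eq_zero {I : Fin n → ℤ} (hP : IsPartition I c) (hy : Monotone y)
    (ha : 0 ≤ a) (ht : t ≤ 0) (hgap : ∀ s, t ≤ y s ∨ y s + a < t) (α : Fin n → ℕ)
    (hα : rootDegree c y a + ∑ s, (α s : ℤ) ≤ 0)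
    (hα' : rootDegree c y a + ∑ s, (α s : ℤ) = 0 → ∃ s, y s < t) :
    ∑ σ ∈ nodePerms c, rootNumer c y a (fun s => (I (σ s) : ℚ)) /
      rootDenom c y a (fun s => (I (σ s) : ℚ)) * ∏ s, (I (σ s) : ℚ) ^ α s = 0 := by
  classical
  -- the labellings are grouped by the set of boxes that are occupied above the threshold
  let W : Equiv.Perm (Fin n) → Finset (Fin n) := fun σ => (univ.filter fun s => t ≤ y s).image σ
  rw [← sum_fiberwise (s := nodePerms c) (g := W)]
  refine sum_eq_zero fun w _ => ?_
  by_cases hex : ∃ σ ∈ nodePerms c, W σ = w ∧ rootNumer c y a (fun s => (I (σ s) : ℚ)) ≠ 0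
  · obtain ⟨σ₀, hσ₀, hw, hne⟩ := hex
    have h0 := (mem_nodePerms _).1 hσ₀
    have hW : ∀ σ s, σ s ∈ W σ ↔ t ≤ y s := by
      intro σ s
      simp [W]
    have hP' : IsPartition (fun s => I (σ₀ s)) c := by
      refine ⟨fun b => hP.nonneg _, fun b => ?_, fun b b' h h' => ?_, fun b i j h1 h2 h3 h4 => ?_⟩
      · rw [← h0]; exact hP.content_le _
      · exact σ₀.injective (hP.inj _ _ (by rw [h0, h0, h]) h')
      · obtain ⟨b', e1, e2⟩ := hP.down (σ₀ b) i j h1 h2 h3 (by rw [h0]; exact h4)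
        exact ⟨σ₀.symm b', by simpa using e1, by rw [← h0 (σ₀.symm b'), Equiv.apply_symm_apply, e2]⟩
    rw [← sum_sideNode_perms_eq_zero hP' hy ha ht hgap hne α hα hα']
    refine sum_nbij' (fun σ => σ₀⁻¹ * σ) (fun ρ => σ₀ * ρ) ?_ ?_ ?_ ?_ ?_
    · intro σ hσ
      obtain ⟨h1, h2⟩ := mem_filter.1 hσ
      rw [mem_nodePerms] at h1 ⊢
      intro s
      have e : σ₀ ((σ₀⁻¹ * σ) s) = σ s := by simp
      rw [sideNode_eq_iff]
      refine ⟨by rw [← h0, e, h1], ?_⟩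
      have h3 := hW σ₀ ((σ₀⁻¹ * σ) s)
      rw [e, hw, ← h2, hW] at h3
      have := side_cases y t s
      have := side_cases y t ((σ₀⁻¹ * σ) s)
      rw [← side_eq_one, ← side_eq_one] at h3
      omega
    · intro ρ hρ
      rw [mem_nodePerms] at hρ
      have hρ' := fun s => sideNode_eq_iff.1 (hρ s)
      refine mem_filter.2 ⟨(mem_nodePerms _).2 fun s => ?_, ?_⟩
      · rw [Equiv.Perm.mul_apply, h0]; exact (hρ' s).1
      · rw [← hw]
        ext b
        obtain ⟨s, rfl⟩ := (σ₀ * ρ).surjective b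
        rw [hW, Equiv.Perm.mul_apply, hW, ← side_eq_one, ← side_eq_one, (hρ' s).2]
    · intro σ _; simp
    · intro ρ _; simp
    · intro σ _; simp
  · push Not at hex
    refine sum_eq_zero fun σ hσ => ?_
    obtain ⟨h1, h2⟩ := mem_filter.1 hσ
    rw [hex σ h1 h2]
    simp

end CosetSums

/-! ### The monomial basis of `M₃ / ⟨1⟩` -/

section MonomialBasis

variable (μ : YoungDiagram)

/-- The class of `x₁^i x₂^j x₃^n` in `M₃ / ⟨1⟩`. -/
def mon (i j : ℕ) (n : ℤ) : M3 μ ⧸ unitSubmodule μ :=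
  (unitSubmodule μ).mkQ (M3.mk μ n (MvPolynomial.X 0 ^ i * MvPolynomial.X 1 ^ j))

theorem mon_eq_zero_of_nonneg {i j : ℕ} {n : ℤ} (hn : 0 ≤ n) : mon μ i j n = 0 := by
  obtain ⟨k, rfl⟩ := Int.eq_ofNat_of_zero_le hn
  exact (Submodule.Quotient.mk_eq_zero _).2 (mk_zero_mem μ k _)

theorem mon_eq_zero_of_notMem {i j : ℕ} {n : ℤ} (h : (i, j) ∉ μ) : mon μ i j n = 0 := by
  have : M3.mk μ n (MvPolynomial.X 0 ^ i * MvPolynomial.X 1 ^ j) = 0 := by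
    have h0 : Ideal.Quotient.mk (monomialIdeal μ) (MvPolynomial.X 0 ^ i * MvPolynomial.X 1 ^ j) =
        0 := Ideal.Quotient.eq_zero_iff_mem.2 (Ideal.subset_span ⟨i, j, h, rfl⟩)
    unfold M3.mk
    rw [h0]
    exact TensorProduct.tmul_zero _ _
  rw [mon, this, map_zero]

theorem X_zero_smul_mon (i j : ℕ) (n : ℤ) :
    (MvPolynomial.X 0 : R3) • mon μ i j n = mon μ (i + 1) j n := by
  rw [mon, ← map_smul, Algebra.smul_def, algebraMap_R3_apply, MvPolynomial.aeval_X]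
  change (unitSubmodule μ).mkQ (M3.mk μ 0 (MvPolynomial.X 0) * _) = _
  rw [M3.mk_mul, zero_add, mon]
  congr 2
  ring

theorem X_one_smul_mon (i j : ℕ) (n : ℤ) :
    (MvPolynomial.X 1 : R3) • mon μ i j n = mon μ i (j + 1) n := by
  rw [mon, ← map_smul, Algebra.smul_def, algebraMap_R3_apply, MvPolynomial.aeval_X]
  change (unitSubmodule μ).mkQ (M3.mk μ 0 (MvPolynomial.X 1) * _) = _
  rw [M3.mk_mul, zero_add, mon]
  congr 2
  ring

theorem X_two_smul_mon (i j : ℕ) (n : ℤ) :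
    (MvPolynomial.X 2 : R3) • mon μ i j n = mon μ i j (n + 1) := by
  rw [mon, ← map_smul, Algebra.smul_def, algebraMap_R3_apply, MvPolynomial.aeval_X]
  change (unitSubmodule μ).mkQ (M3.mk μ 1 1 * _) = _
  rw [M3.mk_mul, one_mul, mon, add_comm]

theorem actQuot_mon (t : Torus) (i j : ℕ) (n : ℤ) :
    actQuot μ t (mon μ i j n) =
      (((t 0 : ℂˣ) : ℂ) ^ (i : ℤ) * ((t 1 : ℂˣ) : ℂ) ^ (j : ℤ) * ((t 2 : ℂˣ) : ℂ) ^ n) •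
        mon μ i j n := by
  have h : actQuot μ t (mon μ i j n) = (unitSubmodule μ).mkQ
      (actM3 μ t (M3.mk μ n (MvPolynomial.X 0 ^ i * MvPolynomial.X 1 ^ j))) := rfl
  have h2 : planeScale (t 0) (t 1) (MvPolynomial.X 0 ^ i * MvPolynomial.X 1 ^ j) =
      (((t 0 : ℂˣ) : ℂ) ^ i * ((t 1 : ℂˣ) : ℂ) ^ j) •
        (MvPolynomial.X 0 ^ i * MvPolynomial.X 1 ^ j) := by
    simp only [planeScale, map_mul, map_pow, MvPolynomial.aeval_X, Matrix.cons_val_zero,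
      Matrix.cons_val_one, MvPolynomial.smul_eq_C_mul]
    ring
  rw [h, actM3_mk, h2, M3.mk_smul, smul_smul, mon]
  have h3 : ∀ (z : ℂ) (m : M3 μ), (unitSubmodule μ).mkQ (z • m) = z • (unitSubmodule μ).mkQ m :=
    fun z m => rfl
  rw [h3]
  congr 1
  push_cast
  simp only [zpow_natCast]
  ring

/-- The exponent of `x₁^i x₂^j`. -/
def planeExp (i j : ℕ) : Fin 2 →₀ ℕ := Finsupp.equivFunOnFinite.symm ![i, j]

theorem planeExp_inj {i j i' j' : ℕ} : planeExp i j = planeExp i' j' ↔ i = i' ∧ j = j' := by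
  rw [planeExp, planeExp, Equiv.apply_eq_iff_eq]
  simp

theorem X_pow_mul_X_pow (i j : ℕ) : (MvPolynomial.X 0 ^ i * MvPolynomial.X 1 ^ j :
    MvPolynomial (Fin 2) ℂ) = MvPolynomial.monomial (planeExp i j) 1 := by
  have : (Finsupp.single 0 i + Finsupp.single 1 j : Fin 2 →₀ ℕ) = planeExp i j := by
    ext k
    fin_cases k <;> simp [planeExp]
  rw [MvPolynomial.X_pow_eq_monomial, MvPolynomial.X_pow_eq_monomial, MvPolynomial.monomial_mul,
    mul_one, this]

theorem coeff_eq_zero_of_mem_monomialIdeal {i j : ℕ} (h : (i, j) ∈ μ)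
    {p : MvPolynomial (Fin 2) ℂ} (hp : p ∈ monomialIdeal μ) :
    MvPolynomial.coeff (planeExp i j) p = 0 := by
  have hs : {p : MvPolynomial (Fin 2) ℂ | ∃ i j : ℕ, (i, j) ∉ μ ∧
      p = MvPolynomial.X 0 ^ i * MvPolynomial.X 1 ^ j} =
      (fun s => MvPolynomial.monomial s (1 : ℂ)) '' {s | ∃ i j : ℕ, (i, j) ∉ μ ∧ s = planeExp i j} := by
    ext p
    constructor
    · rintro ⟨i, j, h, rfl⟩
      exact ⟨planeExp i j, ⟨i, j, h, rfl⟩, (X_pow_mul_X_pow i j).symm⟩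
    · rintro ⟨_, ⟨i, j, h, rfl⟩, rfl⟩
      exact ⟨i, j, h, (X_pow_mul_X_pow i j).symm⟩
  rw [monomialIdeal, hs, MvPolynomial.mem_ideal_span_monomial_image] at hp
  by_contra hne
  obtain ⟨_, ⟨i', j', h', rfl⟩, hle⟩ := hp _ (MvPolynomial.mem_support_iff.2 hne)
  have h0 : i' ≤ i := by simpa [planeExp] using hle 0
  have h1 : j' ≤ j := by simpa [planeExp] using hle 1
  exact h' (μ.isLowerSet (show ((i', j') : ℕ × ℕ) ≤ (i, j) from ⟨h0, h1⟩) h)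

variable {μ}

/-- The coefficient of `x₁^i x₂^j x₃^n`, as a functional on `M₃`. -/
def coeffM3 {i j : ℕ} (h : (i, j) ∈ μ) (n : ℤ) : M3 μ →ₗ[ℂ] ℂ :=
  TensorProduct.lift
    ((LinearMap.toSpanSingleton ℂ _
      ((((monomialIdeal μ).restrictScalars ℂ).liftQ (MvPolynomial.lcoeff ℂ (planeExp i j))
        (fun _ hp => coeff_eq_zero_of_mem_monomialIdeal μ h hp)).comp
        (Submodule.Quotient.restrictScalarsEquiv ℂ (monomialIdeal μ)).symm.toLinearMap)).comp
      ((Finsupp.lapply n).comp (AddMonoidAlgebra.coeffLinearEquiv ℂ).toLinearMap))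

theorem coeffM3_mk {i j : ℕ} (h : (i, j) ∈ μ) (n n' : ℤ) (p : MvPolynomial (Fin 2) ℂ) :
    coeffM3 h n (M3.mk μ n' p) = if n' = n then MvPolynomial.coeff (planeExp i j) p else 0 := by
  have : coeffM3 h n (M3.mk μ n' p) =
      ((LaurentPolynomial.T n' : ℂ[T;T⁻¹]).coeff n) • MvPolynomial.coeff (planeExp i j) p := rfl
  rw [this, LaurentPolynomial.T_apply]
  split_ifs <;> simp

theorem coeffM3_eq_zero_of_mem {i j : ℕ} (h : (i, j) ∈ μ) {n : ℤ} (hn : n < 0) {m : M3 μ}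
    (hm : m ∈ unitSubmodule μ) : coeffM3 h n m = 0 := by
  obtain ⟨r, rfl⟩ := Submodule.mem_span_singleton.1 hm
  induction r using MvPolynomial.induction_on' with
  | monomial d z =>
    have hX : ∀ k : Fin 2, ∀ e : ℕ, coordM3 μ k.castSucc ^ e = M3.mk μ 0 (MvPolynomial.X k ^ e) := by
      intro k e
      have h2 : coordM3 μ k.castSucc = M3.mk μ 0 (MvPolynomial.X k) := by fin_cases k <;> rfl
      induction e with
      | zero => simp [M3.mk_zero_one]
      | succ e ih => rw [pow_succ, pow_succ, ih, h2, M3.mk_mul, add_zero]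
    have h1 : (MvPolynomial.monomial d z : R3) • (1 : M3 μ) =
        z • M3.mk μ (d 2) (MvPolynomial.X 0 ^ d 0 * MvPolynomial.X 1 ^ d 1) := by
      rw [MvPolynomial.monomial_eq, Finsupp.prod_fintype _ _ (fun _ => pow_zero _),
        Fin.prod_univ_three, ← MvPolynomial.smul_eq_C_mul, smul_assoc]
      congr 1
      rw [mul_comm, mul_smul, Algebra.smul_def (_ * _) (1 : M3 μ), mul_one, map_mul,
        algebraMap_R3_apply, algebraMap_R3_apply, map_pow, map_pow, MvPolynomial.aeval_X,
        MvPolynomial.aeval_X]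
      have h0 := hX 0 (d 0)
      have h1 := hX 1 (d 1)
      simp only [Fin.castSucc_zero, Fin.castSucc_one] at h0 h1
      rw [h0, h1, M3.mk_mul, X_two_smul_mk]
      simp
    rw [h1, map_smul, coeffM3_mk, if_neg (by omega), smul_zero]
  | add p q hp hq =>
    rw [add_smul, map_add, hp (Submodule.smul_mem _ _ (Submodule.mem_span_singleton_self _)),
      hq (Submodule.smul_mem _ _ (Submodule.mem_span_singleton_self _)), add_zero]

/-- The coefficient of `x₁^i x₂^j x₃^n`, `n < 0`, as a functional on `M₃ / ⟨1⟩`. -/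
def coeffQuot {i j : ℕ} (h : (i, j) ∈ μ) {n : ℤ} (hn : n < 0) :
    (M3 μ ⧸ unitSubmodule μ) →ₗ[ℂ] ℂ :=
  (((unitSubmodule μ).restrictScalars ℂ).liftQ (coeffM3 h n)
    (fun _ hm => coeffM3_eq_zero_of_mem h hn hm)).comp
    (Submodule.Quotient.restrictScalarsEquiv ℂ (unitSubmodule μ)).symm.toLinearMap

theorem coeffQuot_mon {i j : ℕ} (h : (i, j) ∈ μ) {n : ℤ} (hn : n < 0) (i' j' : ℕ) (n' : ℤ) :
    coeffQuot h hn (mon μ i' j' n') = if i' = i ∧ j' = j ∧ n' = n then 1 else 0 := by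
  have : coeffQuot h hn (mon μ i' j' n') =
    coeffM3 h n (M3.mk μ n' (MvPolynomial.X 0 ^ i' * MvPolynomial.X 1 ^ j')) := rfl
  rw [this, coeffM3_mk, X_pow_mul_X_pow, MvPolynomial.coeff_monomial]
  simp only [planeExp_inj]
  by_cases h1 : n' = n <;> simp [h1]

variable (μ)

/-- The monomials `x₁^i x₂^j x₃^(-k-1)` with `(i,j) ∈ μ`. -/
abbrev MonIndex : Type := {x : (ℕ × ℕ) × ℕ // x.1 ∈ μ}

/-- The weight of a monomial. -/
def MonIndex.weight {μ : YoungDiagram} (x : MonIndex μ) : Fin 3 → ℤ :=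
  ![(x.1.1.1 : ℤ), (x.1.1.2 : ℤ), -(x.1.2 : ℤ) - 1]

theorem MonIndex.weight_injective : Function.Injective (MonIndex.weight (μ := μ)) := by
  rintro ⟨⟨⟨i, j⟩, k⟩, h⟩ ⟨⟨⟨i', j'⟩, k'⟩, h'⟩ he
  have h0 := congrFun he 0
  have h1 := congrFun he 1
  have h2 := congrFun he 2
  simp [MonIndex.weight] at h0 h1 h2
  simp
  omega

/-- The class of a monomial in `M₃ / ⟨1⟩`. -/
def monVec (x : MonIndex μ) : M3 μ ⧸ unitSubmodule μ := mon μ x.1.1.1 x.1.1.2 (-(x.1.2 : ℤ) - 1)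

theorem coeffQuot_monVec (x y : MonIndex μ) :
    coeffQuot (i := x.1.1.1) (j := x.1.1.2) x.2 (n := -(x.1.2 : ℤ) - 1) (by omega) (monVec μ y) =
      if y = x then 1 else 0 := by
  rw [monVec, coeffQuot_mon]
  obtain ⟨⟨⟨i, j⟩, k⟩, h⟩ := x
  obtain ⟨⟨⟨i', j'⟩, k'⟩, h'⟩ := y
  congr 1
  simp
  omega

theorem mk_mem_span (n : ℤ) (p : MvPolynomial (Fin 2) ℂ) :
    (unitSubmodule μ).mkQ (M3.mk μ n p) ∈ Submodule.span ℂ (Set.range (monVec μ)) := by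
  induction p using MvPolynomial.induction_on' with
  | monomial d z =>
    have h1 : MvPolynomial.monomial d z =
        z • (MvPolynomial.X 0 ^ d 0 * MvPolynomial.X 1 ^ d 1 : MvPolynomial (Fin 2) ℂ) := by
      have : planeExp (d 0) (d 1) = d := by
        ext k
        fin_cases k <;> simp [planeExp]
      rw [X_pow_mul_X_pow, MvPolynomial.smul_monomial, smul_eq_mul, mul_one, this]
    rw [h1, M3.mk_smul]
    refine Submodule.smul_mem _ z (?_ : mon μ (d 0) (d 1) n ∈ _)
    by_cases h : (d 0, d 1) ∈ μ
    · by_cases hn : 0 ≤ n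
      · rw [mon_eq_zero_of_nonneg μ hn]; exact zero_mem _
      · refine Submodule.subset_span ⟨⟨((d 0, d 1), (-n - 1).toNat), h⟩, ?_⟩
        simp only [monVec]
        congr 1
        omega
    · rw [mon_eq_zero_of_notMem μ h]; exact zero_mem _
  | add p q hp hq =>
    have : M3.mk μ n (p + q) = M3.mk μ n p + M3.mk μ n q := by
      unfold M3.mk
      rw [map_add]
      exact TensorProduct.tmul_add _ _ _
    rw [this, map_add]
    exact add_mem hp hq

/-- The monomial basis of `M₃ / ⟨1⟩`. -/
def monBasis : Module.Basis (MonIndex μ) ℂ (M3 μ ⧸ unitSubmodule μ) := by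
  refine Module.Basis.mk (v := monVec μ) ?_ ?_
  · rw [linearIndependent_iff']
    intro s g hg x hx
    have := congrArg (coeffQuot (i := x.1.1.1) (j := x.1.1.2) x.2 (n := -(x.1.2 : ℤ) - 1)
      (by omega)) hg
    simpa [coeffQuot_monVec, hx] using this
  · rintro q -
    obtain ⟨m, rfl⟩ := Submodule.mkQ_surjective _ q
    have hm : m ∈ Submodule.span ℂ {m : M3 μ | ∃ n p, m = M3.mk μ n p} := by
      rw [M3.span_mk]; trivial
    induction hm using Submodule.span_induction with
    | mem x hx =>
      obtain ⟨n, p, rfl⟩ := hx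
      exact mk_mem_span μ n p
    | zero => rw [map_zero]; exact zero_mem _
    | add x y _ _ hx hy => rw [map_add]; exact add_mem hx hy
    | smul c x _ hx => exact Submodule.smul_mem _ c hx

theorem monBasis_apply (x : MonIndex μ) : monBasis μ x = monVec μ x := by
  simp [monBasis]

theorem actQuot_monBasis (t : Torus) (x : MonIndex μ) :
    actQuot μ t (monBasis μ x) = (∏ i, ((t i : ℂˣ) : ℂ) ^ x.weight i) • monBasis μ x := by
  rw [monBasis_apply, monVec, actQuot_mon, Fin.prod_univ_three]
  rfl

theorem repr_actQuot (t : Torus) (q : M3 μ ⧸ unitSubmodule μ) (x : MonIndex μ) :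
    (monBasis μ).repr (actQuot μ t q) x =
      (∏ i, ((t i : ℂˣ) : ℂ) ^ x.weight i) * (monBasis μ).repr q x := by
  let φ : (M3 μ ⧸ unitSubmodule μ) →ₗ[ℂ] (M3 μ ⧸ unitSubmodule μ) :=
    { toFun := actQuot μ t
      map_add' := map_add _
      map_smul' := actQuot_smul μ t }
  have : ((monBasis μ).coord x).comp φ =
      (∏ i, ((t i : ℂˣ) : ℂ) ^ x.weight i) • (monBasis μ).coord x := by
    refine (monBasis μ).ext fun y => ?_
    have h1 : φ (monBasis μ y) = _ := actQuot_monBasis μ t y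
    rw [LinearMap.comp_apply, h1, map_smul, LinearMap.smul_apply, Module.Basis.coord_apply,
      Module.Basis.repr_self]
    by_cases h : y = x
    · rw [h]
    · simp [h]
  exact congrArg (fun ψ => ψ q) this

end MonomialBasis

/-! ### Fixed loci in terms of heights -/

section Heights

/-- The boxes of a partition. -/
abbrev Box (μ : YoungDiagram) : Type := {b : ℕ × ℕ // b ∈ μ}

instance (μ : YoungDiagram) : Fintype (Box μ) := Fintype.subtype μ.cells fun _ => μ.mem_cells _

/-- The index of `x₁^i x₂^j x₃^(-k-1)`. -/
def boxIndex {μ : YoungDiagram} (b : Box μ) (k : ℕ) : MonIndex μ := ⟨(b.1, k), b.2⟩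

namespace FixedLocus

variable {μ : YoungDiagram} (L : FixedLocus μ)

theorem monVec_mem_of_repr_ne_zero {q : M3 μ ⧸ unitSubmodule μ} (hq : q ∈ L.Q) {x : MonIndex μ}
    (hx : (monBasis μ).repr q x ≠ 0) : monVec μ x ∈ L.Q := by
  obtain ⟨N, hN⟩ : ∃ N, ((monBasis μ).repr q).support.card = N := ⟨_, rfl⟩
  induction N using Nat.strong_induction_on generalizing q with
  | _ N ih =>
    by_cases h : ∃ y, y ≠ x ∧ (monBasis μ).repr q y ≠ 0
    · -- a combination of `q` with a translate of `q` under the torus loses the monomial `y`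
      obtain ⟨y, hyx, hy⟩ := h
      obtain ⟨i, hi⟩ : ∃ i, y.weight i ≠ x.weight i := by
        by_contra! h
        exact hyx (MonIndex.weight_injective μ (funext h))
      set t : Torus := Function.update 1 i (Units.mk0 2 two_ne_zero) with ht
      have hprod : ∀ w : Fin 3 → ℤ, ∏ j, ((t j : ℂˣ) : ℂ) ^ w j = 2 ^ w i := by
        intro w
        rw [Finset.prod_eq_single i]
        · simp [ht]
        · intro j _ hj
          simp [ht, hj]
        · simp
      let q' := actQuot μ t q - (2 : ℂ) ^ y.weight i • q
      have hq' : q' ∈ L.Q := by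
        refine sub_mem (L.invariant t q hq) ?_
        rw [← algebraMap_smul R3]
        exact Submodule.smul_mem _ _ hq
      have hrep : ∀ z, (monBasis μ).repr q' z =
          ((2 : ℂ) ^ z.weight i - 2 ^ y.weight i) * (monBasis μ).repr q z := by
        intro z
        simp only [q', map_sub, map_smul, Finsupp.sub_apply, Finsupp.smul_apply, smul_eq_mul]
        rw [repr_actQuot, hprod]
        ring
      refine ih _ ?_ hq' ?_ rfl
      · rw [← hN]
        refine Finset.card_lt_card ((Finset.ssubset_iff_of_subset ?_).2 ⟨y, ?_, ?_⟩)
        · intro z hz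
          rw [Finsupp.mem_support_iff, hrep] at hz
          exact Finsupp.mem_support_iff.2 (right_ne_zero_of_mul hz)
        · exact Finsupp.mem_support_iff.2 hy
        · rw [Finsupp.mem_support_iff, hrep, sub_self, zero_mul]
          exact fun h => h rfl
      · rw [hrep]
        refine mul_ne_zero (sub_ne_zero.2 fun h => hi ?_) hx
        have : (((2 : ℝ) ^ x.weight i : ℝ) : ℂ) = ((2 : ℝ) ^ y.weight i : ℝ) := by
          push_cast; exact h
        have h2 : ((2 : ℝ) ^ x.weight i : ℝ) = 2 ^ y.weight i := by exact_mod_cast this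
        exact (zpow_right_injective₀ (by norm_num) (by norm_num) h2).symm
    · push Not at h
      have hq1 : q = (monBasis μ).repr q x • monVec μ x := by
        refine (monBasis μ).repr.injective (Finsupp.ext fun y => ?_)
        rw [map_smul, ← monBasis_apply, Module.Basis.repr_self, Finsupp.smul_apply, smul_eq_mul]
        rcases eq_or_ne y x with rfl | hyx
        · simp
        · rw [h y hyx, Finsupp.single_eq_of_ne hyx, mul_zero]
      have hq2 : monVec μ x = algebraMap ℂ R3 ((monBasis μ).repr q x)⁻¹ • q := by
        rw [algebraMap_smul]
        conv_rhs => rw [hq1]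
        rw [map_smul, Finsupp.smul_apply, smul_smul, ← monBasis_apply, Module.Basis.repr_self]
        simp [hx]
      rw [hq2]
      exact Submodule.smul_mem _ _ hq

theorem mem_iff (q : M3 μ ⧸ unitSubmodule μ) :
    q ∈ L.Q ↔ ∀ x, (monBasis μ).repr q x ≠ 0 → monVec μ x ∈ L.Q := by
  refine ⟨fun hq x hx => L.monVec_mem_of_repr_ne_zero hq hx, fun h => ?_⟩
  rw [← (monBasis μ).linearCombination_repr q, Finsupp.linearCombination_apply]
  refine sum_mem fun x hx => ?_
  simp only [monBasis_apply]
  rw [← algebraMap_smul R3]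
  exact Submodule.smul_mem _ _ (h x (Finsupp.mem_support_iff.1 hx))

theorem monVec_mem_weightPart {x : MonIndex μ} (h : monVec μ x ∈ L.Q) :
    monVec μ x ∈ L.weightPart x.weight := by
  refine ⟨h, fun t => ?_⟩
  rw [← monBasis_apply]
  exact actQuot_monBasis μ t x

theorem repr_eq_zero_of_mem_weightSpace {q : M3 μ ⧸ unitSubmodule μ} {w : Fin 3 → ℤ}
    (hq : q ∈ weightSpace μ w) {x : MonIndex μ} (hx : x.weight ≠ w) :
    (monBasis μ).repr q x = 0 := by
  obtain ⟨i, hi⟩ := Function.ne_iff.1 hx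
  set t : Torus := Function.update 1 i (Units.mk0 2 two_ne_zero) with ht
  have hprod : ∀ w : Fin 3 → ℤ, ∏ j, ((t j : ℂˣ) : ℂ) ^ w j = 2 ^ w i := by
    intro w
    rw [Finset.prod_eq_single i]
    · simp [ht]
    · intro j _ hj
      simp [ht, hj]
    · simp
  have h1 := repr_actQuot μ t q x
  rw [hq t, map_smul, Finsupp.smul_apply, smul_eq_mul, hprod, hprod] at h1
  by_contra hne
  have h2 := mul_right_cancel₀ hne h1
  have : (((2 : ℝ) ^ w i : ℝ) : ℂ) = ((2 : ℝ) ^ x.weight i : ℝ) := by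
    push_cast; exact h2
  have h3 : ((2 : ℝ) ^ w i : ℝ) = 2 ^ x.weight i := by exact_mod_cast this
  exact hi (zpow_right_injective₀ (by norm_num) (by norm_num) h3).symm

theorem finrank_weightPart_of_mem {x : MonIndex μ} (h : monVec μ x ∈ L.Q) :
    Module.finrank ℂ (L.weightPart x.weight) = 1 := by
  have : L.weightPart x.weight = ℂ ∙ monVec μ x := by
    refine le_antisymm (fun q hq => ?_) ?_
    · refine Submodule.mem_span_singleton.2 ⟨(monBasis μ).repr q x, ?_⟩
      refine (monBasis μ).repr.injective (Finsupp.ext fun y => ?_)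
      rw [map_smul, ← monBasis_apply, Module.Basis.repr_self, Finsupp.smul_apply, smul_eq_mul]
      rcases eq_or_ne y x with rfl | hyx
      · simp
      · rw [Finsupp.single_eq_of_ne hyx, mul_zero, repr_eq_zero_of_mem_weightSpace hq.2
          fun h => hyx (MonIndex.weight_injective μ h)]
    · rw [Submodule.span_singleton_le_iff_mem]
      exact L.monVec_mem_weightPart h
  rw [this, finrank_span_singleton]
  rw [← monBasis_apply]
  exact (monBasis μ).ne_zero x

theorem finrank_weightPart_eq_zero {w : Fin 3 → ℤ}
    (h : ∀ x : MonIndex μ, x.weight = w → monVec μ x ∉ L.Q) :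
    Module.finrank ℂ (L.weightPart w) = 0 := by
  have : L.weightPart w = ⊥ := by
    refine eq_bot_iff.2 fun q hq => (Submodule.mem_bot ℂ).2 ?_
    refine (monBasis μ).repr.injective (Finsupp.ext fun y => ?_)
    rw [map_zero, Finsupp.zero_apply]
    by_cases hy : y.weight = w
    · by_contra hne
      exact h y hy (L.monVec_mem_of_repr_ne_zero hq.1 hne)
    · exact repr_eq_zero_of_mem_weightSpace hq.2 hy
  rw [this, finrank_bot]

theorem exists_monVec_notMem (b : Box μ) : ∃ k, monVec μ (boxIndex b k) ∉ L.Q := by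
  by_contra! h
  refine Set.infinite_of_injective_forall_mem (f := fun k : ℕ => (boxIndex b k).weight) ?_ ?_
    L.finite_weights
  · intro k k' hk
    have := congrArg (fun x : MonIndex μ => x.1.2) (MonIndex.weight_injective μ hk)
    exact this
  · intro k
    rw [Set.mem_ofPred_eq, L.finrank_weightPart_of_mem (h k)]
    exact one_ne_zero

open Classical in
/-- The number of monomials `x₁^i x₂^j x₃^n`, for a given box `(i,j)`, that are contained in a
fixed locus. -/
def height (b : Box μ) : ℕ := Nat.find (L.exists_monVec_notMem b)

theorem X_two_smul_monVec (b : Box μ) (k : ℕ) :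
    (MvPolynomial.X 2 : R3) • monVec μ (boxIndex b (k + 1)) = monVec μ (boxIndex b k) := by
  simp only [monVec, boxIndex]
  rw [X_two_smul_mon]
  congr 1
  push_cast
  ring

theorem monVec_mem_iff (b : Box μ) (k : ℕ) : monVec μ (boxIndex b k) ∈ L.Q ↔ k < L.height b := by
  classical
  constructor
  · intro h
    by_contra! hle
    have hdown : ∀ m, ∀ k, monVec μ (boxIndex b (k + m)) ∈ L.Q → monVec μ (boxIndex b k) ∈ L.Q := by
      intro m
      induction m with
      | zero => exact fun k hk => hk
      | succ m ih =>
        intro k hk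
        refine ih k ?_
        rw [← X_two_smul_monVec]
        exact Submodule.smul_mem _ _ hk
    obtain ⟨m, rfl⟩ := Nat.exists_eq_add_of_le hle
    exact Nat.find_spec (L.exists_monVec_notMem b) (hdown m _ h)
  · intro h
    exact not_not.1 (Nat.find_min (L.exists_monVec_notMem b) h)

theorem height_mono : Monotone L.height := by
  have h0 : ∀ (i j : ℕ) (n : ℤ), mon μ i j n ∈ L.Q → mon μ (i + 1) j n ∈ L.Q := by
    intro i j n h
    rw [← X_zero_smul_mon]
    exact Submodule.smul_mem _ _ h
  have h1 : ∀ (i j : ℕ) (n : ℤ), mon μ i j n ∈ L.Q → mon μ i (j + 1) n ∈ L.Q := by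
    intro i j n h
    rw [← X_one_smul_mon]
    exact Submodule.smul_mem _ _ h
  have h2 : ∀ (k l i j : ℕ) (n : ℤ), mon μ i j n ∈ L.Q → mon μ (i + k) (j + l) n ∈ L.Q := by
    intro k l i j n h
    induction k with
    | zero =>
      induction l with
      | zero => exact h
      | succ l ih => exact h1 _ _ n ih
    | succ k ih => exact h0 _ _ n ih
  rintro ⟨⟨i, j⟩, hb⟩ ⟨⟨i', j'⟩, hb'⟩ ⟨hi, hj⟩
  obtain ⟨k, rfl⟩ := Nat.exists_eq_add_of_le (show i ≤ i' from hi)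
  obtain ⟨l, rfl⟩ := Nat.exists_eq_add_of_le (show j ≤ j' from hj)
  by_contra! hlt
  have := (L.monVec_mem_iff ⟨(i, j), hb⟩ _).2 hlt
  exact lt_irrefl _ ((L.monVec_mem_iff ⟨(i + k, j + l), hb'⟩ _).1 (h2 k l i j _ this))

theorem height_injective : Function.Injective (height (μ := μ)) := by
  intro L L' h
  have hmem : ∀ x : MonIndex μ, monVec μ x ∈ L.Q ↔ monVec μ x ∈ L'.Q := by
    intro x
    have h1 := L.monVec_mem_iff ⟨x.1.1, x.2⟩ x.1.2
    have h2 := L'.monVec_mem_iff ⟨x.1.1, x.2⟩ x.1.2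
    rw [h] at h1
    exact h1.trans h2.symm
  have hQ : L.Q = L'.Q := by
    ext q
    rw [L.mem_iff, L'.mem_iff]
    exact forall_congr' fun x => imp_congr_right fun _ => hmem x
  cases L
  cases L'
  simpa using hQ

theorem exists_height_eq (h : Box μ → ℕ) (hh : Monotone h) : ∃ L : FixedLocus μ, L.height = h := by
  classical
  let G : Finset (M3 μ ⧸ unitSubmodule μ) :=
    (Finset.univ : Finset (Box μ)).biUnion fun b =>
      (Finset.range (h b)).image fun k => monVec μ (boxIndex b k)
  have hG : ∀ (b : Box μ) (k : ℕ), k < h b → monVec μ (boxIndex b k) ∈ G := by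
    intro b k hk
    exact Finset.mem_biUnion.2 ⟨b, Finset.mem_univ _, Finset.mem_image_of_mem _ (Finset.mem_range.2 hk)⟩
  have hG' : ∀ q ∈ G, ∃ (b : Box μ) (k : ℕ), k < h b ∧ q = monVec μ (boxIndex b k) := by
    intro q hq
    obtain ⟨b, _, hb⟩ := Finset.mem_biUnion.1 hq
    obtain ⟨k, hk, rfl⟩ := Finset.mem_image.1 hb
    exact ⟨b, k, Finset.mem_range.1 hk, rfl⟩
  -- the complex span is closed under multiplication by the variables
  have hX : ∀ i : Fin 3, ∀ q ∈ Submodule.span ℂ (G : Set (M3 μ ⧸ unitSubmodule μ)),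
      (MvPolynomial.X i : R3) • q ∈ Submodule.span ℂ (G : Set (M3 μ ⧸ unitSubmodule μ)) := by
    intro i q hq
    induction hq using Submodule.span_induction with
    | mem q hq =>
      obtain ⟨⟨⟨i', j'⟩, hb⟩, k, hk, rfl⟩ := hG' q hq
      simp only [monVec, boxIndex]
      fin_cases i
      · simp only [Fin.zero_eta, X_zero_smul_mon]
        by_cases hb' : (i' + 1, j') ∈ μ
        · exact Submodule.subset_span (hG ⟨_, hb'⟩ k
            (hk.trans_le (hh (a := ⟨_, hb⟩) (b := ⟨_, hb'⟩) ⟨Nat.le_succ i', le_rfl⟩)))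
        · rw [mon_eq_zero_of_notMem μ hb']; exact zero_mem _
      · simp only [Fin.mk_one, X_one_smul_mon]
        by_cases hb' : (i', j' + 1) ∈ μ
        · exact Submodule.subset_span (hG ⟨_, hb'⟩ k
            (hk.trans_le (hh (a := ⟨_, hb⟩) (b := ⟨_, hb'⟩) ⟨le_rfl, Nat.le_succ j'⟩)))
        · rw [mon_eq_zero_of_notMem μ hb']; exact zero_mem _
      · simp only [Fin.reduceFinMk, X_two_smul_mon]
        cases k with
        | zero => rw [mon_eq_zero_of_nonneg μ (by simp)]; exact zero_mem _
        | succ k =>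
          have := X_two_smul_monVec ⟨(i', j'), hb⟩ k
          simp only [monVec, boxIndex, X_two_smul_mon] at this
          rw [this]
          exact Submodule.subset_span (hG ⟨_, hb⟩ k (by omega))
    | zero => rw [smul_zero]; exact zero_mem _
    | add p q _ _ hp hq => rw [smul_add]; exact add_mem hp hq
    | smul z q _ hq => rw [smul_comm]; exact Submodule.smul_mem _ z hq
  have hspan : ∀ q ∈ Submodule.span R3 (G : Set (M3 μ ⧸ unitSubmodule μ)),
      q ∈ Submodule.span ℂ (G : Set (M3 μ ⧸ unitSubmodule μ)) := by
    intro q hq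
    induction hq using Submodule.span_induction with
    | mem q hq => exact Submodule.subset_span hq
    | zero => exact zero_mem _
    | add p q _ _ hp hq => exact add_mem hp hq
    | smul r q _ hq =>
      induction r using MvPolynomial.induction_on with
      | C z =>
        rw [← MvPolynomial.algebraMap_eq, algebraMap_smul]
        exact Submodule.smul_mem _ z hq
      | add r r' hr hr' => rw [add_smul]; exact add_mem hr hr'
      | mul_X r i hr => rw [mul_comm, mul_smul]; exact hX i _ hr
  let L : FixedLocus μ :=
    { Q := Submodule.span R3 (G : Set (M3 μ ⧸ unitSubmodule μ))
      fg := ⟨G, rfl⟩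
      invariant := by
        intro t q hq
        induction hq using Submodule.span_induction with
        | mem q hq =>
          obtain ⟨b, k, hk, rfl⟩ := hG' q hq
          rw [← monBasis_apply, actQuot_monBasis, monBasis_apply, ← algebraMap_smul R3]
          exact Submodule.smul_mem _ _ (Submodule.subset_span hq)
        | zero => rw [map_zero]; exact zero_mem _
        | add p q _ _ hp hq => rw [map_add]; exact add_mem hp hq
        | smul r q _ hq => rw [map_smulₛₗ]; exact Submodule.smul_mem _ _ hq }
  have hL : ∀ (b : Box μ) (k : ℕ), monVec μ (boxIndex b k) ∈ L.Q ↔ k < h b := by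
    intro b k
    refine ⟨fun hk => ?_, fun hk => Submodule.subset_span (hG b k hk)⟩
    by_contra! hle
    have hz : ∀ q ∈ Submodule.span ℂ (G : Set (M3 μ ⧸ unitSubmodule μ)),
        (monBasis μ).repr q (boxIndex b k) = 0 := by
      intro q hq
      induction hq using Submodule.span_induction with
      | mem q hq =>
        obtain ⟨b', k', hk', rfl⟩ := hG' q hq
        rw [← monBasis_apply, Module.Basis.repr_self, Finsupp.single_eq_of_ne]
        intro he
        have h1 : b = b' := Subtype.ext (congrArg (fun x : MonIndex μ => x.1.1) he)
        have h2 : k = k' := congrArg (fun x : MonIndex μ => x.1.2) he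
        rw [h1, h2] at hle
        omega
      | zero => simp
      | add p q _ _ hp hq => rw [map_add, Finsupp.add_apply, hp, hq, add_zero]
      | smul z q _ hq => rw [map_smul, Finsupp.smul_apply, hq, smul_zero]
    have := hz _ (hspan _ hk)
    rw [← monBasis_apply, Module.Basis.repr_self, Finsupp.single_eq_same] at this
    exact one_ne_zero this
  refine ⟨L, funext fun b => ?_⟩
  refine le_antisymm ?_ ?_
  · by_contra! hlt
    exact lt_irrefl _ ((hL b _).1 ((L.monVec_mem_iff b _).2 hlt))
  · by_contra! hlt
    exact lt_irrefl _ ((L.monVec_mem_iff b _).1 ((hL b _).2 hlt))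

/-- The character of `Q_U` in terms of its heights. -/
theorem charQ_eq : L.charQ = ∑ b : Box μ, ∑ k ∈ Finset.range (L.height b),
    AddMonoidAlgebra.single (boxIndex b k).weight 1 := by
  classical
  ext w
  rw [AddMonoidAlgebra.coeff_sum, Finsupp.finsetSum_apply]
  simp_rw [AddMonoidAlgebra.coeff_sum, Finsupp.finsetSum_apply, AddMonoidAlgebra.coeff_single,
    Finsupp.single_apply]
  have hL : L.charQ.coeff w = (Module.finrank ℂ (L.weightPart w) : ℤ) := rfl
  rw [hL]
  by_cases h : ∃ x : MonIndex μ, x.weight = w ∧ monVec μ x ∈ L.Q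
  · obtain ⟨x, rfl, hx⟩ := h
    rw [L.finrank_weightPart_of_mem hx]
    have hx' := (L.monVec_mem_iff ⟨x.1.1, x.2⟩ x.1.2).1 hx
    rw [Finset.sum_eq_single ⟨x.1.1, x.2⟩, Finset.sum_eq_single x.1.2]
    · rw [if_pos (by rfl)]; rfl
    · intro k _ hk
      rw [if_neg fun he => hk (congrArg (fun x : MonIndex μ => x.1.2)
        (MonIndex.weight_injective μ he))]
    · intro hk
      exact absurd (Finset.mem_range.2 hx') hk
    · intro b _ hb
      refine Finset.sum_eq_zero fun k _ => if_neg fun he => hb ?_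
      exact Subtype.ext (congrArg (fun x : MonIndex μ => x.1.1) (MonIndex.weight_injective μ he))
    · simp
  · push Not at h
    rw [L.finrank_weightPart_eq_zero h]
    symm
    refine Finset.sum_eq_zero fun b _ => Finset.sum_eq_zero fun k hk => if_neg fun he => ?_
    exact h _ he ((L.monVec_mem_iff b k).2 (Finset.mem_range.1 hk))

end FixedLocus

end Heights

/-! ### Lines of weights in the characters -/

section Characters

/-- The Laurent monomial `t^w`. -/
def tmon (w : Fin 3 → ℤ) : Laurent := AddMonoidAlgebra.single w 1

theorem tmon_mul (v w : Fin 3 → ℤ) : tmon v * tmon w = tmon (v + w) := by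
  simp [tmon, AddMonoidAlgebra.single_mul_single]

theorem bar_tmon (w : Fin 3 → ℤ) : barLaurent (tmon w) = tmon (-w) :=
  AddMonoidAlgebra.domCongr_single (R := ℤ) (A := ℤ) ..

theorem algebraMap_laurent_injective : Function.Injective (algebraMap Laurent CharField) :=
  IsFractionRing.injective Laurent CharField

/-- The vector `(0,0,l)`. -/
def e3 (l : ℤ) : Fin 3 → ℤ := ![0, 0, l]

theorem e3_add (k l : ℤ) : e3 (k + l) = e3 k + e3 l := by
  funext i; fin_cases i <;> simp [e3]

theorem e3_zero : e3 0 = 0 := by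
  funext i; fin_cases i <;> simp [e3]

theorem tvar_two : tvar 2 = tmon (e3 1) := by
  have : (Pi.single 2 1 : Fin 3 → ℤ) = e3 1 := by funext i; fin_cases i <;> simp [e3]
  rw [tvar, tmon, this]

theorem one_sub_tmon_ne_zero : (1 : Laurent) - tmon (e3 1) ≠ 0 := by
  intro h
  apply one_sub_tK_ne_zero 2
  rw [tK, ← map_one (algebraMap Laurent CharField), ← map_sub, tvar_two, h, map_zero]

/-- The expansion of `(t^(w + p e₃) - t^(w + q e₃)) / (1 - t₃)`. -/
def ray (w : Fin 3 → ℤ) (p q : ℤ) : Laurent :=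
  ∑ l ∈ Finset.Ico p q, tmon (w + e3 l) - ∑ l ∈ Finset.Ico q p, tmon (w + e3 l)

theorem ray_mul (w : Fin 3 → ℤ) (p q : ℤ) :
    ray w p q * (1 - tmon (e3 1)) = tmon (w + e3 p) - tmon (w + e3 q) := by
  have key : ∀ (p : ℤ) (k : ℕ), (∑ l ∈ Finset.Ico p (p + k), tmon (w + e3 l)) * (1 - tmon (e3 1)) =
      tmon (w + e3 p) - tmon (w + e3 (p + k)) := by
    intro p k
    induction k with
    | zero => simp
    | succ k ih =>
      have : Finset.Ico p (p + (k + 1 : ℕ)) = insert (p + (k : ℤ)) (Finset.Ico p (p + k)) := by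
        ext x; simp; omega
      rw [this, Finset.sum_insert (by simp), add_mul, ih, mul_sub, mul_one, tmon_mul, add_assoc w,
        ← e3_add]
      push_cast
      rw [add_assoc p]
      ring
  rcases le_total p q with h | h
  · obtain ⟨k, rfl⟩ : ∃ k : ℕ, q = p + k := ⟨(q - p).toNat, by omega⟩
    rw [ray, Finset.Ico_eq_empty (a := p + (k : ℤ)) (b := p) (by omega), Finset.sum_empty, sub_zero,
      key]
  · obtain ⟨k, rfl⟩ : ∃ k : ℕ, p = q + k := ⟨(p - q).toNat, by omega⟩
    rw [ray, Finset.Ico_eq_empty (a := q + (k : ℤ)) (b := q) (by omega), Finset.sum_empty, zero_sub,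
      neg_mul, key, neg_sub]

theorem ray_add (w : Fin 3 → ℤ) (p q r : ℤ) : ray w p q + ray w q r = ray w p r := by
  refine mul_right_cancel₀ one_sub_tmon_ne_zero ?_
  rw [add_mul, ray_mul, ray_mul, ray_mul]
  ring

/-- The vector `(m, m - D, -a m)`, of weight `m ε - D s₂` with `ε = s₁ + s₂ - a s₃`. -/
def lineVec (a m D : ℤ) : Fin 3 → ℤ := ![m, m - D, -(a * m)]

/-- The operation `P ↦ -P - \bar P / (t₁t₂) + P \bar P (1-t₁)(1-t₂) / (t₁t₂)`. -/
def edgeOp (P : Laurent) : Laurent :=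
  -P - barLaurent P * tmon ![-1, -1, 0] +
    P * barLaurent P * (1 + tmon ![-1, -1, 0] - tmon ![-1, 0, 0] - tmon ![0, -1, 0])

theorem edgeOp_sum {ι : Type*} [Fintype ι] (w : ι → Fin 3 → ℤ) :
    edgeOp (∑ s, tmon (w s)) =
      ∑ q : ι × ι, (tmon (w q.2 - w q.1) + tmon (w q.2 - w q.1 - ![1, 1, 0]) -
        tmon (w q.2 - w q.1 - ![1, 0, 0]) - tmon (w q.2 - w q.1 - ![0, 1, 0])) -
      ∑ s, (tmon (w s) + tmon (-w s - ![1, 1, 0])) := by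
  have hneg : (![-1, -1, 0] : Fin 3 → ℤ) = -![1, 1, 0] ∧ (![-1, 0, 0] : Fin 3 → ℤ) = -![1, 0, 0] ∧
      (![0, -1, 0] : Fin 3 → ℤ) = -![0, 1, 0] := by simp
  rw [edgeOp, hneg.1, hneg.2.1, hneg.2.2, Fintype.sum_prod_type_right, map_sum]
  simp_rw [bar_tmon]
  rw [Finset.sum_mul_sum, Finset.sum_mul, Finset.sum_mul, Finset.sum_add_distrib]
  simp_rw [Finset.sum_mul, tmon_mul, mul_sub, mul_add, mul_one, tmon_mul, ← sub_eq_add_neg]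
  ring

variable {μ : YoungDiagram}

theorem algebraMap_edgeOp (P : Laurent) :
    algebraMap Laurent CharField (edgeOp P) =
      -algebraMap Laurent CharField P - bar (algebraMap Laurent CharField P) / (tK 0 * tK 1) +
      algebraMap Laurent CharField P * bar (algebraMap Laurent CharField P) *
        ((1 - tK 0) * (1 - tK 1) / (tK 0 * tK 1)) := by
  have h0 : algebraMap Laurent CharField (tmon ![-1, 0, 0]) = (tK 0)⁻¹ := by
    rw [← algebraMap_barLaurent_tvar]
    congr 1
    have : tvar 0 = tmon (Pi.single 0 1) := rfl
    rw [this, bar_tmon]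
    congr 1
    funext i; fin_cases i <;> simp
  have h1 : algebraMap Laurent CharField (tmon ![0, -1, 0]) = (tK 1)⁻¹ := by
    rw [← algebraMap_barLaurent_tvar]
    congr 1
    have : tvar 1 = tmon (Pi.single 1 1) := rfl
    rw [this, bar_tmon]
    congr 1
    funext i; fin_cases i <;> simp
  have h2 : algebraMap Laurent CharField (tmon ![-1, -1, 0]) = (tK 0)⁻¹ * (tK 1)⁻¹ := by
    rw [← h0, ← h1, ← map_mul, tmon_mul]
    congr 2
    simp
  have n0 := tK_ne_zero 0
  have n1 := tK_ne_zero 1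
  simp only [edgeOp, map_add, map_sub, map_neg, map_mul, map_one, h0, h1, h2, bar_algebraMap]
  field_simp
  ring

namespace FixedLocus

variable (L : FixedLocus μ)

/-- The vertex is determined by `(1 - t₃) 𝖥_U` through the same operation that gives the edge
character of `μ`. -/
theorem vertex_mul : -L.vertex * (1 - tmon (e3 1)) =
    edgeOp L.slice - edgeOp (charPartition μ) := by
  apply algebraMap_laurent_injective
  have hV : algebraMap Laurent CharField L.vertex = L.vertexRational := L.exists_vertex.choose_spec
  have hS : algebraMap Laurent CharField L.slice = (1 - tK 2) * L.charF :=
    L.exists_slice.choose_spec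
  have h3 := one_sub_tK_ne_zero 2
  have n0 := tK_ne_zero 0
  have n1 := tK_ne_zero 1
  have n2 := tK_ne_zero 2
  have hF : L.charF = algebraMap Laurent CharField L.slice / (1 - tK 2) := by
    rw [hS]; field_simp
  have hbar : bar L.charF = -(bar (algebraMap Laurent CharField L.slice) * tK 2 / (1 - tK 2)) := by
    have h4 : (1 : CharField) - (tK 2)⁻¹ = -(1 - tK 2) / tK 2 := by field_simp; ring
    rw [hF, map_div₀, map_sub, map_one, bar_tK, h4]
    field_simp
  rw [← tvar_two]
  simp only [map_mul, map_neg, map_sub, map_one, algebraMap_edgeOp, hV]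
  change -L.vertexRational * (1 - tK 2) = _
  rw [vertexRational, tangentCharacter, edgeCharacter, hbar, hF]
  generalize bar (algebraMap Laurent CharField L.slice) = G'
  generalize algebraMap Laurent CharField L.slice = G
  generalize bar (algebraMap Laurent CharField (charPartition μ)) = F'
  generalize algebraMap Laurent CharField (charPartition μ) = F
  generalize tK 0 = x at *
  generalize tK 1 = y at *
  generalize tK 2 = z at *
  field_simp
  ring

theorem charPartition_eq : charPartition μ = ∑ b : Box μ, tmon ![(b.1.1 : ℤ), (b.1.2 : ℤ), 0] := by
  rw [charPartition]
  exact Finset.sum_subtype μ.cells (fun _ => μ.mem_cells _)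
    (fun c : ℕ × ℕ => tmon ![(c.1 : ℤ), (c.2 : ℤ), 0])

/-- The Laurent polynomial `(1 - t₃) 𝖥_U` in terms of the heights. -/
theorem slice_eq : L.slice = ∑ b : Box μ, tmon ![(b.1.1 : ℤ), (b.1.2 : ℤ), -(L.height b : ℤ)] := by
  have h1 : L.slice = charPartition μ + (1 - tmon (e3 1)) * L.charQ := by
    apply algebraMap_laurent_injective
    have hS : algebraMap Laurent CharField L.slice = (1 - tK 2) * L.charF :=
      L.exists_slice.choose_spec
    have h := one_sub_tK_ne_zero 2
    rw [hS, charF, mul_add, mul_div_cancel₀ _ h, ← tvar_two]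
    simp [tK]
  have h2 : L.charQ = ∑ b : Box μ, ray ![(b.1.1 : ℤ), (b.1.2 : ℤ), 0] (-(L.height b : ℤ)) 0 := by
    rw [charQ_eq]
    refine Finset.sum_congr rfl fun b _ => ?_
    rw [ray, Finset.Ico_eq_empty (a := (0 : ℤ)) (by omega), Finset.sum_empty, sub_zero]
    refine Finset.sum_nbij' (fun k : ℕ => -(k : ℤ) - 1) (fun l => (-l - 1).toNat) ?_ ?_ ?_ ?_ ?_
    · intro k hk
      simp only [Finset.mem_range, Finset.mem_Ico] at hk ⊢
      omega
    · intro l hl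
      simp only [Finset.mem_range, Finset.mem_Ico] at hl ⊢
      omega
    · intro k _
      omega
    · intro l hl
      simp only [Finset.mem_Ico] at hl
      omega
    · intro k _
      rw [tmon]
      congr 1
      funext i
      fin_cases i <;> simp [MonIndex.weight, boxIndex, e3]
  rw [h1, h2, charPartition_eq, mul_comm, Finset.sum_mul]
  simp_rw [ray_mul]
  rw [← Finset.sum_add_distrib]
  refine Finset.sum_congr rfl fun b _ => ?_
  rw [e3_zero, add_zero, add_sub_cancel]
  congr 1
  funext i
  fin_cases i <;> simp [e3]

/-- The vertex character as a sum over pairs of boxes, and over single boxes. The boxes are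
labelled by slots `s`, and `y = a I - h` is the invariant of a box that is determined, together with
its content `c`, by the restriction of the character to `t₃ = (t₁t₂)^(1/a)`. -/
theorem neg_vertex_eq {ι : Type*} [Fintype ι] (B : ι ≃ Box μ) {I c y : ι → ℤ} {a : ℤ}
    (hI : ∀ s, I s = (B s).1.1) (hc : ∀ s, I s - c s = (B s).1.2)
    (hy : ∀ s, y s = a * I s - L.height (B s)) :
    -L.vertex =
      ∑ q : ι × ι, (ray (lineVec a (I q.2 - I q.1) (c q.2 - c q.1)) (y q.2 - y q.1)
          (a * (I q.2 - I q.1)) +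
        ray (lineVec a (I q.2 - I q.1 - 1) (c q.2 - c q.1)) (y q.2 - y q.1 - a)
          (a * (I q.2 - I q.1 - 1)) -
        ray (lineVec a (I q.2 - I q.1 - 1) (c q.2 - c q.1 - 1)) (y q.2 - y q.1 - a)
          (a * (I q.2 - I q.1 - 1)) -
        ray (lineVec a (I q.2 - I q.1) (c q.2 - c q.1 + 1)) (y q.2 - y q.1)
          (a * (I q.2 - I q.1))) -
      ∑ s, (ray (lineVec a (I s) (c s)) (y s) (a * I s) +
        ray (lineVec a (-I s - 1) (-c s)) (-y s - a) (a * (-I s - 1))) := by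
  refine mul_right_cancel₀ one_sub_tmon_ne_zero ?_
  have hS : L.slice = ∑ s, tmon ![I s, I s - c s, y s - a * I s] := by
    rw [slice_eq, ← B.sum_comp]
    refine Finset.sum_congr rfl fun s _ => ?_
    congr 1
    funext i
    fin_cases i
    · simp [hI]
    · simp [hc]
    · simp [hy]
  have hP : charPartition μ = ∑ s, tmon ![I s, I s - c s, 0] := by
    rw [charPartition_eq, ← B.sum_comp]
    refine Finset.sum_congr rfl fun s _ => ?_
    rw [hI, ← hc, hI]
  rw [vertex_mul, hS, hP, edgeOp_sum, edgeOp_sum, sub_mul, Finset.sum_mul, Finset.sum_mul]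
  simp_rw [sub_mul, add_mul, ray_mul]
  rw [sub_sub_sub_comm, ← Finset.sum_sub_distrib, ← Finset.sum_sub_distrib]
  congr 1
  · refine Finset.sum_congr rfl fun q _ => ?_
    have e : ∀ A B C D A' B' C' D' : Laurent, A + B - C - D - (A' + B' - C' - D') =
        (A - A') + (B - B') - (C - C') - (D - D') := fun _ _ _ _ _ _ _ _ => by ring
    rw [e]
    congr 1
    congr 1
    congr 1
    all_goals
      congr 2 <;>
      · funext i
        fin_cases i <;> simp [lineVec, e3] <;> ring
  · refine Finset.sum_congr rfl fun s _ => ?_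
    have e : ∀ A B A' B' : Laurent, A + B - (A' + B') = (A - A') + (B - B') :=
      fun _ _ _ _ => by ring
    rw [e]
    congr 1
    all_goals
      congr 2 <;>
      · funext i
        fin_cases i <;> simp [lineVec, e3] <;> ring

end FixedLocus

end Characters

/-! ### Rational functions that can be evaluated on the plane -/

section EvaluationRing

open MvPolynomial

/-- The linear form `ε = s₁ + s₂ - a s₃` that cuts out the plane `s₃ = (s₁+s₂)/a`. -/
def epsPoly (a : ℕ) : MvPolynomial (Fin 3) ℚ := X 0 + X 1 - C (a : ℚ) * X 2

/-- The linear form `m ε - D s₂ + l s₃`. -/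
def linPoly (a : ℕ) (m D l : ℤ) : MvPolynomial (Fin 3) ℚ :=
  C (m : ℚ) * epsPoly a - C (D : ℚ) * X 1 + C (l : ℚ) * X 2

/-- The linear form `ε` as an element of `ℚ(s₁,s₂,s₃)`. -/
def eps (a : ℕ) : SField := algebraMap _ SField (epsPoly a)

variable {a : ℕ}

theorem algebraMap_sfield_injective :
    Function.Injective (algebraMap (MvPolynomial (Fin 3) ℚ) SField) :=
  IsFractionRing.injective (MvPolynomial (Fin 3) ℚ) SField

theorem restrictPoly_epsPoly (ha : 0 < a) : restrictPoly a (epsPoly a) = 0 := by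
  have : (a : ℚ) ≠ 0 := by exact_mod_cast ha.ne'
  simp only [restrictPoly, epsPoly, map_sub, map_add, map_mul, aeval_X, Matrix.cons_val_zero,
    Matrix.cons_val_one, Matrix.cons_val_two, Matrix.tail_cons, Matrix.head_cons, aeval_C,
    algebraMap_eq, smul_eq_C_mul]
  rw [← mul_assoc, ← C_mul, mul_one_div_cancel this]
  simp

theorem epsPoly_ne_zero (a : ℕ) : epsPoly a ≠ 0 := by
  intro h
  have := congrArg (eval ![1, 0, 0]) h
  simp [epsPoly] at this

theorem eps_ne_zero (a : ℕ) : eps a ≠ 0 := by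
  rw [eps, Ne, map_eq_zero_iff _ algebraMap_sfield_injective]
  exact epsPoly_ne_zero a

theorem restrictPoly_linPoly_ne_zero (ha : 0 < a) (m : ℤ) {D l : ℤ} (h : ¬ (D = 0 ∧ l = 0)) :
    restrictPoly a (linPoly a m D l) ≠ 0 := by
  have ha' : (a : ℚ) ≠ 0 := by exact_mod_cast ha.ne'
  intro h0
  have h1 : restrictPoly a (linPoly a m D l) =
      -(C (D : ℚ) * X 1) + C (l : ℚ) * (C (1 / (a : ℚ)) * (X 0 + X 1)) := by
    rw [linPoly, map_add, map_sub, map_mul, restrictPoly_epsPoly ha]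
    simp [restrictPoly, smul_eq_C_mul]
    left
    ring
  rw [h1] at h0
  have e0 := congrArg (eval ![1, 0]) h0
  have e1 := congrArg (eval ![0, 1]) h0
  simp [ha'] at e0 e1
  rw [e0] at e1
  simp at e1
  exact h ⟨e1, e0⟩

theorem weight_eq (m D l : ℤ) :
    weight (lineVec a m D + e3 l) = algebraMap _ SField (linPoly a m D l) := by
  rw [weight]
  congr 1
  simp only [Fin.sum_univ_three, lineVec, e3, linPoly, epsPoly, smul_eq_C_mul, Pi.add_apply,
    Matrix.cons_val_zero, Matrix.cons_val_one, Matrix.cons_val]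
  push_cast
  simp only [C_add, C_sub, C_neg, C_mul, C_0]
  ring

theorem algebraMap_linPoly (m D l : ℤ) : algebraMap _ SField (linPoly a m D l) =
    eps a * m + algebraMap _ SField (linPoly a 0 D l) := by
  have : linPoly a m D l = C (m : ℚ) * epsPoly a + linPoly a 0 D l := by
    simp only [linPoly, Int.cast_zero, C_0]
    ring
  rw [this, map_add, map_mul, eps, mul_comm]
  congr 2
  rw [← map_intCast (algebraMap (MvPolynomial (Fin 3) ℚ) SField)]
  simp

variable (a) in
/-- The rational functions that can be evaluated on the plane `s₃ = (s₁+s₂)/a`. -/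
def evalRing : Subring SField where
  carrier := {x | ∃ p q : MvPolynomial (Fin 3) ℚ, restrictPoly a q ≠ 0 ∧
    x = algebraMap _ SField p / algebraMap _ SField q}
  one_mem' := ⟨1, 1, by simp, by simp⟩
  zero_mem' := ⟨0, 1, by simp, by simp⟩
  mul_mem' := by
    rintro _ _ ⟨p, q, hq, rfl⟩ ⟨p', q', hq', rfl⟩
    exact ⟨p * p', q * q', by rw [map_mul]; exact mul_ne_zero hq hq', by
      rw [map_mul, map_mul, div_mul_div_comm]⟩
  add_mem' := by
    rintro _ _ ⟨p, q, hq, rfl⟩ ⟨p', q', hq', rfl⟩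
    have h1 : algebraMap _ SField q ≠ 0 := by
      rw [Ne, map_eq_zero_iff _ algebraMap_sfield_injective]
      rintro rfl
      exact hq (map_zero _)
    have h2 : algebraMap _ SField q' ≠ 0 := by
      rw [Ne, map_eq_zero_iff _ algebraMap_sfield_injective]
      rintro rfl
      exact hq' (map_zero _)
    exact ⟨p * q' + q * p', q * q', by rw [map_mul]; exact mul_ne_zero hq hq', by
      rw [map_add, map_mul, map_mul, map_mul, div_add_div _ _ h1 h2]⟩
  neg_mem' := by
    rintro _ ⟨p, q, hq, rfl⟩
    exact ⟨-p, q, hq, by rw [map_neg, neg_div]⟩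

theorem poly_mem_evalRing (p : MvPolynomial (Fin 3) ℚ) : algebraMap _ SField p ∈ evalRing a :=
  ⟨p, 1, by simp, by simp⟩

variable (a) in
/-- The units of the ring of rational functions that can be evaluated. -/
def IsEvalUnit (x : SField) : Prop :=
  ∃ p q : MvPolynomial (Fin 3) ℚ, restrictPoly a p ≠ 0 ∧ restrictPoly a q ≠ 0 ∧
    x = algebraMap _ SField p / algebraMap _ SField q

namespace IsEvalUnit

theorem mem {x : SField} (h : IsEvalUnit a x) : x ∈ evalRing a := by
  obtain ⟨p, q, -, hq, h⟩ := h
  exact ⟨p, q, hq, h⟩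

theorem one : IsEvalUnit a 1 := ⟨1, 1, by simp, by simp, by simp⟩

theorem mul {x y : SField} (hx : IsEvalUnit a x) (hy : IsEvalUnit a y) : IsEvalUnit a (x * y) := by
  obtain ⟨p, q, hp, hq, rfl⟩ := hx
  obtain ⟨p', q', hp', hq', rfl⟩ := hy
  exact ⟨p * p', q * q', by rw [map_mul]; exact mul_ne_zero hp hp',
    by rw [map_mul]; exact mul_ne_zero hq hq', by rw [map_mul, map_mul, div_mul_div_comm]⟩

theorem inv {x : SField} (hx : IsEvalUnit a x) : IsEvalUnit a x⁻¹ := by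
  obtain ⟨p, q, hp, hq, rfl⟩ := hx
  exact ⟨q, p, hq, hp, inv_div _ _⟩

theorem prod {ι : Type*} {s : Finset ι} {f : ι → SField} (h : ∀ i ∈ s, IsEvalUnit a (f i)) :
    IsEvalUnit a (∏ i ∈ s, f i) := by
  classical
  induction s using Finset.induction_on with
  | empty => exact one
  | insert i s hi ih =>
    rw [Finset.prod_insert hi]
    exact (h i (Finset.mem_insert_self _ _)).mul
      (ih fun j hj => h j (Finset.mem_insert_of_mem hj))

theorem ne_zero {x : SField} (hx : IsEvalUnit a x) : x ≠ 0 := by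
  obtain ⟨p, q, hp, hq, rfl⟩ := hx
  refine div_ne_zero ?_ ?_ <;>
  · rw [Ne, map_eq_zero_iff _ algebraMap_sfield_injective]
    rintro rfl
    simp at *

theorem linPoly (ha : 0 < a) (m : ℤ) {D l : ℤ} (h : ¬ (D = 0 ∧ l = 0)) :
    IsEvalUnit a (algebraMap _ SField (linPoly a m D l)) :=
  ⟨OneLeg.linPoly a m D l, 1, restrictPoly_linPoly_ne_zero ha m h, by simp, by simp⟩

theorem ratCast {r : ℚ} (hr : r ≠ 0) : IsEvalUnit a (r : SField) := by
  refine ⟨C r, 1, ?_, by simp, ?_⟩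
  · rw [← algebraMap_eq, AlgHom.commutes, algebraMap_eq, Ne, C_eq_zero]
    exact hr
  · rw [map_one, div_one, ← algebraMap_eq, ← IsScalarTower.algebraMap_apply, eq_ratCast]

end IsEvalUnit

/-- A rational function without a pole along the plane has a unique evaluation. -/
theorem existsUnique_hasEvaluation {x : SField} (hx : x ∈ evalRing a) :
    ∃! y, HasEvaluation a x y := by
  obtain ⟨p, q, hq, rfl⟩ := hx
  refine ⟨_, ⟨p, q, hq, rfl, rfl⟩, ?_⟩
  rintro y ⟨p', q', hq', h, rfl⟩
  have ne : ∀ {q : MvPolynomial (Fin 3) ℚ}, restrictPoly a q ≠ 0 → algebraMap _ SField q ≠ 0 := by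
    intro q hq
    rw [Ne, map_eq_zero_iff _ algebraMap_sfield_injective]
    rintro rfl
    exact hq (map_zero _)
  have ne' : ∀ {q : MvPolynomial (Fin 3) ℚ}, restrictPoly a q ≠ 0 →
      algebraMap _ (FractionRing (MvPolynomial (Fin 2) ℚ)) (restrictPoly a q) ≠ 0 := by
    intro q hq
    rwa [Ne, map_eq_zero_iff _ (IsFractionRing.injective (MvPolynomial (Fin 2) ℚ) _)]
  rw [div_eq_div_iff (ne hq) (ne hq'), ← map_mul, ← map_mul] at h
  have h' := algebraMap_sfield_injective h
  rw [div_eq_div_iff (ne' hq') (ne' hq), ← map_mul, ← map_mul, ← map_mul, ← map_mul, h']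

/-- A multiple of `ε` evaluates to zero. -/
theorem hasEvaluation_zero (ha : 0 < a) {x : SField} (hx : x ∈ evalRing a) :
    HasEvaluation a (eps a * x) 0 := by
  obtain ⟨p, q, hq, rfl⟩ := hx
  refine ⟨epsPoly a * p, q, hq, ?_, ?_⟩
  · rw [map_mul, eps, mul_div_assoc]
  · rw [map_mul, restrictPoly_epsPoly ha, zero_mul, map_zero, zero_div]

end EvaluationRing

/-! ### Polynomial functions of the labelling -/

section SlotRing

open MvPolynomial

variable {n : ℕ} (a : ℕ) (I : Fin n → ℤ)

/-- The functions of a labelling `σ` of the boxes by the slots that are polynomials in the numbers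
`ε I (σ s)`, with coefficients that can be evaluated on the plane. Here `I` is the first coordinate
of the boxes, and `σ s` is the box of the slot `s`. -/
def slotRing : Subalgebra (evalRing a) (Equiv.Perm (Fin n) → SField) :=
  Algebra.adjoin (evalRing a) (Set.range fun s σ => eps a * (I (σ s) : SField))

variable {a I}

theorem slotRing_gen (s : Fin n) : (fun σ => eps a * (I (σ s) : SField)) ∈ slotRing a I :=
  Algebra.subset_adjoin ⟨s, rfl⟩

theorem const_mem_slotRing {x : SField} (hx : x ∈ evalRing a) : (fun _ => x) ∈ slotRing a I :=
  (slotRing a I).algebraMap_mem ⟨x, hx⟩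

theorem slotRing_shift {F : Equiv.Perm (Fin n) → SField} (hF : F ∈ slotRing a I)
    (τ : Equiv.Perm (Fin n)) : (fun σ => F (σ * τ)) ∈ slotRing a I := by
  induction hF using Algebra.adjoin_induction with
  | mem x hx =>
    obtain ⟨s, rfl⟩ := hx
    exact slotRing_gen (τ s)
  | algebraMap r => exact (slotRing a I).algebraMap_mem r
  | add x y _ _ hx hy => exact add_mem hx hy
  | mul x y _ _ hx hy => exact mul_mem hx hy

/-- A function in the ring whose values are units is a unit: up to the product over all labellings,
which is a constant, its inverse is the product of its other translates. -/
theorem inv_mem_slotRing {F : Equiv.Perm (Fin n) → SField} (hF : F ∈ slotRing a I)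
    (hu : ∀ σ, IsEvalUnit a (F σ)) : (fun σ => (F σ)⁻¹) ∈ slotRing a I := by
  classical
  have hU : IsEvalUnit a (∏ τ, F τ) := IsEvalUnit.prod fun τ _ => hu τ
  have h1 : (fun σ => (F σ)⁻¹) = (fun _ => (∏ τ, F τ)⁻¹) *
      ∏ τ ∈ Finset.univ.erase (1 : Equiv.Perm (Fin n)), fun σ => F (σ * τ) := by
    funext σ
    have h2 : ∏ τ, F τ = F σ * ∏ τ ∈ Finset.univ.erase (1 : Equiv.Perm (Fin n)), F (σ * τ) := by
      rw [← Equiv.prod_comp (Equiv.mulLeft σ), ← Finset.mul_prod_erase _ _ (Finset.mem_univ 1)]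
      simp
    have h3 := (hu σ).ne_zero
    have h4 : ∏ τ ∈ Finset.univ.erase (1 : Equiv.Perm (Fin n)), F (σ * τ) ≠ 0 :=
      Finset.prod_ne_zero_iff.2 fun τ _ => (hu _).ne_zero
    rw [Pi.mul_apply, Finset.prod_apply, h2]
    field_simp
  rw [h1]
  exact mul_mem (const_mem_slotRing hU.inv.mem) (prod_mem fun τ _ => slotRing_shift hF τ)

theorem linPoly_mem_slotRing {m : Equiv.Perm (Fin n) → ℤ}
    (hm : (fun σ => eps a * (m σ : SField)) ∈ slotRing a I) (D l : ℤ) :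
    (fun σ => algebraMap _ SField (linPoly a (m σ) D l)) ∈ slotRing a I := by
  have h : (fun σ => algebraMap _ SField (linPoly a (m σ) D l)) =
      (fun σ => eps a * (m σ : SField)) + fun _ => algebraMap _ SField (linPoly a 0 D l) :=
    funext fun σ => algebraMap_linPoly _ _ _
  rw [h]
  exact add_mem hm (const_mem_slotRing (poly_mem_evalRing _))

end SlotRing

/-! ### Euler classes of lines of weights -/

section RegularEuler

open MvPolynomial

theorem weight_ne_zero {w : Fin 3 → ℤ} (hw : w ≠ 0) : weight w ≠ 0 := by
  obtain ⟨i, hi⟩ := Function.ne_iff.1 hw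
  rw [weight, Ne, map_eq_zero_iff _ algebraMap_sfield_injective]
  intro h
  have := congrArg (eval (Pi.single i 1)) h
  simp [Pi.single_apply] at this
  exact hi this

open Classical in
/-- The weight of a character, replaced by `1` if the character is trivial. -/
def regWeight (w : Fin 3 → ℤ) : SField := if w = 0 then 1 else weight w

theorem regWeight_ne_zero (w : Fin 3 → ℤ) : regWeight w ≠ 0 := by
  unfold regWeight
  split_ifs with h
  · exact one_ne_zero
  · exact weight_ne_zero h

theorem regWeight_of_ne {w : Fin 3 → ℤ} (hw : w ≠ 0) : regWeight w = weight w := if_neg hw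

/-- The Euler class of the nontrivial part of a virtual representation. In contrast to `euler`, it
is multiplicative without any assumption. -/
def regEuler (γ : Laurent) : SField := γ.coeff.prod fun w k => regWeight w ^ k

theorem euler_eq_regEuler {γ : Laurent} (h : γ.coeff 0 = 0) : euler γ = regEuler γ := by
  refine Finsupp.prod_congr fun w hw => ?_
  rw [regWeight_of_ne]
  rintro rfl
  exact Finsupp.mem_support_iff.1 hw h

theorem regEuler_zero : regEuler 0 = 1 := Finsupp.prod_zero_index

theorem regEuler_add (γ γ' : Laurent) : regEuler (γ + γ') = regEuler γ * regEuler γ' := by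
  rw [regEuler, AddMonoidAlgebra.coeff_add]
  exact Finsupp.prod_add_index' (fun _ => zpow_zero _)
    fun w k k' => zpow_add₀ (regWeight_ne_zero w) k k'

theorem regEuler_neg (γ : Laurent) : regEuler (-γ) = (regEuler γ)⁻¹ := by
  refine eq_inv_of_mul_eq_one_left ?_
  rw [← regEuler_add, neg_add_cancel, regEuler_zero]

theorem regEuler_sub (γ γ' : Laurent) : regEuler (γ - γ') = regEuler γ * (regEuler γ')⁻¹ := by
  rw [sub_eq_add_neg, regEuler_add, regEuler_neg]

theorem regEuler_sum {ι : Type*} (s : Finset ι) (γ : ι → Laurent) :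
    regEuler (∑ i ∈ s, γ i) = ∏ i ∈ s, regEuler (γ i) := by
  classical
  induction s using Finset.induction_on with
  | empty => simp [regEuler_zero]
  | insert i s hi ih => rw [Finset.sum_insert hi, Finset.prod_insert hi, regEuler_add, ih]

theorem regEuler_tmon (w : Fin 3 → ℤ) : regEuler (tmon w) = regWeight w := by
  rw [regEuler, tmon, AddMonoidAlgebra.coeff_single, Finsupp.prod_single_index (zpow_zero _),
    zpow_one]

theorem regEuler_ray (w : Fin 3 → ℤ) (p q : ℤ) : regEuler (ray w p q) =
    (∏ l ∈ Finset.Ico p q, regWeight (w + e3 l)) *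
      (∏ l ∈ Finset.Ico q p, regWeight (w + e3 l))⁻¹ := by
  simp only [ray, regEuler_sub, regEuler_sum, regEuler_tmon]

theorem lineVec_add_e3_eq_zero {a m D l : ℤ} (h : lineVec a m D + e3 l = 0) :
    m = 0 ∧ D = 0 ∧ l = 0 := by
  have h0 := congrFun h 0
  have h1 := congrFun h 1
  have h2 := congrFun h 2
  simp [lineVec, e3] at h0 h1 h2
  subst h0
  simp at h2
  exact ⟨rfl, by omega, h2⟩

variable {a : ℕ}

theorem regWeight_line {m D l : ℤ} (h : ¬ (m = 0 ∧ D = 0 ∧ l = 0)) :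
    regWeight (lineVec a m D + e3 l) = algebraMap _ SField (linPoly a m D l) := by
  rw [regWeight_of_ne fun h0 => h (lineVec_add_e3_eq_zero h0), weight_eq]

theorem algebraMap_linPoly_zero (m : ℤ) :
    algebraMap _ SField (linPoly a m 0 0) = eps a * m := by
  rw [algebraMap_linPoly]
  simp [linPoly]

theorem coeff_zero_ray {m D δ : ℤ} (h : D = 0 → 0 < δ → m ≠ 0) :
    (ray (lineVec a m D) δ (a * m)).coeff 0 = 0 := by
  have key : ∀ p q : ℤ, (¬ (m = 0 ∧ D = 0 ∧ p ≤ 0 ∧ 0 < q)) →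
      (∑ l ∈ Finset.Ico p q, tmon (lineVec a m D + e3 l)).coeff 0 = 0 := by
    intro p q hpq
    rw [AddMonoidAlgebra.coeff_sum, Finsupp.finsetSum_apply]
    refine Finset.sum_eq_zero fun l hl => ?_
    rw [tmon, AddMonoidAlgebra.coeff_single, Finsupp.single_eq_of_ne]
    intro h0
    obtain ⟨h1, h2, h3⟩ := lineVec_add_e3_eq_zero h0.symm
    subst h3
    rw [Finset.mem_Ico] at hl
    exact hpq ⟨h1, h2, hl⟩
  rw [ray, AddMonoidAlgebra.coeff_sub, Finsupp.sub_apply, key, key, sub_zero]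
  · rintro ⟨h1, h2, -, h4⟩
    exact h h2 h4 h1
  · rintro ⟨h1, -, -, h4⟩
    rw [h1] at h4
    simp at h4

/-- The part of a line of weights that depends on the box labelling: it is a unit, apart from the
factor `m ε` in case that the line meets the singular locus. -/
theorem exists_regEuler_ray {n : ℕ} {I : Fin n → ℤ} (ha : 0 < a) {m : Equiv.Perm (Fin n) → ℤ}
    (hm : (fun σ => eps a * (m σ : SField)) ∈ slotRing a I) (D δ : ℤ) :
    ∃ H ∈ slotRing a I, (∀ σ, IsEvalUnit a (H σ)) ∧ ∀ σ, (D = 0 → 0 < δ → m σ ≠ 0) →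
      regEuler (ray (lineVec a (m σ) D) δ 0) =
        (if D = 0 ∧ 0 < δ then eps a * m σ else 1)⁻¹ * H σ := by
  let F : ℤ → Equiv.Perm (Fin n) → SField := fun l σ =>
    if D = 0 ∧ l = 0 then 1 else algebraMap _ SField (linPoly a (m σ) D l)
  have hF : ∀ l, F l ∈ slotRing a I := by
    intro l
    by_cases h : D = 0 ∧ l = 0
    · have : F l = fun _ => 1 := funext fun σ => if_pos h
      rw [this]
      exact one_mem _
    · have : F l = fun σ => algebraMap _ SField (linPoly a (m σ) D l) :=
        funext fun σ => if_neg h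
      rw [this]
      exact linPoly_mem_slotRing hm D l
  have hu : ∀ l σ, IsEvalUnit a (F l σ) := by
    intro l σ
    by_cases h : D = 0 ∧ l = 0
    · simp only [F, if_pos h]
      exact IsEvalUnit.one
    · simp only [F, if_neg h]
      exact IsEvalUnit.linPoly ha _ h
  have hu' : ∀ (T : Finset ℤ) σ, IsEvalUnit a ((∏ l ∈ T, F l) σ) := by
    intro T σ
    rw [Finset.prod_apply]
    exact IsEvalUnit.prod fun l _ => hu l σ
  refine ⟨(∏ l ∈ Finset.Ico δ 0, F l) * fun σ => ((∏ l ∈ Finset.Ico 0 δ, F l) σ)⁻¹,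
    mul_mem (prod_mem fun l _ => hF l) (inv_mem_slotRing (prod_mem fun l _ => hF l) (hu' _)),
    fun σ => (hu' _ σ).mul (hu' _ σ).inv, fun σ hσ => ?_⟩
  rw [regEuler_ray, Pi.mul_apply, Finset.prod_apply, Finset.prod_apply]
  have h1 : ∏ l ∈ Finset.Ico δ 0, regWeight (lineVec a (m σ) D + e3 l) =
      ∏ l ∈ Finset.Ico δ 0, F l σ := by
    refine Finset.prod_congr rfl fun l hl => ?_
    have hl : ¬ l = 0 := by rw [Finset.mem_Ico] at hl; omega
    rw [regWeight_line fun h => hl h.2.2]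
    exact (if_neg fun h => hl h.2).symm
  have h2 : ∏ l ∈ Finset.Ico 0 δ, regWeight (lineVec a (m σ) D + e3 l) =
      (if D = 0 ∧ 0 < δ then eps a * m σ else 1) * ∏ l ∈ Finset.Ico 0 δ, F l σ := by
    by_cases h : D = 0 ∧ 0 < δ
    · have h0 : (0 : ℤ) ∈ Finset.Ico 0 δ := Finset.mem_Ico.2 ⟨le_rfl, h.2⟩
      rw [if_pos h, ← Finset.mul_prod_erase _ _ h0, ← Finset.mul_prod_erase _ (fun l => F l σ) h0]
      have hF0 : F 0 σ = 1 := if_pos ⟨h.1, rfl⟩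
      rw [hF0, one_mul, regWeight_line fun h' => hσ h.1 h.2 h'.1]
      congr 1
      · rw [h.1, algebraMap_linPoly_zero]
      · refine Finset.prod_congr rfl fun l hl => ?_
        have hl : ¬ l = 0 := (Finset.mem_erase.1 hl).1
        rw [regWeight_line fun h => hl h.2.2]
        exact (if_neg fun h => hl h.2).symm
    · rw [if_neg h, one_mul]
      refine Finset.prod_congr rfl fun l hl => ?_
      have hl : ¬ D = 0 := fun h' => h ⟨h', by rw [Finset.mem_Ico] at hl; omega⟩
      rw [regWeight_line fun h => hl h.2.1]
      exact (if_neg fun h => hl h.1).symm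
  rw [h1, h2, mul_inv]
  ring

theorem exists_regEuler_sum_ray {n : ℕ} {I : Fin n → ℤ} (ha : 0 < a) {ι : Type*} [Fintype ι]
    {m : ι → Equiv.Perm (Fin n) → ℤ}
    (hm : ∀ i, (fun σ => eps a * (m i σ : SField)) ∈ slotRing a I) (D δ : ι → ℤ) :
    ∃ H ∈ slotRing a I, (∀ σ, IsEvalUnit a (H σ)) ∧
      ∀ σ, (∀ i, D i = 0 → 0 < δ i → m i σ ≠ 0) →
        regEuler (∑ i, ray (lineVec a (m i σ) (D i)) (δ i) 0) =
          (∏ i with D i = 0 ∧ 0 < δ i, eps a * (m i σ : SField))⁻¹ * H σ := by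
  choose H hH hu hr using fun i => exists_regEuler_ray ha (hm i) (D i) (δ i)
  refine ⟨∏ i, H i, prod_mem fun i _ => hH i, fun σ => ?_, fun σ hσ => ?_⟩
  · rw [Finset.prod_apply]
    exact IsEvalUnit.prod fun i _ => hu i σ
  · rw [regEuler_sum, Finset.prod_congr rfl fun i _ => hr i σ (hσ i), Finset.prod_mul_distrib,
      Finset.prod_apply, Finset.prod_inv_distrib, Finset.prod_filter]

/-- The part of a line of weights that does not depend on the heights. -/
theorem regEuler_ray_const (ha : 0 < a) (m D : ℤ) : ∃ u, IsEvalUnit a u ∧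
    regEuler (ray (lineVec a m D) 0 (a * m)) = (if D = 0 ∧ 0 < m then eps a else 1) * u := by
  have ha' : (0 : ℤ) < a := by exact_mod_cast ha
  have hline : ∀ T : Finset ℤ, (∀ l ∈ T, ¬ (D = 0 ∧ l = 0)) →
      IsEvalUnit a (∏ l ∈ T, regWeight (lineVec a m D + e3 l)) := by
    intro T hT
    refine IsEvalUnit.prod fun l hl => ?_
    rw [regWeight_line fun h => hT l hl h.2]
    exact IsEvalUnit.linPoly ha m (hT l hl)
  rw [regEuler_ray]
  have h1 : IsEvalUnit a (∏ l ∈ Finset.Ico (a * m) 0, regWeight (lineVec a m D + e3 l)) :=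
    hline _ fun l hl h => by rw [Finset.mem_Ico] at hl; omega
  by_cases h : D = 0 ∧ 0 < m
  · have h0 : (0 : ℤ) ∈ Finset.Ico 0 (a * m) := Finset.mem_Ico.2 ⟨le_rfl, mul_pos ha' h.2⟩
    rw [if_pos h, ← Finset.mul_prod_erase _ _ h0, regWeight_line fun h' => h.2.ne' h'.1, h.1,
      algebraMap_linPoly_zero, mul_assoc, mul_assoc]
    rw [h.1] at hline h1
    refine ⟨_, IsEvalUnit.mul ?_ (IsEvalUnit.mul (hline _ fun l hl h => ?_) h1.inv), rfl⟩
    · have := IsEvalUnit.ratCast (a := a) (r := (m : ℚ)) (by exact_mod_cast h.2.ne')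
      rwa [Rat.cast_intCast] at this
    · exact (Finset.mem_erase.1 hl).1 h.2
  · simp only [if_neg h, one_mul]
    refine ⟨_, IsEvalUnit.mul (hline _ fun l hl h' => h ⟨h'.1, ?_⟩) h1.inv, rfl⟩
    rw [Finset.mem_Ico, h'.2] at hl
    exact pos_of_mul_pos_right hl.2 ha'.le

theorem regEuler_sum_ray_const (ha : 0 < a) {ι : Type*} [Fintype ι] (m D : ι → ℤ) :
    ∃ u, IsEvalUnit a u ∧ regEuler (∑ i, ray (lineVec a (m i) (D i)) 0 (a * m i)) =
      eps a ^ (Finset.univ.filter fun i => D i = 0 ∧ 0 < m i).card * u := by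
  choose u hu hr using fun i => regEuler_ray_const ha (m i) (D i)
  refine ⟨∏ i, u i, IsEvalUnit.prod fun i _ => hu i, ?_⟩
  rw [regEuler_sum, Finset.prod_congr rfl fun i _ => hr i, Finset.prod_mul_distrib,
    ← Finset.prod_filter, Finset.prod_const]

end RegularEuler

/-! ### Counting boxes on diagonals -/

section Counting

open Finset

variable {B : Type*} [Fintype B] {I c : B → ℤ}

/-- The number of boxes on a diagonal with first coordinate less than `u`, in case that the
partition does not cut off the diagonal before. -/
theorem IsPartition.card_diagonal (hP : IsPartition I c) (b : B) {e u : ℤ} (hu : u ≤ I b + 1)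
    (he : u - 1 - e ≤ I b - c b) :
    (#(univ.filter fun b' => c b' = e ∧ I b' < u) : ℤ) = max 0 (u - max 0 e) := by
  have : #(univ.filter fun b' => c b' = e ∧ I b' < u) = #(Ico (max 0 e) u) := by
    refine card_bij (fun b' _ => I b') ?_ ?_ ?_
    · intro b' hb'
      rw [mem_filter] at hb'
      have h1 := hP.nonneg b'
      have h2 := hP.content_le b'
      rw [mem_Ico]
      omega
    · intro b' hb' b'' hb'' h
      rw [mem_filter] at hb' hb''
      exact hP.inj _ _ (hb'.2.1.trans hb''.2.1.symm) h
    · intro i hi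
      rw [mem_Ico] at hi
      obtain ⟨b', h1, h2⟩ := hP.down b i (i - e) (by omega) (by omega) (by omega) (by omega)
      exact ⟨b', mem_filter.2 ⟨mem_univ _, by omega, by omega⟩, h1⟩
  rw [this, Int.card_Ico, Int.toNat_eq_max]
  omega

/-- The order in `ε` of the part of the weight that does not depend on the heights is zero. -/
theorem IsPartition.card_const (hP : IsPartition I c) :
    (#(univ.filter fun q : B × B => c q.2 - c q.1 = 0 ∧ 0 < I q.2 - I q.1) : ℤ) +
      #(univ.filter fun q : B × B => c q.2 - c q.1 = 0 ∧ 0 < I q.2 - I q.1 - 1) =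
    #(univ.filter fun q : B × B => c q.2 - c q.1 - 1 = 0 ∧ 0 < I q.2 - I q.1 - 1) +
      #(univ.filter fun q : B × B => c q.2 - c q.1 + 1 = 0 ∧ 0 < I q.2 - I q.1) +
      #(univ.filter fun b => c b = 0 ∧ 0 < I b) := by
  have key : ∀ p r : ℤ, (#(univ.filter fun q : B × B =>
      c q.2 - c q.1 - p = r ∧ 0 < I q.2 - I q.1 - p) : ℤ) =
      ∑ b, (#(univ.filter fun b' => c b' = c b - p - r ∧ I b' < I b - p) : ℤ) := by
    classical
    intro p r
    rw [card_eq_sum_card_fiberwise (f := Prod.snd) (t := univ) fun _ _ => mem_coe.2 (mem_univ _)]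
    push_cast
    refine sum_congr rfl fun b _ => ?_
    congr 1
    refine card_nbij' Prod.fst (fun b' => (b', b)) ?_ ?_ ?_ ?_
    · intro q hq
      simp only [coe_filter, mem_filter, mem_univ, true_and, Set.mem_ofPred_eq] at hq ⊢
      rw [← hq.2]
      omega
    · intro b' hb'
      simp only [coe_filter, mem_filter, mem_univ, true_and, Set.mem_ofPred_eq] at hb' ⊢
      exact ⟨by omega, trivial⟩
    · intro q hq
      simp only [coe_filter, mem_filter, mem_univ, true_and, Set.mem_ofPred_eq] at hq
      rw [← hq.2]
    · intro b' _
      rfl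
  have h00 := key 0 0
  have h11 := key 1 (-1)
  have h10 := key 1 0
  have h01 := key 0 (-1)
  have hl : (#(univ.filter fun b => c b = 0 ∧ 0 < I b) : ℤ) =
      ∑ b, if c b = 0 ∧ 0 < I b then 1 else 0 := by
    rw [card_filter]
    push_cast
    rfl
  have e11 : (univ.filter fun q : B × B => c q.2 - c q.1 = 0 ∧ 0 < I q.2 - I q.1 - 1) =
      univ.filter fun q : B × B => c q.2 - c q.1 - 1 = -1 ∧ 0 < I q.2 - I q.1 - 1 :=
    filter_congr fun q _ => by omega
  have e01 : (univ.filter fun q : B × B => c q.2 - c q.1 + 1 = 0 ∧ 0 < I q.2 - I q.1) =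
      univ.filter fun q : B × B => c q.2 - c q.1 - 0 = -1 ∧ 0 < I q.2 - I q.1 - 0 :=
    filter_congr fun q _ => by omega
  have e00 : (univ.filter fun q : B × B => c q.2 - c q.1 = 0 ∧ 0 < I q.2 - I q.1) =
      univ.filter fun q : B × B => c q.2 - c q.1 - 0 = 0 ∧ 0 < I q.2 - I q.1 - 0 :=
    filter_congr fun q _ => by omega
  -- the count can be done separately for each box, as the second box of the pairs
  rw [e11, e01, e00, h00, h11, h10, h01, hl, ← sum_add_distrib, ← sum_add_distrib,
    ← sum_add_distrib]
  refine sum_congr rfl fun b _ => ?_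
  have h1 := hP.nonneg b
  have h2 := hP.content_le b
  rw [hP.card_diagonal b (by omega) (by omega), hP.card_diagonal b (by omega) (by omega),
    hP.card_diagonal b (by omega) (by omega), hP.card_diagonal b (by omega) (by omega)]
  split_ifs <;> omega

end Counting

/-! ### The weight of a fixed locus -/

section WeightFormula

open MvPolynomial

variable {n : ℕ} {I c y : Fin n → ℤ} {a : ℕ}

theorem mem_nodePerms_content {σ : Equiv.Perm (Fin n)} (hσ : σ ∈ nodePerms c) (s : Fin n) :
    c (σ s) = c s := (mem_nodePerms c).1 hσ s

theorem prod_eps_mul {ι : Type*} (T : Finset ι) (f : ι → ℤ) (g : ι → ℚ) (h : ∀ i, g i = f i) :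
    ∏ i ∈ T, eps a * (f i : SField) = eps a ^ T.card * ((∏ i ∈ T, g i : ℚ) : SField) := by
  rw [Finset.prod_mul_distrib, Finset.prod_const, Rat.cast_prod]
  congr 1
  exact Finset.prod_congr rfl fun i _ => by rw [h, Rat.cast_intCast]

/-- A sum of lines of weights, in terms of the lines that meet the singular locus, if the part that
does not depend on the heights is the same for all labellings. -/
theorem exists_regEuler_lines (ha : 0 < a) {ι : Type*} [Fintype ι]
    {m : ι → Equiv.Perm (Fin n) → ℤ}
    (hm : ∀ i, (fun σ => eps a * (m i σ : SField)) ∈ slotRing a I) (D δ : ι → ℤ)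
    (G : Finset (Equiv.Perm (Fin n)))
    (hG : ∀ σ ∈ G, ∑ i, ray (lineVec a (m i σ) (D i)) 0 (a * m i σ) =
      ∑ i, ray (lineVec a (m i 1) (D i)) 0 (a * m i 1)) :
    ∃ H ∈ slotRing a I, (∀ σ, IsEvalUnit a (H σ)) ∧
      ∀ σ ∈ G, (∀ i, D i = 0 → 0 < δ i → m i σ ≠ 0) →
        (∑ i, ray (lineVec a (m i σ) (D i)) (δ i) (a * m i σ)).coeff 0 = 0 ∧
        regEuler (∑ i, ray (lineVec a (m i σ) (D i)) (δ i) (a * m i σ)) =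
          eps a ^ (Finset.univ.filter fun i => D i = 0 ∧ 0 < m i 1).card *
          (∏ i with D i = 0 ∧ 0 < δ i, eps a * (m i σ : SField))⁻¹ * H σ := by
  obtain ⟨H, hH, hu, hr⟩ := exists_regEuler_sum_ray ha hm D δ
  obtain ⟨u, hu', hr'⟩ := regEuler_sum_ray_const ha (fun i => m i 1) D
  refine ⟨(fun _ => u) * H, mul_mem (const_mem_slotRing hu'.mem) hH, fun σ => hu'.mul (hu σ),
    fun σ hσ hne => ⟨?_, ?_⟩⟩
  · rw [AddMonoidAlgebra.coeff_sum, Finsupp.finsetSum_apply]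
    exact Finset.sum_eq_zero fun i _ => coeff_zero_ray (hne i)
  · have : ∑ i, ray (lineVec a (m i σ) (D i)) (δ i) (a * m i σ) =
        ∑ i, ray (lineVec a (m i σ) (D i)) (δ i) 0 +
          ∑ i, ray (lineVec a (m i 1) (D i)) 0 (a * m i 1) := by
      rw [← hG σ hσ, ← Finset.sum_add_distrib]
      exact Finset.sum_congr rfl fun i _ => (ray_add _ _ _ _).symm
    rw [this, regEuler_add, hr σ hne, hr', Pi.mul_apply]
    ring

/-- The contribution of the pairs of boxes, for one of the four monomials of
`(1 - t₁)(1 - t₂) / (t₁t₂)`. -/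
theorem exists_regEuler_pairs (ha : 0 < a) (p e : ℤ) (r : ℤ) (hr : e = p - r) :
    ∃ H ∈ slotRing a I, (∀ σ, IsEvalUnit a (H σ)) ∧
      ∀ σ ∈ nodePerms c, (∀ q ∈ rootSet c y a p r, I (σ q.2) - I (σ q.1) - p ≠ 0) →
        (∑ q : Fin n × Fin n, ray (lineVec a (I (σ q.2) - I (σ q.1) - p) (c q.2 - c q.1 - e))
          (y q.2 - y q.1 - p * a) (a * (I (σ q.2) - I (σ q.1) - p))).coeff 0 = 0 ∧
        regEuler (∑ q : Fin n × Fin n,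
          ray (lineVec a (I (σ q.2) - I (σ q.1) - p) (c q.2 - c q.1 - e))
          (y q.2 - y q.1 - p * a) (a * (I (σ q.2) - I (σ q.1) - p))) =
          eps a ^ (Finset.univ.filter fun q : Fin n × Fin n =>
            c q.2 - c q.1 - e = 0 ∧ 0 < I q.2 - I q.1 - p).card *
          (eps a ^ (rootSet c y a p r).card *
            (rootProd (rootSet c y a p r) p (fun s => (I (σ s) : ℚ)) : SField))⁻¹ * H σ := by
  have hm : ∀ q : Fin n × Fin n,
      (fun σ : Equiv.Perm (Fin n) => eps a * ((I (σ q.2) - I (σ q.1) - p : ℤ) : SField)) ∈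
        slotRing a I := by
    intro q
    have : (fun σ : Equiv.Perm (Fin n) =>
        eps a * ((I (σ q.2) - I (σ q.1) - p : ℤ) : SField)) =
        (fun σ => eps a * (I (σ q.2) : SField)) - (fun σ => eps a * (I (σ q.1) : SField)) -
          fun _ => eps a * (p : SField) := by
      funext σ
      simp only [Pi.sub_apply]
      push_cast
      ring
    rw [this]
    exact sub_mem (sub_mem (slotRing_gen _) (slotRing_gen _))
      (const_mem_slotRing (mul_mem (poly_mem_evalRing _) (intCast_mem _ _)))
  have hG : ∀ σ ∈ nodePerms c, ∑ q : Fin n × Fin n,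
      ray (lineVec a (I (σ q.2) - I (σ q.1) - p) (c q.2 - c q.1 - e)) 0
        (a * (I (σ q.2) - I (σ q.1) - p)) =
      ∑ q : Fin n × Fin n, ray (lineVec a (I ((1 : Equiv.Perm (Fin n)) q.2) -
        I ((1 : Equiv.Perm (Fin n)) q.1) - p) (c q.2 - c q.1 - e)) 0
        (a * (I ((1 : Equiv.Perm (Fin n)) q.2) - I ((1 : Equiv.Perm (Fin n)) q.1) - p)) := by
    intro σ hσ
    rw [← Equiv.sum_comp (σ.prodCongr σ) fun q : Fin n × Fin n => ray
      (lineVec a (I ((1 : Equiv.Perm (Fin n)) q.2) - I ((1 : Equiv.Perm (Fin n)) q.1) - p)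
        (c q.2 - c q.1 - e)) 0
      (a * (I ((1 : Equiv.Perm (Fin n)) q.2) - I ((1 : Equiv.Perm (Fin n)) q.1) - p))]
    simp [mem_nodePerms_content hσ]
  obtain ⟨H, hH, hu, hreg⟩ := exists_regEuler_lines (I := I) ha
    (m := fun (q : Fin n × Fin n) σ => I (σ q.2) - I (σ q.1) - p) hm
    (fun q => c q.2 - c q.1 - e) (fun q => y q.2 - y q.1 - p * a) (nodePerms c) hG
  refine ⟨H, hH, hu, fun σ hσ hne => ?_⟩
  have hset : (Finset.univ.filter fun q : Fin n × Fin n =>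
      c q.2 - c q.1 - e = 0 ∧ 0 < y q.2 - y q.1 - p * a) = rootSet c y a p r :=
    Finset.filter_congr fun q _ => by omega
  obtain ⟨h0, h1⟩ := hreg σ hσ fun q h2 h3 => hne q (by
    rw [← hset, Finset.mem_filter]
    exact ⟨Finset.mem_univ _, h2, h3⟩)
  refine ⟨h0, ?_⟩
  rw [h1, hset, rootProd]
  congr 3
  exact prod_eps_mul _ _ _ fun q => by push_cast; ring

/-- The contribution of the lines of weights of the summand `𝖥_U`. -/
theorem exists_regEuler_frameLow (ha : 0 < a) :
    ∃ H ∈ slotRing a I, (∀ σ, IsEvalUnit a (H σ)) ∧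
      ∀ σ ∈ nodePerms c, (∀ s ∈ frameLow c y, I (σ s) ≠ 0) →
        (∑ s, ray (lineVec a (I (σ s)) (c s)) (y s) (a * I (σ s))).coeff 0 = 0 ∧
        regEuler (∑ s, ray (lineVec a (I (σ s)) (c s)) (y s) (a * I (σ s))) =
          eps a ^ (Finset.univ.filter fun s => c s = 0 ∧ 0 < I s).card *
          (eps a ^ (frameLow c y).card *
            ((∏ s ∈ frameLow c y, (I (σ s) : ℚ) : ℚ) : SField))⁻¹ * H σ := by
  have hG : ∀ σ ∈ nodePerms c, ∑ s, ray (lineVec a (I (σ s)) (c s)) 0 (a * I (σ s)) =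
      ∑ s, ray (lineVec a (I ((1 : Equiv.Perm (Fin n)) s)) (c s)) 0
        (a * I ((1 : Equiv.Perm (Fin n)) s)) := by
    intro σ hσ
    rw [← Equiv.sum_comp σ fun s => ray (lineVec a (I ((1 : Equiv.Perm (Fin n)) s)) (c s)) 0
      (a * I ((1 : Equiv.Perm (Fin n)) s))]
    simp [mem_nodePerms_content hσ]
  obtain ⟨H, hH, hu, hreg⟩ := exists_regEuler_lines (I := I) ha
    (m := fun (s : Fin n) σ => I (σ s)) slotRing_gen c y (nodePerms c) hG
  refine ⟨H, hH, hu, fun σ hσ hne => ?_⟩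
  obtain ⟨h0, h1⟩ := hreg σ hσ fun s h2 h3 => hne s (Finset.mem_filter.2
    ⟨Finset.mem_univ _, h2, h3⟩)
  refine ⟨h0, ?_⟩
  rw [h1]
  congr 3
  exact prod_eps_mul _ _ _ fun q => rfl

/-- The contribution of the lines of weights of the summand dual to `𝖥_U`. -/
theorem exists_regEuler_frameHigh (ha : 0 < a) (hI : ∀ s, 0 ≤ I s) :
    ∃ H ∈ slotRing a I, (∀ σ, IsEvalUnit a (H σ)) ∧ ∀ σ ∈ nodePerms c,
        (∑ s, ray (lineVec a (-I (σ s) - 1) (-c s)) (-y s - a) (a * (-I (σ s) - 1))).coeff 0 = 0 ∧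
        regEuler (∑ s, ray (lineVec a (-I (σ s) - 1) (-c s)) (-y s - a) (a * (-I (σ s) - 1))) =
          (eps a ^ (frameHigh c y a).card *
            ((∏ s ∈ frameHigh c y a, (-(I (σ s) : ℚ) - 1) : ℚ) : SField))⁻¹ * H σ := by
  have hm : ∀ s, (fun σ : Equiv.Perm (Fin n) => eps a * ((-I (σ s) - 1 : ℤ) : SField)) ∈
      slotRing a I := by
    intro s
    have : (fun σ : Equiv.Perm (Fin n) => eps a * ((-I (σ s) - 1 : ℤ) : SField)) =
        -(fun σ => eps a * (I (σ s) : SField)) - fun _ => eps a := by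
      funext σ
      simp only [Pi.sub_apply, Pi.neg_apply]
      push_cast
      ring
    rw [this]
    exact sub_mem (neg_mem (slotRing_gen _)) (const_mem_slotRing (poly_mem_evalRing _))
  have hG : ∀ σ ∈ nodePerms c, ∑ s, ray (lineVec a (-I (σ s) - 1) (-c s)) 0
      (a * (-I (σ s) - 1)) =
      ∑ s, ray (lineVec a (-I ((1 : Equiv.Perm (Fin n)) s) - 1) (-c s)) 0
        (a * (-I ((1 : Equiv.Perm (Fin n)) s) - 1)) := by
    intro σ hσ
    rw [← Equiv.sum_comp σ fun s => ray
      (lineVec a (-I ((1 : Equiv.Perm (Fin n)) s) - 1) (-c s)) 0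
      (a * (-I ((1 : Equiv.Perm (Fin n)) s) - 1))]
    simp [mem_nodePerms_content hσ]
  obtain ⟨H, hH, hu, hreg⟩ := exists_regEuler_lines (I := I) ha
    (m := fun (s : Fin n) σ => -I (σ s) - 1) hm (fun s => -c s) (fun s => -y s - a)
    (nodePerms c) hG
  refine ⟨H, hH, hu, fun σ hσ => ?_⟩
  obtain ⟨h0, h1⟩ := hreg σ hσ fun s _ _ => by have := hI (σ s); omega
  have hset : (Finset.univ.filter fun s => -c s = 0 ∧ 0 < -y s - a) = frameHigh c y a :=
    Finset.filter_congr fun q _ => by omega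
  have hset' : (Finset.univ.filter fun s => -c s = 0 ∧
      0 < -I ((1 : Equiv.Perm (Fin n)) s) - 1) = ∅ :=
    Finset.filter_eq_empty_iff.2 fun s _ => by
      have := hI ((1 : Equiv.Perm (Fin n)) s)
      omega
  refine ⟨h0, ?_⟩
  rw [h1, hset, hset', Finset.card_empty, pow_zero, one_mul]
  congr 2
  exact prod_eps_mul _ _ _ fun q => by push_cast; ring

/-- For a labelling that comes from a fixed locus, the denominator does not vanish. -/
theorem rootDenom_ne_zero (hP : IsPartition I c) {σ : Equiv.Perm (Fin n)} (hσ : σ ∈ nodePerms c)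
    (h : rootNumer c y a (fun s => (I (σ s) : ℚ)) ≠ 0) :
    (∀ q ∈ rootSet c y a 0 0, I (σ q.2) - I (σ q.1) - 0 ≠ 0) ∧
      ∀ q ∈ rootSet c y a 1 1, I (σ q.2) - I (σ q.1) - 1 ≠ 0 := by
  obtain ⟨v1, v2, -⟩ := rootNumer_ne_zero (p := fun s => I (σ s)) h
  have hc := fun s => mem_nodePerms_content hσ s
  constructor
  · intro q hq h0
    simp only [rootSet, Finset.mem_filter] at hq
    have : σ q.2 = σ q.1 := hP.inj _ _ (by rw [hc, hc]; omega) (by omega)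
    have := congrArg y (σ.injective this)
    omega
  · intro q hq h0
    simp only [rootSet, Finset.mem_filter] at hq
    -- the box next to the box of `q.1`, below the box of `q.2`
    have h1 := hP.content_le (σ q.2)
    have h2 := hP.nonneg (σ q.1)
    have h3 := hP.content_le (σ q.1)
    have h4 := hc q.1
    have h5 := hc q.2
    obtain ⟨b, hb, hb'⟩ := hP.down (σ q.2) (I (σ q.2)) (I (σ q.1) - c q.1) (by omega) le_rfl
      (by omega) (by omega)
    obtain ⟨s, rfl⟩ := σ.surjective b
    rw [hc] at hb'
    have h6 := v1 q.1 s (by omega) (by omega)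
    have h7 := v2 s q.2 (by omega) (by omega)
    omega

/-- The Euler class of a fixed locus is a power of `ε`, times the singular part, times a function
of the labelling without poles. -/
theorem exists_euler_eq {μ : YoungDiagram} (ha : 0 < a) (hP : IsPartition I c)
    (e : Fin n ≃ Box μ) (hI : ∀ s, I s = (e s).1.1) (hc : ∀ s, I s - c s = (e s).1.2) :
    ∃ H ∈ slotRing a I, ∀ σ ∈ nodePerms c, rootNumer c y a (fun s => (I (σ s) : ℚ)) ≠ 0 →
      ∀ L : FixedLocus μ, (∀ s, y s = a * I (σ s) - L.height (e (σ s))) →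
        euler (-L.vertex) = eps a ^ rootDegree c y a *
          ((rootNumer c y a (fun s => (I (σ s) : ℚ)) /
            rootDenom c y a (fun s => (I (σ s) : ℚ)) : ℚ) : SField) * H σ := by
  obtain ⟨H00, m00, u00, r00⟩ := exists_regEuler_pairs (I := I) (c := c) (y := y) ha 0 0 0 (by omega)
  obtain ⟨H11, m11, u11, r11⟩ := exists_regEuler_pairs (I := I) (c := c) (y := y) ha 1 0 1 (by omega)
  obtain ⟨H10, m10, u10, r10⟩ := exists_regEuler_pairs (I := I) (c := c) (y := y) ha 1 1 0 (by omega)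
  obtain ⟨H01, m01, u01, r01⟩ :=
    exists_regEuler_pairs (I := I) (c := c) (y := y) ha 0 (-1) 1 (by omega)
  obtain ⟨Hl, ml, ul, rl⟩ := exists_regEuler_frameLow (I := I) (c := c) (y := y) ha
  obtain ⟨Hh, mh, uh, rh⟩ := exists_regEuler_frameHigh (I := I) (c := c) (y := y) ha hP.nonneg
  refine ⟨H00 * H11 * (fun σ => (H10 σ)⁻¹) * (fun σ => (H01 σ)⁻¹) * (fun σ => (Hl σ)⁻¹) *
    (fun σ => (Hh σ)⁻¹), mul_mem (mul_mem (mul_mem (mul_mem (mul_mem m00 m11)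
      (inv_mem_slotRing m10 u10)) (inv_mem_slotRing m01 u01)) (inv_mem_slotRing ml ul))
      (inv_mem_slotRing mh uh), fun σ hσ hne L hL => ?_⟩
  obtain ⟨d0, d1⟩ := rootDenom_ne_zero hP hσ hne
  have hne' := hne
  rw [rootNumer, mul_ne_zero_iff, mul_ne_zero_iff, mul_ne_zero_iff] at hne'
  obtain ⟨⟨⟨n1, n2⟩, n3⟩, n4⟩ := hne'
  have n1' : ∀ q ∈ rootSet c y a 1 0, I (σ q.2) - I (σ q.1) - 1 ≠ 0 := fun q hq h0 =>
    n1 (rootProd_eq_zero (x := fun s => I (σ s)) hq (by omega))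
  have n2' : ∀ q ∈ rootSet c y a 0 1, I (σ q.2) - I (σ q.1) - 0 ≠ 0 := fun q hq h0 =>
    n2 (rootProd_eq_zero (x := fun s => I (σ s)) hq (by omega))
  have n3' : ∀ s ∈ frameLow c y, I (σ s) ≠ 0 := fun s hs h0 =>
    n3 (Finset.prod_eq_zero hs (by rw [h0, Int.cast_zero]))
  obtain ⟨z00, e00⟩ := r00 σ hσ d0
  obtain ⟨z11, e11⟩ := r11 σ hσ d1
  obtain ⟨z10, e10⟩ := r10 σ hσ n1'
  obtain ⟨z01, e01⟩ := r01 σ hσ n2'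
  obtain ⟨zl, el⟩ := rl σ hσ n3'
  obtain ⟨zh, eh⟩ := rh σ hσ
  have hV := L.neg_vertex_eq (σ.trans e) (I := fun s => I (σ s)) (c := c) (y := y) (a := a)
    (fun s => hI _) (fun s => by
      have := hc (σ s)
      rw [mem_nodePerms_content hσ] at this
      exact this) hL
  simp only [Finset.sum_sub_distrib, Finset.sum_add_distrib] at hV
  simp only [sub_zero, zero_mul, one_mul, sub_neg_eq_add] at z00 e00 z11 e11 z10 e10 z01 e01
  rw [hV, euler_eq_regEuler]
  · simp only [regEuler_sub, regEuler_add, e00, e11, e10, e01, el, eh, Pi.mul_apply]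
    have hcount := hP.card_const
    generalize hN00 : (Finset.univ.filter fun q : Fin n × Fin n =>
      c q.2 - c q.1 = 0 ∧ 0 < I q.2 - I q.1).card = N00 at *
    generalize hN11 : (Finset.univ.filter fun q : Fin n × Fin n =>
      c q.2 - c q.1 = 0 ∧ 0 < I q.2 - I q.1 - 1).card = N11 at *
    generalize hN10 : (Finset.univ.filter fun q : Fin n × Fin n =>
      c q.2 - c q.1 - 1 = 0 ∧ 0 < I q.2 - I q.1 - 1).card = N10 at *
    generalize hN01 : (Finset.univ.filter fun q : Fin n × Fin n =>
      c q.2 - c q.1 + 1 = 0 ∧ 0 < I q.2 - I q.1).card = N01 at *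
    generalize hNl : (Finset.univ.filter fun s => c s = 0 ∧ 0 < I s).card = Nl at *
    have hpow : eps a ^ N00 * eps a ^ N11 = eps a ^ N10 * eps a ^ N01 * eps a ^ Nl := by
      rw [← pow_add, ← pow_add, ← pow_add]
      congr 1
      omega
    have hε := eps_ne_zero a
    have hdeg : eps a ^ rootDegree c y a = eps a ^ (rootSet c y a 1 0).card *
        eps a ^ (rootSet c y a 0 1).card * eps a ^ (frameLow c y).card *
        eps a ^ (frameHigh c y a).card / eps a ^ (rootSet c y a 0 0).card /
        eps a ^ (rootSet c y a 1 1).card := by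
      rw [rootDegree, zpow_sub₀ hε, zpow_sub₀ hε, zpow_add₀ hε, zpow_add₀ hε, zpow_add₀ hε]
      simp only [zpow_natCast]
    rw [hdeg, rootNumer, rootDenom]
    simp only [Rat.cast_mul, Rat.cast_div]
    have hpow' : eps a ^ N00 * eps a ^ N11 * (eps a ^ N10)⁻¹ * (eps a ^ N01)⁻¹ *
        (eps a ^ Nl)⁻¹ = 1 := by
      rw [hpow]
      field_simp
    simp only [mul_inv, inv_inv, div_eq_mul_inv]
    refine Eq.trans ?_ (one_mul _)
    rw [← hpow']
    ring
  · simp only [AddMonoidAlgebra.coeff_sub, AddMonoidAlgebra.coeff_add, Finsupp.sub_apply,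
      Finsupp.add_apply, z00, z11, z10, z01, zl, zh, add_zero, sub_zero]

end WeightFormula

/-! ### Descendents -/

section Descendents

open MvPolynomial

theorem chern_add (k : ℕ) (γ γ' : Laurent) : chern k (γ + γ') = chern k γ + chern k γ' := by
  rw [chern, AddMonoidAlgebra.coeff_add]
  exact Finsupp.sum_add_index' (fun _ => by simp) fun w x x' => by push_cast; ring

theorem chern_zero (k : ℕ) : chern k 0 = 0 := Finsupp.sum_zero_index

theorem chern_neg (k : ℕ) (γ : Laurent) : chern k (-γ) = -chern k γ := by
  refine eq_neg_of_add_eq_zero_left ?_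
  rw [← chern_add, neg_add_cancel, chern_zero]

theorem chern_sum (k : ℕ) {ι : Type*} (s : Finset ι) (γ : ι → Laurent) :
    chern k (∑ i ∈ s, γ i) = ∑ i ∈ s, chern k (γ i) := by
  classical
  induction s using Finset.induction_on with
  | empty => simp [chern_zero]
  | insert i s hi ih => rw [Finset.sum_insert hi, Finset.sum_insert hi, chern_add, ih]

theorem chern_tmon (k : ℕ) (w : Fin 3 → ℤ) :
    chern k (tmon w) = weight w ^ k / (k.factorial : SField) := by
  rw [chern, tmon, AddMonoidAlgebra.coeff_single, Finsupp.sum_single_index (by simp)]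
  simp

theorem FixedLocus.descendentCharacter_eq {μ : YoungDiagram} (L : FixedLocus μ) :
    L.descendentCharacter = L.slice * (1 - tvar 0) * (1 - tvar 1) := by
  refine algebraMap_laurent_injective ?_
  rw [descendentCharacter, L.exists_descendent.choose_spec, map_mul, map_mul, slice,
    L.exists_slice.choose_spec]
  simp only [map_sub, map_one]
  change _ = _ * (1 - tK 0) * (1 - tK 1)
  ring

variable {n : ℕ} {I c y : Fin n → ℤ} {a : ℕ}

/-- The Chern characters of the fixed loci are functions of the labelling without poles. -/
theorem exists_chern_eq {μ : YoungDiagram} (e : Fin n ≃ Box μ) (hI : ∀ s, I s = (e s).1.1)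
    (hc : ∀ s, I s - c s = (e s).1.2) (k : ℕ) :
    ∃ H ∈ slotRing a I, ∀ σ ∈ nodePerms c,
      ∀ L : FixedLocus μ, (∀ s, y s = a * I (σ s) - L.height (e (σ s))) →
        chern k L.descendentCharacter = H σ := by
  let F : Fin n → ℤ → ℤ → Equiv.Perm (Fin n) → SField := fun s p q σ =>
    algebraMap _ SField (linPoly a (I (σ s) + p) (c s + p - q) (y s + a * p)) ^ k *
      (k.factorial : SField)⁻¹
  have hF : ∀ s p q, F s p q ∈ slotRing a I := by
    intro s p q
    refine mul_mem (pow_mem (linPoly_mem_slotRing (m := fun σ => I (σ s) + p) ?_ _ _) k)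
      (const_mem_slotRing ?_)
    · have : (fun σ : Equiv.Perm (Fin n) => eps a * ((I (σ s) + p : ℤ) : SField)) =
          (fun σ => eps a * (I (σ s) : SField)) + fun _ => eps a * (p : SField) := by
        funext σ
        simp only [Pi.add_apply]
        push_cast
        ring
      rw [this]
      exact add_mem (slotRing_gen _)
        (const_mem_slotRing (mul_mem (poly_mem_evalRing _) (intCast_mem _ _)))
    · have h := IsEvalUnit.ratCast (a := a) (r := (k.factorial : ℚ))
        (by exact_mod_cast k.factorial_ne_zero)
      rw [Rat.cast_natCast] at h
      exact h.inv.mem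
  refine ⟨∑ s, (F s 0 0 - F s 1 0 - F s 0 1 + F s 1 1), sum_mem fun s _ =>
    add_mem (sub_mem (sub_mem (hF _ _ _) (hF _ _ _)) (hF _ _ _)) (hF _ _ _),
    fun σ hσ L hL => ?_⟩
  have hmon : ∀ s (p q : ℤ), chern k (tmon ![((e (σ s)).1.1 : ℤ) + p, ((e (σ s)).1.2 : ℤ) + q,
      -(L.height (e (σ s)) : ℤ)]) = F s p q σ := by
    intro s p q
    rw [chern_tmon]
    simp only [F]
    rw [← weight_eq, div_eq_mul_inv]
    congr 3
    have h1 := hI (σ s)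
    have h2 := hc (σ s)
    rw [mem_nodePerms_content hσ] at h2
    have h3 := hL s
    funext i
    fin_cases i
    · simp [lineVec, e3]; omega
    · simp [lineVec, e3]; omega
    · simp [lineVec, e3]; rw [h3]; ring
  have hchar : L.descendentCharacter = ∑ s, (
      tmon ![((e (σ s)).1.1 : ℤ) + 0, ((e (σ s)).1.2 : ℤ) + 0, -(L.height (e (σ s)) : ℤ)] +
      -tmon ![((e (σ s)).1.1 : ℤ) + 1, ((e (σ s)).1.2 : ℤ) + 0, -(L.height (e (σ s)) : ℤ)] +
      -tmon ![((e (σ s)).1.1 : ℤ) + 0, ((e (σ s)).1.2 : ℤ) + 1, -(L.height (e (σ s)) : ℤ)] +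
      tmon ![((e (σ s)).1.1 : ℤ) + 1, ((e (σ s)).1.2 : ℤ) + 1, -(L.height (e (σ s)) : ℤ)]) := by
    rw [L.descendentCharacter_eq, L.slice_eq, ← Equiv.sum_comp (σ.trans e), Finset.sum_mul,
      Finset.sum_mul]
    refine Finset.sum_congr rfl fun s _ => ?_
    have h0 : tvar 0 = tmon ![1, 0, 0] := by
      rw [tvar, tmon]; congr 1; funext i; fin_cases i <;> rfl
    have h1 : tvar 1 = tmon ![0, 1, 0] := by
      rw [tvar, tmon]; congr 1; funext i; fin_cases i <;> rfl
    rw [h0, h1]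
    simp only [mul_sub, sub_mul, mul_one, tmon_mul, Equiv.trans_apply]
    simp only [Matrix.empty_add_empty, add_zero, Matrix.head_cons,
      Matrix.tail_cons, Matrix.add_cons]
    abel
  rw [hchar, chern_sum, Finset.sum_apply]
  refine Finset.sum_congr rfl fun s _ => ?_
  simp only [chern_add, chern_neg, hmon, Pi.add_apply, Pi.sub_apply]
  ring

/-- The descendent weight of a fixed locus is a power of `ε`, times the singular part, times a
function of the labelling without poles. -/
theorem exists_descendentWeight_eq {μ : YoungDiagram} (ha : 0 < a) (hP : IsPartition I c)
    (e : Fin n ≃ Box μ) (hI : ∀ s, I s = (e s).1.1) (hc : ∀ s, I s - c s = (e s).1.2)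
    {k : ℕ} (i : Fin k → ℕ) :
    ∃ H ∈ slotRing a I, ∀ σ ∈ nodePerms c, rootNumer c y a (fun s => (I (σ s) : ℚ)) ≠ 0 →
      ∀ L : FixedLocus μ, (∀ s, y s = a * I (σ s) - L.height (e (σ s))) →
        L.descendentWeight i = eps a ^ rootDegree c y a *
          ((rootNumer c y a (fun s => (I (σ s) : ℚ)) /
            rootDenom c y a (fun s => (I (σ s) : ℚ)) : ℚ) : SField) * H σ := by
  obtain ⟨H, hH, h⟩ := exists_euler_eq (y := y) ha hP e hI hc
  choose G hG hg using fun j => exists_chern_eq (y := y) (a := a) e hI hc (2 + i j)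
  refine ⟨H * ∏ j, G j, mul_mem hH (prod_mem fun j _ => hG j), fun σ hσ hne L hL => ?_⟩
  rw [FixedLocus.descendentWeight, h σ hσ hne L hL, Pi.mul_apply, Finset.prod_apply,
    Finset.prod_congr rfl fun j _ => hg j σ hσ L hL]
  ring

end Descendents

/-! ### Sums over labellings -/

section SumOfWeights

open MvPolynomial

variable {n : ℕ} {I c y : Fin n → ℤ} {a : ℕ}

/-- The sum over all labellings of a power of `ε`, times the singular part, times a function without
poles, is a multiple of `ε^N` for `N = 0`, or for `N = 1` if some level lies below a gap. -/
theorem exists_sum_eq_eps_mul (hP : IsPartition I c) (hy : Monotone y) {t : ℤ}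
    (ht : t ≤ 0) (hgap : ∀ s, t ≤ y s ∨ y s + a < t) {H : Equiv.Perm (Fin n) → SField}
    (hH : H ∈ slotRing a I) {N : ℕ} (hN : N = 0 ∨ N = 1 ∧ ∃ s, y s < t) :
    ∃ x ∈ evalRing a, ∑ σ ∈ nodePerms c, eps a ^ rootDegree c y a *
      ((rootNumer c y a (fun s => (I (σ s) : ℚ)) /
        rootDenom c y a (fun s => (I (σ s) : ℚ)) : ℚ) : SField) * H σ = eps a ^ N * x := by
  have hε := eps_ne_zero a
  let T : (Fin n →₀ ℕ) → ℚ := fun α => ∑ σ ∈ nodePerms c,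
    rootNumer c y a (fun s => (I (σ s) : ℚ)) / rootDenom c y a (fun s => (I (σ s) : ℚ)) *
      ∏ s, (I (σ s) : ℚ) ^ α s
  rw [slotRing, Algebra.adjoin_range_eq_range_aeval] at hH
  obtain ⟨P, rfl⟩ := hH
  have hterm : ∀ α : Fin n →₀ ℕ, ∃ x ∈ evalRing a,
      eps a ^ (rootDegree c y a + ∑ s, (α s : ℤ)) * (T α : SField) = eps a ^ N * x := by
    intro α
    by_cases hα : (N : ℤ) ≤ rootDegree c y a + ∑ s, (α s : ℤ)
    · obtain ⟨l, hl⟩ := Int.eq_ofNat_of_zero_le (sub_nonneg.2 hα)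
      refine ⟨eps a ^ l * (T α : SField), mul_mem (pow_mem (poly_mem_evalRing _) l) ?_, ?_⟩
      · rw [← eq_ratCast (algebraMap ℚ SField), IsScalarTower.algebraMap_apply ℚ
          (MvPolynomial (Fin 3) ℚ) SField]
        exact poly_mem_evalRing _
      · have : rootDegree c y a + ∑ s, (α s : ℤ) = N + l := by omega
        rw [this, zpow_add₀ hε, zpow_natCast, zpow_natCast]
        ring
    · have hT : T α = 0 := by
        refine sum_root_terms_eq_zero hP hy (by omega) ht hgap α ?_ ?_
        · rcases hN with h | ⟨h, -⟩ <;> omega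
        · intro h0
          rcases hN with h | ⟨-, h⟩
          · omega
          · exact h
      exact ⟨0, zero_mem _, by rw [hT]; simp⟩
  choose x hx hxe using hterm
  refine ⟨∑ α ∈ P.support, ((P.coeff α : evalRing a) : SField) * x α,
    sum_mem fun α _ => mul_mem (P.coeff α).2 (hx α), ?_⟩
  rw [Finset.mul_sum]
  have hexp : ∀ σ, (aeval (fun s σ => eps a * (I (σ s) : SField)) P :
      Equiv.Perm (Fin n) → SField) σ = ∑ α ∈ P.support, ((P.coeff α : evalRing a) : SField) *
        (eps a ^ (∑ s, (α s : ℤ)) * ((∏ s, (I (σ s) : ℚ) ^ α s : ℚ) : SField)) := by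
    intro σ
    rw [aeval_def, eval₂_eq', Finset.sum_apply]
    refine Finset.sum_congr rfl fun α _ => ?_
    rw [Pi.mul_apply, Finset.prod_apply]
    congr 1
    simp only [Pi.pow_apply, mul_pow, Finset.prod_mul_distrib]
    rw [Finset.prod_pow_eq_pow_sum, ← zpow_natCast]
    push_cast
    rfl
  calc _ = ∑ σ ∈ nodePerms c, ∑ α ∈ P.support, ((P.coeff α : evalRing a) : SField) *
        (eps a ^ (rootDegree c y a + ∑ s, (α s : ℤ)) *
          ((rootNumer c y a (fun s => (I (σ s) : ℚ)) /
            rootDenom c y a (fun s => (I (σ s) : ℚ)) * ∏ s, (I (σ s) : ℚ) ^ α s : ℚ) :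
            SField)) := by
        refine Finset.sum_congr rfl fun σ _ => ?_
        rw [AlgHom.toRingHom_eq_coe, RingHom.coe_coe, hexp, Finset.mul_sum]
        refine Finset.sum_congr rfl fun α _ => ?_
        rw [zpow_add₀ hε, Rat.cast_mul]
        ring
    _ = ∑ α ∈ P.support, ((P.coeff α : evalRing a) : SField) *
        (eps a ^ (rootDegree c y a + ∑ s, (α s : ℤ)) * (T α : SField)) := by
        rw [Finset.sum_comm]
        refine Finset.sum_congr rfl fun α _ => ?_
        rw [← Finset.mul_sum, ← Finset.mul_sum, ← Rat.cast_sum]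
    _ = _ := Finset.sum_congr rfl fun α _ => by rw [hxe]; ring

end SumOfWeights

/-! ### Fixed loci and labellings of boxes -/

section Labellings

open MvPolynomial

variable {μ : YoungDiagram} {a : ℕ}

/-- The content `i - j` of a box `(i, j)`. -/
def Box.content (b : Box μ) : ℤ := b.1.1 - b.1.2

variable (a) in
/-- The number `a i - h`, for a box `(i, j)` of height `h`. After the substitution
`t₃ = (t₁t₂)^(1/a)`, the box and its height contribute `(t₁t₂)^((a i - h)/a) t₂^(j - i)`. -/
def FixedLocus.level (L : FixedLocus μ) (b : Box μ) : ℤ := a * b.1.1 - L.height b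

variable (a) in
/-- The exponent of the contribution of a box to the restriction of the character. -/
def fracExponent (y c : ℤ) : ℚ × ℚ := ((y : ℚ) / a, (y : ℚ) / a - c)

theorem fracExponent_inj (ha : 0 < a) {y c y' c' : ℤ} :
    fracExponent a y c = fracExponent a y' c' ↔ y = y' ∧ c = c' := by
  have ha' : (a : ℚ) ≠ 0 := by exact_mod_cast ha.ne'
  constructor
  · intro h
    have h1 := congrArg Prod.fst h
    have h2 := congrArg Prod.snd h
    simp only [fracExponent] at h1 h2
    rw [h1, sub_right_inj] at h2
    rw [div_left_inj' ha'] at h1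
    exact ⟨by exact_mod_cast h1, by exact_mod_cast h2⟩
  · rintro ⟨rfl, rfl⟩
    rfl

theorem substT3_slice (ha : 0 < a) (L : FixedLocus μ) : substT3 a L.slice =
    ∑ b : Box μ, AddMonoidAlgebra.single (fracExponent a (L.level a b) (Box.content b)) 1 := by
  have ha' : (a : ℚ) ≠ 0 := by exact_mod_cast ha.ne'
  rw [L.slice_eq, map_sum]
  refine Finset.sum_congr rfl fun b _ => ?_
  rw [tmon, substT3, AddMonoidAlgebra.mapDomainRingHom_apply, AddMonoidAlgebra.mapDomain_single]
  congr 1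
  simp only [AddMonoidHom.coe_mk, ZeroHom.coe_mk, fracExponent, FixedLocus.level, Box.content,
    Matrix.cons_val_zero, Matrix.cons_val_one, Matrix.cons_val]
  ext
  · simp only
    push_cast
    field_simp
    ring
  · simp only
    push_cast
    field_simp
    ring

variable {n : ℕ}

/-- The boxes, listed by increasing level with respect to a fixed locus. -/
theorem exists_sorted_boxes (L : FixedLocus μ) :
    ∃ e : Fin (Fintype.card (Box μ)) ≃ Box μ, Monotone fun s => L.level a (e s) :=
  ⟨(Tuple.sort fun s => L.level a ((Fintype.equivFin (Box μ)).symm s)).trans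
    (Fintype.equivFin (Box μ)).symm,
    Tuple.monotone_sort fun s => L.level a ((Fintype.equivFin (Box μ)).symm s)⟩

theorem isPartition_boxes (e : Fin n ≃ Box μ) :
    IsPartition (fun s => ((e s).1.1 : ℤ)) (fun s => Box.content (e s)) where
  nonneg s := by positivity
  content_le s := by simp only [Box.content]; omega
  inj s s' h h' := by
    simp only [Box.content] at h h'
    exact e.injective (Subtype.ext (Prod.ext (by omega) (by omega)))
  down s i j hi hi' hj hj' := by
    obtain ⟨i, rfl⟩ := Int.eq_ofNat_of_zero_le hi
    obtain ⟨j, rfl⟩ := Int.eq_ofNat_of_zero_le hj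
    have hi' : (i : ℤ) ≤ (e s).1.1 := hi'
    have hj' : (j : ℤ) ≤ (e s).1.1 - ((e s).1.1 - (e s).1.2) := hj'
    have hle : (i, j) ≤ (e s).1 := ⟨by simp only; omega, by simp only; omega⟩
    have hmem : (i, j) ∈ μ := μ.isLowerSet hle (e s).2
    refine ⟨e.symm ⟨(i, j), hmem⟩, ?_, ?_⟩ <;> simp [Box.content]

/-- The labellings of the boxes of a fixed locus `L` by slots of given contents and levels. -/
def labellings (e : Fin n ≃ Box μ) (y : Fin n → ℤ) (a : ℕ) (L : FixedLocus μ) :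
    Finset (Equiv.Perm (Fin n)) := by
  classical
  exact (nodePerms fun s => Box.content (e s)).filter fun σ => ∀ s, L.level a (e (σ s)) = y s

theorem mem_labellings {e : Fin n ≃ Box μ} {y : Fin n → ℤ} {L : FixedLocus μ}
    {σ : Equiv.Perm (Fin n)} : σ ∈ labellings e y a L ↔
      (∀ s, Box.content (e (σ s)) = Box.content (e s)) ∧ ∀ s, L.level a (e (σ s)) = y s := by
  classical
  rw [labellings, Finset.mem_filter, mem_nodePerms]

theorem eq_of_mem_labellings {e : Fin n ≃ Box μ} {y : Fin n → ℤ} {L L' : FixedLocus μ}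
    {σ : Equiv.Perm (Fin n)} (h : σ ∈ labellings e y a L) (h' : σ ∈ labellings e y a L') :
    L = L' := by
  rw [mem_labellings] at h h'
  refine FixedLocus.height_injective (funext fun b => ?_)
  obtain ⟨s, rfl⟩ := e.surjective b
  obtain ⟨s, rfl⟩ := σ.surjective s
  have := (h.2 s).trans (h'.2 s).symm
  simp only [FixedLocus.level] at this
  omega

theorem mem_lociOver_of_mem_labellings (ha : 0 < a) {e : Fin n ≃ Box μ} {L L' : FixedLocus μ}
    {σ : Equiv.Perm (Fin n)} (h : σ ∈ labellings e (fun s => L.level a (e s)) a L') :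
    L' ∈ lociOver μ a (substT3 a L.slice) := by
  rw [mem_labellings] at h
  rw [lociOver, Set.mem_ofPred_eq, substT3_slice ha, substT3_slice ha, ← Equiv.sum_comp (σ.trans e),
    ← Equiv.sum_comp e]
  exact Finset.sum_congr rfl fun s _ => by rw [Equiv.trans_apply, h.1, h.2]

/-- Elements of the same `𝒮_f` have the same multiset of contents and levels. -/
theorem labellings_nonempty (ha : 0 < a) (e : Fin n ≃ Box μ) {L L' : FixedLocus μ}
    (h : L' ∈ lociOver μ a (substT3 a L.slice)) :
    (labellings e (fun s => L.level a (e s)) a L').Nonempty := by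
  classical
  rw [lociOver, Set.mem_ofPred_eq, substT3_slice ha, substT3_slice ha, ← Equiv.sum_comp e,
    ← Equiv.sum_comp e] at h
  let κ : FixedLocus μ → Fin n → ℚ × ℚ := fun L s =>
    fracExponent a (L.level a (e s)) (Box.content (e s))
  have hcount : ∀ (L : FixedLocus μ) (v : ℚ × ℚ),
      (∑ s, AddMonoidAlgebra.single (κ L s) (1 : ℤ)).coeff v =
        Fintype.card {s // κ L s = v} := by
    intro L v
    rw [AddMonoidAlgebra.coeff_sum, Finsupp.finsetSum_apply, Fintype.card_subtype,
      Finset.card_filter]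
    push_cast
    refine Finset.sum_congr rfl fun s _ => ?_
    rw [AddMonoidAlgebra.coeff_single, Finsupp.single_apply]
  have hcard : ∀ v, Fintype.card {s // κ L s = v} = Fintype.card {s // κ L' s = v} := by
    intro v
    have h1 := hcount L v
    have h2 := hcount L' v
    have h3 : (∑ s, AddMonoidAlgebra.single (κ L' s) (1 : ℤ)) =
      ∑ s, AddMonoidAlgebra.single (κ L s) (1 : ℤ) := h
    rw [h3] at h2
    exact_mod_cast h1.symm.trans h2
  let σ : Equiv.Perm (Fin n) := (Equiv.sigmaFiberEquiv (κ L)).symm.trans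
    ((Equiv.sigmaCongrRight fun v => Fintype.equivOfCardEq (hcard v)).trans
      (Equiv.sigmaFiberEquiv (κ L')))
  have hσ : ∀ s, κ L' (σ s) = κ L s := by
    intro s
    exact ((Fintype.equivOfCardEq (hcard (κ L s))) ⟨s, rfl⟩).2
  refine ⟨σ, mem_labellings.2 ⟨fun s => ?_, fun s => ?_⟩⟩
  · exact ((fracExponent_inj ha).1 (hσ s)).2
  · exact ((fracExponent_inj ha).1 (hσ s)).1

/-- All fixed loci in `𝒮_f` have the same number of labellings. -/
theorem card_labellings (ha : 0 < a) (e : Fin n ≃ Box μ) {L L' : FixedLocus μ}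
    (h : L' ∈ lociOver μ a (substT3 a L.slice)) :
    (labellings e (fun s => L.level a (e s)) a L').card =
      (labellings e (fun s => L.level a (e s)) a L).card := by
  obtain ⟨τ, hτ⟩ := labellings_nonempty ha e h
  rw [mem_labellings] at hτ
  symm
  refine Finset.card_bij' (fun σ _ => τ * σ) (fun σ _ => τ⁻¹ * σ) ?_ ?_ ?_ ?_
  · intro σ hσ
    rw [mem_labellings] at hσ ⊢
    exact ⟨fun s => by rw [Equiv.Perm.mul_apply, hτ.1, hσ.1],
      fun s => by rw [Equiv.Perm.mul_apply, hτ.2, hσ.2]⟩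
  · intro σ hσ
    rw [mem_labellings] at hσ ⊢
    have h1 := fun s => hτ.1 (τ⁻¹ s)
    have h2 := fun s => hτ.2 (τ⁻¹ s)
    simp only [Equiv.Perm.inv_def, Equiv.apply_symm_apply] at h1 h2
    exact ⟨fun s => by rw [Equiv.Perm.mul_apply, Equiv.Perm.inv_def, ← h1, hσ.1],
      fun s => by rw [Equiv.Perm.mul_apply, Equiv.Perm.inv_def, ← h2, hσ.2]⟩
  · intro σ _
    simp
  · intro σ _
    simp

theorem finite_lociOver_slice (ha : 0 < a) (L : FixedLocus μ) :
    (lociOver μ a (substT3 a L.slice)).Finite := by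
  classical
  let e := (Fintype.equivFin (Box μ)).symm
  refine (Set.finite_iUnion (f := fun σ : Equiv.Perm (Fin (Fintype.card (Box μ))) =>
    {L' | σ ∈ labellings e (fun s => L.level a (e s)) a L'}) fun σ => ?_).subset fun L' hL' => ?_
  · exact Set.Subsingleton.finite fun L₁ h₁ L₂ h₂ => eq_of_mem_labellings h₁ h₂
  · obtain ⟨σ, hσ⟩ := labellings_nonempty ha e hL'
    exact Set.mem_iUnion.2 ⟨σ, hσ⟩

/-- The heights of a fixed locus increase along rows and columns, thus the singular part of its
weight does not vanish. -/
theorem rootNumer_ne_zero_of_mem_labellings {e : Fin n ≃ Box μ} {y : Fin n → ℤ}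
    {L : FixedLocus μ} {σ : Equiv.Perm (Fin n)} (h : σ ∈ labellings e y a L) :
    rootNumer (fun s => Box.content (e s)) y a (fun s => (((e (σ s)).1.1 : ℤ) : ℚ)) ≠ 0 := by
  rw [mem_labellings] at h
  obtain ⟨hc, hy⟩ := h
  have hle : ∀ s s', (e (σ s)).1.1 ≤ (e (σ s')).1.1 → (e (σ s)).1.2 ≤ (e (σ s')).1.2 →
      L.height (e (σ s)) ≤ L.height (e (σ s')) := fun s s' h h' => L.height_mono ⟨h, h'⟩
  rw [rootNumer, rootProd, rootProd]
  refine mul_ne_zero (mul_ne_zero (mul_ne_zero ?_ ?_) ?_) ?_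
  · refine Finset.prod_ne_zero_iff.2 fun q hq h0 => ?_
    rw [rootSet, Finset.mem_filter] at hq
    have h0' : ((e (σ q.2)).1.1 : ℤ) - (e (σ q.1)).1.1 - 1 = 0 := by exact_mod_cast h0
    have h1 := hc q.1
    have h2 := hc q.2
    have h3 := hy q.1
    have h4 := hy q.2
    have h5 := hle q.1 q.2
    simp only [Box.content, FixedLocus.level] at *
    have h6 : ((e (σ q.2)).1.1 : ℤ) = (e (σ q.1)).1.1 + 1 := by omega
    rw [h6, mul_add] at h4
    have := h5 (by omega) (by omega)
    omega
  · refine Finset.prod_ne_zero_iff.2 fun q hq h0 => ?_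
    rw [rootSet, Finset.mem_filter] at hq
    have h0' : ((e (σ q.2)).1.1 : ℤ) - (e (σ q.1)).1.1 - 0 = 0 := by exact_mod_cast h0
    have h1 := hc q.1
    have h2 := hc q.2
    have h3 := hy q.1
    have h4 := hy q.2
    have h5 := hle q.1 q.2
    simp only [Box.content, FixedLocus.level] at *
    have h6 : ((e (σ q.2)).1.1 : ℤ) = (e (σ q.1)).1.1 := by omega
    rw [h6] at h4
    have := h5 (by omega) (by omega)
    omega
  · refine Finset.prod_ne_zero_iff.2 fun s hs h0 => ?_
    rw [frameLow, Finset.mem_filter] at hs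
    have h0' : ((e (σ s)).1.1 : ℤ) = 0 := by exact_mod_cast h0
    have h3 := hy s
    simp only [FixedLocus.level] at h3
    rw [h0', mul_zero] at h3
    omega
  · refine Finset.prod_ne_zero_iff.2 fun s _ h0 => ?_
    have h0' : -((e (σ s)).1.1 : ℤ) - 1 = 0 := by exact_mod_cast h0
    omega

theorem monotone_of_steps {f : Box μ → ℤ}
    (h1 : ∀ b b' : Box μ, b'.1.1 = b.1.1 + 1 → b'.1.2 = b.1.2 → f b ≤ f b')
    (h2 : ∀ b b' : Box μ, b'.1.1 = b.1.1 → b'.1.2 = b.1.2 + 1 → f b ≤ f b') : Monotone f := by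
  have key : ∀ k : ℕ, ∀ b b' : Box μ, b.1 ≤ b'.1 →
      b'.1.1 - b.1.1 + (b'.1.2 - b.1.2) = k → f b ≤ f b' := by
    intro k
    induction k with
    | zero =>
      rintro b b' ⟨hi, hj⟩ hk
      rw [Subtype.ext (Prod.ext (by omega) (by omega) : b.1 = b'.1)]
    | succ k ih =>
      rintro b b' ⟨hi, hj⟩ hk
      by_cases hlt : b.1.1 < b'.1.1
      · have hmem : (b.1.1 + 1, b.1.2) ∈ μ := μ.isLowerSet (a := b'.1)
          (Prod.mk_le_mk.2 ⟨hlt, hj⟩) b'.2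
        exact (h1 b ⟨_, hmem⟩ rfl rfl).trans
          (ih ⟨_, hmem⟩ b' (Prod.mk_le_mk.2 ⟨hlt, hj⟩) (by simp only; omega))
      · have hlt' : b.1.2 < b'.1.2 := by omega
        have hmem : (b.1.1, b.1.2 + 1) ∈ μ := μ.isLowerSet (a := b'.1)
          (Prod.mk_le_mk.2 ⟨hi, hlt'⟩) b'.2
        exact (h2 b ⟨_, hmem⟩ rfl rfl).trans
          (ih ⟨_, hmem⟩ b' (Prod.mk_le_mk.2 ⟨hi, hlt'⟩) (by simp only; omega))
  exact fun b b' hb => key _ b b' hb rfl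

/-- If the singular part of a labelling does not vanish, then the labelling belongs to a fixed
locus. -/
theorem exists_mem_labellings {e : Fin n ≃ Box μ} {y : Fin n → ℤ} {σ : Equiv.Perm (Fin n)}
    (hσ : σ ∈ nodePerms fun s => Box.content (e s))
    (h : rootNumer (fun s => Box.content (e s)) y a (fun s => (((e (σ s)).1.1 : ℤ) : ℚ)) ≠ 0) :
    ∃ L : FixedLocus μ, σ ∈ labellings e y a L := by
  rw [mem_nodePerms] at hσ
  obtain ⟨v1, v2, v3⟩ := rootNumer_ne_zero (p := fun s => ((e (σ s)).1.1 : ℤ)) h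
  let f : Box μ → ℤ := fun b => a * b.1.1 - y (σ.symm (e.symm b))
  have hf : ∀ s, f (e (σ s)) = a * (e (σ s)).1.1 - y s := fun s => by simp [f]
  have hsur : ∀ b : Box μ, ∃ s, e (σ s) = b := fun b => ⟨σ.symm (e.symm b), by simp⟩
  have hmono : Monotone f := by
    refine monotone_of_steps ?_ ?_
    · intro b b' hi hj
      obtain ⟨s, rfl⟩ := hsur b
      obtain ⟨s', rfl⟩ := hsur b'
      have h1 := hσ s
      have h2 := hσ s'
      have h3 := v1 s s'
      simp only [Box.content] at h1 h2 h3
      rw [hf, hf, hi]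
      push_cast
      have := h3 (by omega) (by omega)
      linarith
    · intro b b' hi hj
      obtain ⟨s, rfl⟩ := hsur b
      obtain ⟨s', rfl⟩ := hsur b'
      have h1 := hσ s
      have h2 := hσ s'
      have h3 := v2 s s'
      simp only [Box.content] at h1 h2 h3
      rw [hf, hf, hi]
      have := h3 (by omega) (by omega)
      linarith
  have hnonneg : ∀ b, 0 ≤ f b := by
    intro b
    have hmem : (0, 0) ∈ μ := μ.isLowerSet (a := b.1)
      (Prod.mk_le_mk.2 ⟨Nat.zero_le _, Nat.zero_le _⟩) b.2
    refine le_trans ?_ (hmono (show (⟨(0, 0), hmem⟩ : Box μ) ≤ b from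
      Prod.mk_le_mk.2 ⟨Nat.zero_le _, Nat.zero_le _⟩))
    obtain ⟨s, hs⟩ := hsur ⟨(0, 0), hmem⟩
    have h1 := hσ s
    have h3 := v3 s
    rw [← hs, hf]
    rw [hs] at h1 h3 ⊢
    simp only [Box.content] at h1 h3 ⊢
    have := h3 (by omega) (by simp)
    simp
    omega
  obtain ⟨L, hL⟩ := FixedLocus.exists_height_eq (fun b => (f b).toNat)
    fun b b' hb => Int.toNat_le_toNat (hmono hb)
  refine ⟨L, mem_labellings.2 ⟨hσ, fun s => ?_⟩⟩
  rw [FixedLocus.level, hL, Int.toNat_of_nonneg (hnonneg _), hf]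
  ring

end Labellings

/-! ### The evaluation of the sums -/

section Evaluation

open MvPolynomial

variable {μ : YoungDiagram} {a k : ℕ}

/-- The sum of the weights over `𝒮_f` has no pole, and it vanishes on the plane if there is a gap
in the levels. -/
theorem exists_weightSum_eq (ha : 0 < a) (i : Fin k → ℕ) (L : FixedLocus μ) {t : ℤ} (ht : t ≤ 0)
    (hgap : ∀ b, t ≤ L.level a b ∨ L.level a b + a < t) {N : ℕ}
    (hN : N = 0 ∨ N = 1 ∧ ∃ b, L.level a b < t) :
    ∃ x ∈ evalRing a, weightSum μ a i (substT3 a L.slice) = eps a ^ N * x := by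
  classical
  obtain ⟨e, he⟩ := exists_sorted_boxes (a := a) L
  have hP := isPartition_boxes e
  set y : Fin (Fintype.card (Box μ)) → ℤ := fun s => L.level a (e s) with hy
  set c : Fin (Fintype.card (Box μ)) → ℤ := fun s => Box.content (e s) with hc
  obtain ⟨H, hH, hw⟩ := exists_descendentWeight_eq (y := y) ha hP e (fun _ => rfl)
    (fun s => by simp only [hc, Box.content]; omega) i
  obtain ⟨x, hx, hsum⟩ := exists_sum_eq_eps_mul (y := y) hP he ht (fun s => hgap _) hH (N := N) (by
    rcases hN with h | ⟨h, b, hb⟩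
    · exact Or.inl h
    · exact Or.inr ⟨h, e.symm b, by simpa [hy] using hb⟩)
  have hfin := finite_lociOver_slice ha L
  set T : Equiv.Perm (Fin (Fintype.card (Box μ))) → SField := fun σ =>
    eps a ^ rootDegree c y a * ((rootNumer c y a (fun s => (((e (σ s)).1.1 : ℤ) : ℚ)) /
      rootDenom c y a (fun s => (((e (σ s)).1.1 : ℤ) : ℚ)) : ℚ) : SField) * H σ with hT
  have hTw : ∀ L' : FixedLocus μ, ∀ σ ∈ labellings e y a L', L'.descendentWeight i = T σ := by
    intro L' σ hσ
    have hσ' := mem_labellings.1 hσ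
    exact hw σ ((mem_nodePerms _).2 hσ'.1) (rootNumer_ne_zero_of_mem_labellings hσ) L'
      fun s => (hσ'.2 s).symm
  -- every labelling with nonzero term belongs to exactly one element of `𝒮_f`
  have hone : ∀ σ ∈ nodePerms c,
      ∑ L' ∈ hfin.toFinset with σ ∈ labellings e y a L', T σ = T σ := by
    intro σ hσ
    by_cases h0 : rootNumer c y a (fun s => (((e (σ s)).1.1 : ℤ) : ℚ)) = 0
    · have : T σ = 0 := by
        simp only [hT]
        rw [h0, zero_div, Rat.cast_zero, mul_zero, zero_mul]
      rw [this, Finset.sum_const_zero]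
    · obtain ⟨L', hL'⟩ := exists_mem_labellings hσ h0
      have : hfin.toFinset.filter (fun L' => σ ∈ labellings e y a L') = {L'} := by
        ext L''
        rw [Finset.mem_filter, Finset.mem_singleton, Set.Finite.mem_toFinset]
        constructor
        · rintro ⟨-, h⟩
          exact eq_of_mem_labellings h hL'
        · rintro rfl
          exact ⟨mem_lociOver_of_mem_labellings ha hL', hL'⟩
      rw [this, Finset.sum_singleton]
  set K := (labellings e y a L).card with hK
  have hK0 : (K : ℚ) ≠ 0 := by
    have := (labellings_nonempty ha e (L := L) (L' := L) rfl).card_pos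
    exact_mod_cast this.ne'
  have hdouble : (K : SField) * weightSum μ a i (substT3 a L.slice) = eps a ^ N * x := by
    rw [← hsum, weightSum, finsum_mem_eq_finite_toFinset_sum _ hfin, Finset.mul_sum]
    calc _ = ∑ L' ∈ hfin.toFinset, ∑ σ ∈ labellings e y a L', T σ := by
          refine Finset.sum_congr rfl fun L' hL' => ?_
          rw [← Finset.sum_congr rfl (hTw L'), Finset.sum_const, nsmul_eq_mul, hK,
            card_labellings ha e (hfin.mem_toFinset.1 hL')]
      _ = ∑ σ ∈ nodePerms c, ∑ L' ∈ hfin.toFinset with σ ∈ labellings e y a L', T σ := by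
          refine Finset.sum_comm' fun L' σ => ?_
          rw [Finset.mem_filter]
          refine ⟨fun h => ⟨h, (mem_nodePerms _).2 (mem_labellings.1 h.2).1⟩, fun h => h.1⟩
      _ = _ := Finset.sum_congr rfl hone
  have hK1 : IsEvalUnit a (K : SField) := by
    have := IsEvalUnit.ratCast (a := a) hK0
    rwa [Rat.cast_natCast] at this
  refine ⟨(K : SField)⁻¹ * x, mul_mem hK1.inv.mem hx, ?_⟩
  rw [mul_left_comm, ← hdouble, inv_mul_cancel_left₀ hK1.ne_zero]

/-- If the levels are not bounded from below by `-a(n+1)`, where `n` is the number of boxes, then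
there is a gap in the levels. -/
theorem exists_gap (ha : 0 < a) (L : FixedLocus μ) (b₀ : Box μ)
    (hb₀ : L.level a b₀ < -(a * (Fintype.card (Box μ) + 1))) :
    ∃ t ≤ 0, (∀ b, t ≤ L.level a b ∨ L.level a b + a < t) ∧ ∃ b, L.level a b < t := by
  have ha' : (0 : ℤ) < a := by exact_mod_cast ha
  by_contra! h
  -- otherwise each of the `n + 1` intervals `[-a(j+1), -aj)` contains a level
  have key : ∀ j : Fin (Fintype.card (Box μ) + 1), ∃ b,
      L.level a b < -(a * (j : ℤ)) ∧ -(a * ((j : ℤ) + 1)) ≤ L.level a b := by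
    intro j
    by_contra! hj
    have hj' : (a : ℤ) * j ≤ a * (Fintype.card (Box μ) + 1) :=
      mul_le_mul_of_nonneg_left (by have := j.2; omega) ha'.le
    have := h (-(a * (j : ℤ))) (by simp; positivity) (fun b => ?_) b₀
    · omega
    · have := hj b
      rw [mul_add, mul_one] at this
      by_cases hb : -(a * (j : ℤ)) ≤ L.level a b
      · exact Or.inl hb
      · exact Or.inr (by have := this (by omega); omega)
  choose g hg1 hg2 using key
  have hinj : Function.Injective g := by
    have hlt : ∀ j j' : Fin (Fintype.card (Box μ) + 1), j < j' → g j ≠ g j' := by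
      intro j j' hlt heq
      have h1 := hg2 j
      have h2 := hg1 j'
      rw [← heq] at h2
      have : (a : ℤ) * (j + 1) ≤ a * j' :=
        mul_le_mul_of_nonneg_left (by have : (j : ℕ) < j' := hlt; omega) ha'.le
      omega
    intro j j' heq
    rcases lt_trichotomy j j' with hj | hj | hj
    · exact absurd heq (hlt _ _ hj)
    · exact hj
    · exact absurd heq.symm (hlt _ _ hj)
  have := Fintype.card_le_of_injective g hinj
  rw [Fintype.card_fin] at this
  omega

theorem weightSum_eq_zero_of_empty (i : Fin k → ℕ) {f : FracLaurent} (hf : lociOver μ a f = ∅) :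
    weightSum μ a i f = 0 := by
  rw [weightSum, hf, finsum_mem_empty]

theorem weightSum_mem_evalRing (ha : 0 < a) (i : Fin k → ℕ) (f : FracLaurent) :
    weightSum μ a i f ∈ evalRing a := by
  rcases Set.eq_empty_or_nonempty (lociOver μ a f) with hf | ⟨L, rfl⟩
  · rw [weightSum_eq_zero_of_empty i hf]
    exact zero_mem _
  · obtain ⟨t, ht⟩ := (Set.finite_range (L.level a)).bddBelow
    have ht' : ∀ b, t ≤ L.level a b := fun b => ht ⟨b, rfl⟩
    obtain ⟨x, hx, h⟩ := exists_weightSum_eq ha i L (min_le_right t 0)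
      (fun b => Or.inl ((min_le_left _ _).trans (ht' b))) (Or.inl rfl)
    rw [h, pow_zero, one_mul]
    exact hx

theorem finite_lociOver (ha : 0 < a) (f : FracLaurent) : (lociOver μ a f).Finite := by
  rcases Set.eq_empty_or_nonempty (lociOver μ a f) with hf | ⟨L, rfl⟩
  · rw [hf]
    exact Set.finite_empty
  · exact finite_lociOver_slice ha L

theorem finite_not_hasEvaluation_zero (ha : 0 < a) (i : Fin k → ℕ) :
    {f | ¬ HasEvaluation a (weightSum μ a i f) 0}.Finite := by
  -- the heights of the loci without a level less than `-a(n+1)` are bounded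
  let N : Box μ → ℕ := fun b => a * b.1.1 + a * (Fintype.card (Box μ) + 1)
  have hfin : {L : FixedLocus μ | L.height ∈ Set.Icc 0 N}.Finite :=
    (Set.finite_Icc 0 N).preimage FixedLocus.height_injective.injOn
  refine (hfin.image fun L => substT3 a L.slice).subset fun f hf => ?_
  rcases Set.eq_empty_or_nonempty (lociOver μ a f) with he | ⟨L, rfl⟩
  · refine absurd ?_ hf
    have := hasEvaluation_zero ha (zero_mem (evalRing a))
    rwa [mul_zero, ← weightSum_eq_zero_of_empty i he] at this
  · refine ⟨L, ⟨fun b => Nat.zero_le _, fun b => ?_⟩, rfl⟩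
    by_contra! hb
    obtain ⟨t, ht, hgap, hlt⟩ := exists_gap ha L b (by
      simp only [N] at hb
      have : ((a * b.1.1 + a * (Fintype.card (Box μ) + 1) : ℕ) : ℤ) < L.height b := by
        exact_mod_cast hb
      push_cast at this
      rw [FixedLocus.level]
      linarith)
    obtain ⟨x, hx, h⟩ := exists_weightSum_eq ha i L ht hgap (N := 1) (Or.inr ⟨rfl, hlt⟩)
    refine hf ?_
    rw [h, pow_one]
    exact hasEvaluation_zero ha hx

end Evaluation

end OneLeg

end

theorem proposition4p2 (μ : YoungDiagram) (k : ℕ) (i : Fin k → ℕ) (a : ℕ) (ha : 0 < a) :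
    (∀ f ∈ OneLeg.fracRing a, (OneLeg.lociOver μ a f).Finite ∧
      ∃! y : FractionRing (MvPolynomial (Fin 2) ℚ),
        OneLeg.HasEvaluation a (OneLeg.weightSum μ a i f) y) ∧
    {f | f ∈ OneLeg.fracRing a ∧
      ¬ OneLeg.HasEvaluation a (OneLeg.weightSum μ a i f) 0}.Finite :=
  ⟨fun f _ => ⟨OneLeg.finite_lociOver ha f,
    OneLeg.existsUnique_hasEvaluation (OneLeg.weightSum_mem_evalRing ha i f)⟩,
    (OneLeg.finite_not_hasEvaluation_zero ha i).subset fun _ hf => hf.2⟩
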